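/- \textbf{Conventions.} Manifolds are smooth, finite-dimensional, Hausdorff and second countable, without boundary. A $\mathbb Z$-graded vector bundle $V_\bullet\to M$ is a family $(V_i)_{i\in\mathbb Z}$ of real smooth vector bundles of finite rank over $M$; sections of $V_i^*$ have degree $-i$, and $V[1]_i:=V_{i+1}$. A morphism $V_\bullet\to W_\bullet$ over $\phi:M\to N$ is a family of vector bundle morphisms $V_i\to W_i$ over $\phi$. We write $T[1]M$ also for the graded vector bundle with $TM$ in degree $-1$ and $0$ elsewhere, and $T[1]\phi$ for the tangent map of $\phi$. Let $\Gamma(SV_\bullet^*)$ be the graded-commutative $\mathbb Z$-graded algebra whose degree $k$ part consists of the sections of degree $k$ of the bundle of graded symmetric algebras of $V_\bullet^*$ which are locally polynomials in smooth functions and smooth sections of the bundles $V_i^*$. A $\mathbb Z$-graded manifold $\mathcal M$ is given by its function algebra $C(\mathcal M)$, a graded-commutative $\mathbb Z$-graded algebra isomorphic to $\Gamma(SV_\bullet^*)$ for some $V_\bullet\to M$; morphisms $\mathcal M\to\mathcal N$ are morphisms of graded algebras $C(\mathcal N)\to C(\mathcal M)$. Let $\mathfrak S(V_\bullet)$ be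 the graded manifold with $C(\mathfrak S(V_\bullet))=\Gamma(SV_\bullet^*)$; a morphism $L:V_\bullet\to W_\bullet$ induces $\mathfrak S(L):\mathfrak S(V_\bullet)\to\mathfrak S(W_\bullet)$. Let $C(D)=\mathbb R[\epsilon]/(\epsilon^2)$ with $\deg\epsilon=-1$. For a graded manifold $\mathcal X$ let $T[1]\mathcal X=\mathrm{Hom}(D,\mathcal X)$ be the presheaf $\mathcal T\mapsto\hom(D\times\mathcal T,\mathcal X)$ on graded manifolds, where $\hom(D\times\mathcal T,\mathcal X)$ is the set of morphisms of graded algebras $\Psi=\Psi_0+\epsilon\Psi_1:C(\mathcal X)\to C(D)\otimes C(\mathcal T)$ (graded tensor product). It is functorial in $\mathcal X$. A connection on a vector bundle $V$ is a smooth splitting $s:V\to J^1V$ of the projection $J^1V\to V$ from the first jet bundle; a connection on $V_\bullet^*$ is a family of connections $s_i$ on $V_i^*$. Let $L:E_\bullet\to F_\bullet$ be a morphism over $\phi:M\to N$, let $L^*:(F_i^*)_{\phi(x)}\to (E_i^*)_x$ be the dual comorphism and $J^1L^*:(J^1F_i^*)_{\phi(x)}\to(J^1E_i^*)_x$ the comorphism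 which it induces on jets. Connections $s$ on $E_\bullet^*$ and $s'$ on $F_\bullet^*$ are compatible if $J^1L^*\circ s'=s\circ L^*$ in every degree. A connection $s$ on $V_\bullet^*$ induces a splitting $$sp_s:\ T[1]\mathfrak S(V_\bullet)\ \cong\ \hom(-,\mathfrak S(V_\bullet\oplus T[1]M\oplus V[1]_\bullet))$$ as follows. An isomorphism of presheaves of this form is said to be \emph{induced by $s$} if, for every $\mathcal T$ and every $\Psi=\Psi_0+\epsilon\Psi_1$, it sends $\Psi$ to the algebra morphism which equals $\Psi_0$ on $C^\infty(M)$ and on $\Gamma(V_i^*)$, sends $df$, viewed as a section of $(T[1]M)^*$, to $\Psi_1(f)$ for $f\in C^\infty(M)$, and sends $\sigma\in\Gamma(V_{i+1}^*)=\Gamma((V[1]_i)^*)$ to $J^1\Psi_1(s\circ\sigma)$. Here $J^1\Psi_1:\Gamma(J^1V_{i+1}^*)\to C(\mathcal T)$ is an additive, $\mathbb R$-linear map with $J^1\Psi_1(f\theta)=\Psi_0(f)\,J^1\Psi_1(\theta)$ for $f\in C^\infty(M)$ and $J^1\Psi_1(j^1\tau)=\Psi_1(\tau)$. \textbf{Theorem.}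 Let $L:E_\bullet\to F_\bullet$ be a morphism of $\mathbb Z$-graded vector bundles over $\phi:M\to N$, and let $s$, $s'$ be connections on $E_\bullet^*$, $F_\bullet^*$ that are compatible with respect to the dual comorphism of $L$. Then there are a unique splitting $sp_s$ of $T[1]\mathfrak S(E_\bullet)$ induced by $s$ and a unique splitting $sp_{s'}$ of $T[1]\mathfrak S(F_\bullet)$ induced by $s'$, and $T[1]\mathfrak S(L):T[1]\mathfrak S(E_\bullet)\to T[1]\mathfrak S(F_\bullet)$ respects them, acting as $L\oplus T[1]\phi\oplus L[1]$: $$sp_{s'}\circ T[1]\mathfrak S(L)=\mathfrak S\bigl(L\oplus T[1]\phi\oplus L[1]\bigr)\circ sp_s .$$ -/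

import Mathlib

open scoped Manifold ContDiff Bundle TensorProduct DirectSum Topology
open CategoryTheory

noncomputable section

namespace GradedGeometry

/-! ### Manifolds and vector bundles -/

/-- A smooth manifold: finite-dimensional, Hausdorff, second countable, without boundary. -/
structure Mfd : Type 1 where
  dim : ℕ
  carrier : Type
  [top : TopologicalSpace carrier]
  [charted : ChartedSpace (EuclideanSpace ℝ (Fin dim)) carrier]
  [smooth : IsManifold (𝓡 dim) ∞ carrier]
  [t2 : T2Space carrier]
  [sc : SecondCountableTopology carrier]

instance : CoeSort Mfd Type := ⟨Mfd.carrier⟩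

attribute [instance] Mfd.top Mfd.charted Mfd.smooth Mfd.t2 Mfd.sc

/-- Smooth real-valued functions. -/
abbrev Mfd.Fun (M : Mfd) : Type := C^∞⟮𝓡 M.dim, M; 𝓘(ℝ, ℝ), ℝ⟯

/-- Smooth maps. -/
abbrev Mfd.Map (M N : Mfd) : Type := C^∞⟮𝓡 M.dim, M; 𝓡 N.dim, N⟯

/-- A smooth real vector bundle of finite rank. -/
structure VB (M : Mfd) : Type 1 where
  F : Type
  fib : M → Type
  [normF : NormedAddCommGroup F]
  [spaceF : NormedSpace ℝ F]
  [finF : FiniteDimensional ℝ F]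
  [acg : ∀ x, AddCommGroup (fib x)]
  [mod : ∀ x, Module ℝ (fib x)]
  [topFib : ∀ x, TopologicalSpace (fib x)]
  [tag : ∀ x, IsTopologicalAddGroup (fib x)]
  [csm : ∀ x, ContinuousSMul ℝ (fib x)]
  [topTot : TopologicalSpace (Bundle.TotalSpace F fib)]
  [fb : FiberBundle F fib]
  [vb : VectorBundle ℝ F fib]
  [smooth : ContMDiffVectorBundle ∞ F fib (𝓡 M.dim)]

attribute [instance] VB.normF VB.spaceF VB.finF VB.acg VB.mod VB.topFib VB.tag VB.csm VB.topTot
  VB.fb VB.vb VB.smooth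

namespace VB

variable {M N : Mfd}

abbrev Tot (V : VB M) : Type := Bundle.TotalSpace V.F V.fib

/-- Smooth sections. -/
abbrev Sec (V : VB M) : Type := Cₛ^∞⟮𝓡 M.dim; V.F, V.fib⟯

/-- The dual bundle. -/
def dual (V : VB M) : VB M where
  F := V.F →L[ℝ] ℝ
  fib := fun x => V.fib x →L[ℝ] Bundle.Trivial M ℝ x

/-- The direct sum of two vector bundles over the same base. -/
def sum (V W : VB M) : VB M where
  F := V.F × W.F
  fib := V.fib ×ᵇ W.fib

/-- The vector bundle of rank zero. -/
def zero (M : Mfd) : VB M where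
  F := PUnit
  fib := Bundle.Trivial M PUnit
  tag := fun _ => inferInstanceAs (IsTopologicalAddGroup PUnit)
  csm := fun _ => inferInstanceAs (ContinuousSMul ℝ PUnit)

/-- The tangent bundle. -/
def tangent (M : Mfd) : VB M where
  F := EuclideanSpace ℝ (Fin M.dim)
  fib := fun x => TangentSpace (𝓡 M.dim) x
  tag := fun _ => inferInstanceAs (IsTopologicalAddGroup (EuclideanSpace ℝ (Fin M.dim)))
  csm := fun _ => inferInstanceAs (ContinuousSMul ℝ (EuclideanSpace ℝ (Fin M.dim)))

/-- Multiplication of a section by a smooth function. -/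
def smulSec (V : VB M) (f : M.Fun) (σ : V.Sec) : V.Sec :=
  ⟨fun x => f x • σ x, f.contMDiff.smul_section σ.contMDiff⟩

/-- A morphism `V → W` of vector bundles over `φ : M → N`. -/
structure Hom (V : VB M) (W : VB N) (φ : M.Map N) where
  app : ∀ x, V.fib x →L[ℝ] W.fib (φ x)
  smooth : ContMDiff ((𝓡 M.dim).prod 𝓘(ℝ, V.F)) ((𝓡 N.dim).prod 𝓘(ℝ, W.F)) ∞
    (fun p : V.Tot => (⟨φ p.1, app p.1 p.2⟩ : W.Tot))


/-- A covector at `x`, as a linear functional on the fibre. -/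
def functional {V : VB M} {x : M} (ξ : V.dual.fib x) : V.fib x →L[ℝ] ℝ := ξ

/-- A linear functional on the fibre, as a covector at `x`. -/
def covector {V : VB M} {x : M} (ξ : V.fib x →L[ℝ] ℝ) : V.dual.fib x := ξ

/-- A family of fibrewise linear functionals is a smooth section of the dual bundle as soon as it is
smooth as a function on the total space. -/
theorem dual_smooth (V : VB M) (ξ : ∀ x, V.dual.fib x)
    (h : ContMDiff ((𝓡 M.dim).prod 𝓘(ℝ, V.F)) 𝓘(ℝ, ℝ) ∞
      (fun p : V.Tot => functional (ξ p.1) p.2)) :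
    ContMDiff (𝓡 M.dim) ((𝓡 M.dim).prod 𝓘(ℝ, V.dual.F)) ∞ (fun x => (⟨x, ξ x⟩ : V.dual.Tot)) := by
  intro x₀
  refine (contMDiffAt_hom_bundle (F₁ := V.F) (E₁ := V.fib) (F₂ := ℝ)
    (E₂ := Bundle.Trivial M ℝ) _).2 ⟨contMDiffAt_id, ?_⟩
  set e := trivializationAt V.F V.fib x₀
  have hx₀ : x₀ ∈ e.baseSet := FiberBundle.mem_baseSet_trivializationAt' x₀
  have key : ∀ v : V.F, ContMDiffAt (𝓡 M.dim) 𝓘(ℝ, ℝ) ∞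
      (fun x => functional (ξ x) (e.symmL ℝ x v)) x₀ := by
    intro v
    have h1 : ContMDiffAt (𝓡 M.dim) ((𝓡 M.dim).prod 𝓘(ℝ, V.F)) ∞
        (fun x => (⟨x, e.symmL ℝ x v⟩ : V.Tot)) x₀ := by
      refine (Bundle.Trivialization.contMDiffAt_section_iff (e := e) hx₀).2 ?_
      refine (contMDiffAt_const (c := v)).congr_of_eventuallyEq ?_
      filter_upwards [e.open_baseSet.mem_nhds hx₀] with x hx
      simp [e.symmL_apply hx, e.apply_mk_symm hx]
    exact (h _).comp x₀ h1
  let b := Module.finBasis ℝ V.F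
  let ψ : (Fin (Module.finrank ℝ V.F) → ℝ) →L[ℝ] (V.F →L[ℝ] ℝ) :=
    LinearMap.toContinuousLinearMap
      ((LinearMap.toContinuousLinearMap (𝕜 := ℝ) (E := V.F) (F' := ℝ)).toLinearMap ∘ₗ
        (b.constr ℝ).toLinearMap)
  have hs : ContMDiffAt (𝓡 M.dim) 𝓘(ℝ, Fin (Module.finrank ℝ V.F) → ℝ) ∞
      (fun x i => functional (ξ x) (e.symmL ℝ x (b i))) x₀ :=
    contMDiffAt_pi_space.2 fun i => key (b i)
  refine (ψ.contMDiff.contMDiffAt.comp x₀ hs).congr_of_eventuallyEq ?_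
  filter_upwards [e.open_baseSet.mem_nhds hx₀] with x hx
  refine (ContinuousLinearMap.inCoordinates_eq (F := V.F) (E := V.fib) (F' := ℝ)
    (E' := Bundle.Trivial M ℝ) (y₀ := x₀) (y := x) (ϕ := functional (ξ x)) hx
    (Set.mem_univ _)).trans ?_
  apply ContinuousLinearMap.coe_injective
  apply b.ext
  intro i
  simp [ψ, e]
  exact congrArg _ (e.symmL_apply hx _).symm

/-- The function on the total space given by a section of the dual bundle. -/
theorem dual_smooth_total (V : VB M) (ξ : V.dual.Sec) :
    ContMDiff ((𝓡 M.dim).prod 𝓘(ℝ, V.F)) 𝓘(ℝ, ℝ) ∞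
      (fun p : V.Tot => functional (ξ p.1) p.2) := by
  have h1 : ContMDiff ((𝓡 M.dim).prod 𝓘(ℝ, V.F)) ((𝓡 M.dim).prod 𝓘(ℝ, V.dual.F)) ∞
      (fun p : V.Tot => (⟨p.1, ξ p.1⟩ : V.dual.Tot)) :=
    ξ.contMDiff.comp (Bundle.contMDiff_proj V.fib)
  have h2 := ContMDiff.clm_bundle_apply (F₁ := V.F) (E₁ := V.fib) (F₂ := ℝ)
    (E₂ := Bundle.Trivial M ℝ) (b := fun p : V.Tot => p.1) (v := fun p => p.2) h1 contMDiff_id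
  intro p
  exact ((Bundle.contMDiffAt_totalSpace).1 (h2 p)).2

theorem sum_fst_smooth (V W : VB M) :
    ContMDiff ((𝓡 M.dim).prod 𝓘(ℝ, (V.sum W).F)) ((𝓡 M.dim).prod 𝓘(ℝ, V.F)) ∞
      (fun p : (V.sum W).Tot => (⟨p.1, p.2.1⟩ : V.Tot)) := by
  intro p
  have h := Bundle.contMDiffAt_totalSpace.1
    (contMDiffAt_id (I := (𝓡 M.dim).prod 𝓘(ℝ, (V.sum W).F)) (n := ∞) (x := p))
  exact Bundle.contMDiffAt_totalSpace.2 ⟨h.1,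
    (ContinuousLinearMap.fst ℝ V.F W.F).contMDiff.contMDiffAt.comp p h.2⟩

theorem sum_snd_smooth (V W : VB M) :
    ContMDiff ((𝓡 M.dim).prod 𝓘(ℝ, (V.sum W).F)) ((𝓡 M.dim).prod 𝓘(ℝ, W.F)) ∞
      (fun p : (V.sum W).Tot => (⟨p.1, p.2.2⟩ : W.Tot)) := by
  intro p
  have h := Bundle.contMDiffAt_totalSpace.1
    (contMDiffAt_id (I := (𝓡 M.dim).prod 𝓘(ℝ, (V.sum W).F)) (n := ∞) (x := p))
  exact Bundle.contMDiffAt_totalSpace.2 ⟨h.1,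
    (ContinuousLinearMap.snd ℝ V.F W.F).contMDiff.contMDiffAt.comp p h.2⟩

namespace Hom

variable {φ : M.Map N}

/-- The section `x ↦ σ(φ x) ∘ L_x` of `V*` obtained from a section `σ` of `W*`. -/
def pullSec {V : VB M} {W : VB N} (L : Hom V W φ) (σ : W.dual.Sec) : V.dual.Sec :=
  ⟨fun x => covector ((functional (σ (φ x))).comp (L.app x)),
    dual_smooth V _ ((dual_smooth_total W σ).comp L.smooth)⟩

/-- The direct sum of two morphisms over the same base map. -/
def sum {V V' : VB M} {W W' : VB N} (L : Hom V W φ) (L' : Hom V' W' φ) :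
    Hom (V.sum V') (W.sum W') φ where
  app := fun x => (L.app x).prodMap (L'.app x)
  smooth := by
    intro p
    have h := Bundle.contMDiffAt_totalSpace.1 ((L.smooth.comp (sum_fst_smooth V V')) p)
    have h' := Bundle.contMDiffAt_totalSpace.1 ((L'.smooth.comp (sum_snd_smooth V V')) p)
    exact Bundle.contMDiffAt_totalSpace.2 ⟨h.1, h.2.prodMk_space h'.2⟩

/-- The morphism between bundles of rank zero. -/
def zero (φ : M.Map N) : Hom (VB.zero M) (VB.zero N) φ where
  app := fun _ => 0
  smooth := by
    exact (Bundle.contMDiff_zeroSection ℝ (VB.zero N).fib).comp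
      (φ.contMDiff.comp (Bundle.contMDiff_proj (VB.zero M).fib))

/-- The tangent map. -/
def tangent (φ : M.Map N) : Hom (VB.tangent M) (VB.tangent N) φ where
  app := fun x => mfderiv (𝓡 M.dim) (𝓡 N.dim) φ x
  smooth := φ.contMDiff.contMDiff_tangentMap (m := ∞) (by simp)

/-- Projection of a direct sum to its first summand. -/
def fst (V W : VB M) : Hom (V.sum W) V ContMDiffMap.id where
  app := fun x => ContinuousLinearMap.fst ℝ (V.fib x) (W.fib x)
  smooth := sum_fst_smooth V W

/-- Projection of a direct sum to its second summand. -/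
def snd (V W : VB M) : Hom (V.sum W) W ContMDiffMap.id where
  app := fun x => ContinuousLinearMap.snd ℝ (V.fib x) (W.fib x)
  smooth := sum_snd_smooth V W

end Hom

/-- The differential of a smooth function, as a section of the cotangent bundle. -/
def d (f : M.Fun) : (VB.tangent M).dual.Sec :=
  ⟨fun x => covector (V := VB.tangent M) (mfderiv (𝓡 M.dim) 𝓘(ℝ, ℝ) f x),
    dual_smooth (VB.tangent M) _ (by
      have h := f.contMDiff.contMDiff_tangentMap (m := ∞) (by simp)
      exact (contMDiff_snd_tangentBundle_modelSpace ℝ 𝓘(ℝ, ℝ)).comp h)⟩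

end VB

/-! ### Graded vector bundles -/

/-- A `ℤ`-graded vector bundle, of finite rank in each degree. -/
abbrev GVB (M : Mfd) : Type 1 := ℤ → VB M

namespace GVB

variable {M N : Mfd}

/-- `T[1]M` as a graded vector bundle: the tangent bundle placed in degree `-1`. -/
def shiftedTangent (M : Mfd) : GVB M
  | Int.negSucc 0 => VB.tangent M
  | _ => VB.zero M

/-- The graded vector bundle `V ⊕ T[1]M ⊕ V[1]`, where `V[1]ᵢ = Vᵢ₊₁`. -/
def T1 (V : GVB M) : GVB M := fun i => (V i).sum ((shiftedTangent M i).sum (V (i + 1)))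

/-- A morphism of graded vector bundles over `φ`. -/
abbrev Hom (E : GVB M) (F : GVB N) (φ : M.Map N) : Type := ∀ i, VB.Hom (E i) (F i) φ

/-- The morphism `T[1]φ : T[1]M → T[1]N`. -/
def shiftedTangentMap (φ : M.Map N) : Hom (shiftedTangent M) (shiftedTangent N) φ
  | Int.negSucc 0 => VB.Hom.tangent φ
  | Int.negSucc (_ + 1) => VB.Hom.zero φ
  | Int.ofNat _ => VB.Hom.zero φ

/-- The morphism `L ⊕ T[1]φ ⊕ L[1]`. -/
def Hom.T1 {E : GVB M} {F : GVB N} {φ : M.Map N} (L : Hom E F φ) : Hom E.T1 F.T1 φ :=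
  fun i => (L i).sum ((shiftedTangentMap φ i).sum (L (i + 1)))

end GVB

/-! ### Graded symmetric algebras of graded real vector spaces -/

section GSym

variable {ι : Type} [DecidableEq ι] (deg : ι → ℤ) (P : ι → Type) [∀ i, AddCommGroup (P i)]
  [∀ i, Module ℝ (P i)]

/-- Graded commutativity of the generators: `a b = (-1)^{|a||b|} b a`. -/
inductive GSym.Rel : TensorAlgebra ℝ (⨁ i, P i) → TensorAlgebra ℝ (⨁ i, P i) → Prop
  | swap (i j : ι) (a : P i) (b : P j) :
      GSym.Rel
        (TensorAlgebra.ι ℝ (DirectSum.lof ℝ ι P i a) * TensorAlgebra.ι ℝ (DirectSum.lof ℝ ι P j b))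
        ((-1 : ℤˣ) ^ (deg i * deg j) •
          (TensorAlgebra.ι ℝ (DirectSum.lof ℝ ι P j b) *
            TensorAlgebra.ι ℝ (DirectSum.lof ℝ ι P i a)))

/-- The graded symmetric algebra of the graded vector space `⨁ᵢ Pᵢ` with `Pᵢ` in degree `deg i`. -/
def GSym : Type := RingQuot (GSym.Rel deg P)

namespace GSym

instance : Ring (GSym deg P) := inferInstanceAs (Ring (RingQuot (GSym.Rel deg P)))
instance : Algebra ℝ (GSym deg P) := inferInstanceAs (Algebra ℝ (RingQuot (GSym.Rel deg P)))

/-- The quotient map. -/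
def mk : TensorAlgebra ℝ (⨁ i, P i) →ₐ[ℝ] GSym deg P := RingQuot.mkAlgHom ℝ (GSym.Rel deg P)

/-- The inclusion of the generators. -/
def gen (i : ι) : P i →ₗ[ℝ] GSym deg P :=
  (mk deg P).toLinearMap ∘ₗ TensorAlgebra.ι ℝ ∘ₗ DirectSum.lof ℝ ι P i

theorem gen_mul_gen (i j : ι) (a : P i) (b : P j) :
    gen deg P i a * gen deg P j b = (-1 : ℤˣ) ^ (deg i * deg j) • (gen deg P j b * gen deg P i a) := by
  have h := RingQuot.mkAlgHom_rel ℝ (GSym.Rel.swap (deg := deg) i j a b)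
  rw [map_mul] at h
  refine h.trans ?_
  rw [Units.smul_def, Units.smul_def, map_zsmul, map_mul]
  rfl

/-- The monomial given by a list of generators. -/
def monomial (l : List (Σ i, P i)) : GSym deg P := (l.map fun p => gen deg P p.1 p.2).prod

/-- The degree of a monomial: the sum of the degrees of its factors. -/
def monomialDeg (l : List (Σ i, P i)) : ℤ := (l.map fun p => deg p.1).sum

/-- The homogeneous elements of degree `n`. -/
def homog (n : ℤ) : Submodule ℝ (GSym deg P) :=
  Submodule.span ℝ {x | ∃ l : List (Σ i, P i), monomialDeg deg P l = n ∧ x = monomial deg P l}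

theorem one_mem_homog : (1 : GSym deg P) ∈ homog deg P 0 :=
  Submodule.subset_span ⟨[], by simp [monomialDeg, monomial]⟩

theorem gen_mem_homog (i : ι) (a : P i) : gen deg P i a ∈ homog deg P (deg i) :=
  Submodule.subset_span ⟨[⟨i, a⟩], by simp [monomialDeg, monomial]⟩

theorem mul_mem_homog {m n : ℤ} {a b : GSym deg P} (ha : a ∈ homog deg P m)
    (hb : b ∈ homog deg P n) : a * b ∈ homog deg P (m + n) := by
  have h : homog deg P m * homog deg P n ≤ homog deg P (m + n) := by
    unfold homog
    rw [Submodule.span_mul_span]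
    refine Submodule.span_mono ?_
    rintro _ ⟨_, ⟨l, rfl, rfl⟩, _, ⟨l', rfl, rfl⟩, rfl⟩
    exact ⟨l ++ l', by simp [monomialDeg, monomial]⟩
  exact h (Submodule.mul_mem_mul ha hb)

theorem gen_mul_monomial (i : ι) (a : P i) (l : List (Σ i, P i)) :
    gen deg P i a * monomial deg P l =
      (-1 : ℤˣ) ^ (deg i * monomialDeg deg P l) • (monomial deg P l * gen deg P i a) := by
  induction l with
  | nil => simp [monomialDeg, monomial]
  | cons p l ih =>
    have h1 : monomial deg P (p :: l) = gen deg P p.1 p.2 * monomial deg P l := by simp [monomial]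
    have h2 : monomialDeg deg P (p :: l) = deg p.1 + monomialDeg deg P l := by simp [monomialDeg]
    rw [h1, h2, ← mul_assoc, gen_mul_gen, smul_mul_assoc, mul_assoc, ih, mul_smul_comm, smul_smul,
      ← mul_assoc, mul_add, zpow_add]

theorem monomial_mul_monomial (l l' : List (Σ i, P i)) :
    monomial deg P l * monomial deg P l' =
      (-1 : ℤˣ) ^ (monomialDeg deg P l * monomialDeg deg P l') •
        (monomial deg P l' * monomial deg P l) := by
  induction l with
  | nil => simp [monomialDeg, monomial]
  | cons p l ih =>
    have h1 : monomial deg P (p :: l) = gen deg P p.1 p.2 * monomial deg P l := by simp [monomial]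
    have h2 : monomialDeg deg P (p :: l) = deg p.1 + monomialDeg deg P l := by simp [monomialDeg]
    rw [h1, h2, mul_assoc, ih, mul_smul_comm, ← mul_assoc, gen_mul_monomial, smul_mul_assoc,
      smul_smul, mul_assoc, add_mul, zpow_add, mul_comm]

theorem homog_comm {m n : ℤ} {a b : GSym deg P} (ha : a ∈ homog deg P m)
    (hb : b ∈ homog deg P n) : a * b = (-1 : ℤˣ) ^ (m * n) • (b * a) := by
  unfold homog at ha hb
  induction ha using Submodule.span_induction with
  | mem x hx =>
    obtain ⟨l, rfl, rfl⟩ := hx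
    induction hb using Submodule.span_induction with
    | mem y hy =>
      obtain ⟨l', rfl, rfl⟩ := hy
      exact monomial_mul_monomial deg P l l'
    | zero => simp
    | add y z _ _ hy hz => rw [mul_add, add_mul, hy, hz, smul_add]
    | smul r y _ hy => rw [mul_smul_comm, smul_mul_assoc, hy, smul_comm]
  | zero => simp
  | add y z _ _ hy hz => rw [mul_add, add_mul, hy, hz, smul_add]
  | smul r y _ hy => rw [mul_smul_comm, smul_mul_assoc, hy, smul_comm]

variable {P} {Q : ι → Type} [∀ i, AddCommGroup (Q i)] [∀ i, Module ℝ (Q i)]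

/-- Functoriality in degree-preserving linear maps. -/
def map (f : ∀ i, P i →ₗ[ℝ] Q i) : GSym deg P →ₐ[ℝ] GSym deg Q :=
  RingQuot.liftAlgHom ℝ
    ⟨TensorAlgebra.lift ℝ (DirectSum.toModule ℝ ι _ fun i => gen deg Q i ∘ₗ f i), by
      rintro _ _ ⟨i, j, a, b⟩
      rw [Units.smul_def, map_zsmul, map_mul, map_mul, TensorAlgebra.lift_ι_apply,
        TensorAlgebra.lift_ι_apply, DirectSum.toModule_lof, DirectSum.toModule_lof, ← Units.smul_def]
      exact gen_mul_gen deg Q i j (f i a) (f j b)⟩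

@[simp]
theorem map_gen (f : ∀ i, P i →ₗ[ℝ] Q i) (i : ι) (a : P i) :
    map deg f (gen deg P i a) = gen deg Q i (f i a) := by
  have h := RingQuot.liftAlgHom_mkAlgHom_apply ℝ
    (TensorAlgebra.lift ℝ (DirectSum.toModule ℝ ι _ fun i => gen deg Q i ∘ₗ f i))
    (s := GSym.Rel deg P) (by
      rintro _ _ ⟨i, j, a, b⟩
      rw [Units.smul_def, map_zsmul, map_mul, map_mul, TensorAlgebra.lift_ι_apply,
        TensorAlgebra.lift_ι_apply, DirectSum.toModule_lof, DirectSum.toModule_lof, ← Units.smul_def]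
      exact gen_mul_gen deg Q i j (f i a) (f j b)) (TensorAlgebra.ι ℝ (DirectSum.lof ℝ ι P i a))
  refine h.trans ?_
  rw [TensorAlgebra.lift_ι_apply, DirectSum.toModule_lof]
  rfl

theorem map_mem_homog (f : ∀ i, P i →ₗ[ℝ] Q i) {n : ℤ} {a : GSym deg P}
    (ha : a ∈ homog deg P n) : map deg f a ∈ homog deg Q n := by
  have h : homog deg P n ≤ (homog deg Q n).comap (map deg f).toLinearMap := by
    refine Submodule.span_le.2 ?_
    rintro _ ⟨l, rfl, rfl⟩
    refine Submodule.subset_span ⟨l.map fun p => ⟨p.1, f p.1 p.2⟩, ?_, ?_⟩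
    · simp [monomialDeg, Function.comp_def]
    · simp [monomial, map_list_prod, Function.comp_def]
  exact h ha

end GSym

end GSym

/-! ### Direct sums of families of submodules as graded algebras -/

section ExternalGrading

variable {A : Type} [Ring A] [Algebra ℝ A] (Γ : ℤ → Submodule ℝ A)

/-- The degree `k` part of the direct sum `⨁ₖ Γₖ`. -/
def sumGrading (k : ℤ) : Submodule ℝ (⨁ k, Γ k) :=
  LinearMap.range (DirectSum.lof ℝ ℤ (fun k => Γ k) k)

instance sumGrading.gradedMonoid [SetLike.GradedMonoid Γ] : SetLike.GradedMonoid (sumGrading Γ) where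
  one_mem := ⟨GradedMonoid.GOne.one (A := fun k => Γ k), by rw [DirectSum.lof_eq_of]; rfl⟩
  mul_mem := by
    rintro i j _ _ ⟨a, rfl⟩ ⟨b, rfl⟩
    refine ⟨(GradedMonoid.GMul.mul (A := fun k => Γ k) a b : (fun k => Γ k) (i + j)), ?_⟩
    simp only [DirectSum.lof_eq_of]
    exact (DirectSum.of_mul_of (A := fun k => Γ k) a b).symm

/-- The inclusion of a summand, with values in the homogeneous part. -/
def sumGrading.incl (k : ℤ) : Γ k →ₗ[ℝ] sumGrading Γ k :=
  (DirectSum.lof ℝ ℤ (fun k => Γ k) k).codRestrict _ fun a => ⟨a, rfl⟩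

/-- The tautological decomposition of the direct sum. -/
def sumGrading.dec : (⨁ k, Γ k) →ₗ[ℝ] ⨁ k, sumGrading Γ k :=
  DirectSum.toModule ℝ ℤ _ fun k =>
    DirectSum.lof ℝ ℤ (fun k => sumGrading Γ k) k ∘ₗ sumGrading.incl Γ k

theorem sumGrading.dec_lof (k : ℤ) (a : Γ k) :
    sumGrading.dec Γ (DirectSum.lof ℝ ℤ (fun k => Γ k) k a) =
      DirectSum.lof ℝ ℤ (fun k => sumGrading Γ k) k (sumGrading.incl Γ k a) := by
  rw [sumGrading.dec, DirectSum.toModule_lof]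
  rfl

instance sumGrading.gradedAlgebra [SetLike.GradedMonoid Γ] : GradedAlgebra (sumGrading Γ) where
  toGradedMonoid := sumGrading.gradedMonoid Γ
  decompose' := sumGrading.dec Γ
  left_inv x := by
    have h : DirectSum.coeLinearMap (sumGrading Γ) ∘ₗ sumGrading.dec Γ = LinearMap.id := by
      refine DirectSum.linearMap_ext _ fun k => LinearMap.ext fun a => ?_
      refine (congrArg (DirectSum.coeLinearMap (sumGrading Γ)) (sumGrading.dec_lof Γ k a)).trans ?_
      exact DirectSum.coeLinearMap_lof (sumGrading Γ) k (sumGrading.incl Γ k a)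
    exact LinearMap.congr_fun h x
  right_inv x := by
    have h : sumGrading.dec Γ ∘ₗ DirectSum.coeLinearMap (sumGrading Γ) = LinearMap.id := by
      refine DirectSum.linearMap_ext _ fun k => LinearMap.ext fun a => ?_
      refine (congrArg (sumGrading.dec Γ) (DirectSum.coeLinearMap_lof (sumGrading Γ) k a)).trans ?_
      obtain ⟨_, b, rfl⟩ := a
      exact sumGrading.dec_lof Γ k b
    exact LinearMap.congr_fun h x

end ExternalGrading

/-! ### The function algebra `Γ(S V*)` of a graded vector bundle -/

namespace GVB

variable {M N : Mfd}

/-- The fibre at `x` of the bundle of algebras `S V*`; the dual of `Vᵢ` sits in degree `-i`. -/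
abbrev SFib (V : GVB M) (x : M) : Type := GSym (fun i : ℤ => -i) fun i => (V i).dual.fib x

/-- The homogeneous elements of degree `k` in the fibre. -/
abbrev SFibDeg (V : GVB M) (x : M) (k : ℤ) : Submodule ℝ (V.SFib x) :=
  GSym.homog (fun i : ℤ => -i) (fun i => (V i).dual.fib x) k

/-- A smooth function, as a section of `S V*` of arity `0`. -/
def funSection (V : GVB M) (f : M.Fun) : ∀ x, V.SFib x := fun x => algebraMap ℝ _ (f x)

/-- A smooth section of the dual of `Vᵢ`, as a section of `S V*` of arity `1`. -/
def dualSection (V : GVB M) (i : ℤ) (σ : (V i).dual.Sec) : ∀ x, V.SFib x :=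
  fun x => GSym.gen (fun i : ℤ => -i) (fun i => (V i).dual.fib x) i (σ x)

/-- Polynomials in smooth functions and smooth sections of the bundles dual to the `Vᵢ`. -/
def polySections (V : GVB M) : Subalgebra ℝ (∀ x, V.SFib x) :=
  Algebra.adjoin ℝ (Set.range V.funSection ∪ ⋃ i, Set.range (V.dualSection i))

/-- A section of `S V*` is smooth if it is locally a polynomial in smooth functions and smooth
sections of the bundles dual to the `Vᵢ`. -/
def IsSmooth (V : GVB M) (a : ∀ x, V.SFib x) : Prop :=
  ∀ x₀ : M, ∃ U ∈ 𝓝 x₀, ∃ b ∈ V.polySections, ∀ x ∈ U, a x = b x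

variable (V : GVB M)

theorem isSmooth_of_mem {a : ∀ x, V.SFib x} (ha : a ∈ V.polySections) : V.IsSmooth a :=
  fun _ => ⟨Set.univ, Filter.univ_mem, a, ha, fun _ _ => rfl⟩

theorem IsSmooth.add {a b : ∀ x, V.SFib x} (ha : V.IsSmooth a) (hb : V.IsSmooth b) :
    V.IsSmooth (a + b) := fun x₀ => by
  obtain ⟨U, hU, a', ha', h⟩ := ha x₀
  obtain ⟨W, hW, b', hb', h'⟩ := hb x₀
  exact ⟨U ∩ W, Filter.inter_mem hU hW, a' + b', add_mem ha' hb', fun x hx => by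
    simp [h x hx.1, h' x hx.2]⟩

theorem IsSmooth.mul {a b : ∀ x, V.SFib x} (ha : V.IsSmooth a) (hb : V.IsSmooth b) :
    V.IsSmooth (a * b) := fun x₀ => by
  obtain ⟨U, hU, a', ha', h⟩ := ha x₀
  obtain ⟨W, hW, b', hb', h'⟩ := hb x₀
  exact ⟨U ∩ W, Filter.inter_mem hU hW, a' * b', mul_mem ha' hb', fun x hx => by
    simp [h x hx.1, h' x hx.2]⟩

/-- `Γ((S V*)ₖ)`: the smooth sections of `S V*` of degree `k`. -/
def SSec (k : ℤ) : Submodule ℝ (∀ x, V.SFib x) where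
  carrier := {a | V.IsSmooth a ∧ ∀ x, a x ∈ V.SFibDeg x k}
  zero_mem' := ⟨V.isSmooth_of_mem (zero_mem _), fun _ => zero_mem _⟩
  add_mem' ha hb := ⟨ha.1.add V hb.1, fun x => add_mem (ha.2 x) (hb.2 x)⟩
  smul_mem' r a ha := by
    refine ⟨fun x₀ => ?_, fun x => Submodule.smul_mem _ r (ha.2 x)⟩
    obtain ⟨U, hU, a', ha', h⟩ := ha.1 x₀
    exact ⟨U, hU, r • a', Subalgebra.smul_mem _ ha' r, fun x hx => by simp [h x hx]⟩

instance : SetLike.GradedMonoid V.SSec where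
  one_mem := ⟨V.isSmooth_of_mem (one_mem _), fun _ => GSym.one_mem_homog _ _⟩
  mul_mem _ _ _ _ ha hb :=
    ⟨ha.1.mul V hb.1, fun x => GSym.mul_mem_homog _ _ (ha.2 x) (hb.2 x)⟩

theorem funSection_mem (f : M.Fun) : V.funSection f ∈ V.SSec 0 := by
  refine ⟨V.isSmooth_of_mem (Algebra.subset_adjoin (Or.inl ⟨f, rfl⟩)), fun x => ?_⟩
  unfold funSection
  rw [Algebra.algebraMap_eq_smul_one]
  exact Submodule.smul_mem _ _ (GSym.one_mem_homog _ _)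

theorem dualSection_mem (i : ℤ) (σ : (V i).dual.Sec) : V.dualSection i σ ∈ V.SSec (-i) :=
  ⟨V.isSmooth_of_mem (Algebra.subset_adjoin (Or.inr (Set.mem_iUnion.2 ⟨i, σ, rfl⟩))),
    fun x => GSym.gen_mem_homog (fun i : ℤ => -i) (fun i => (V i).dual.fib x) i (σ x)⟩

/-- The graded algebra `Γ(S V*)`, the direct sum of its homogeneous parts `Γ((S V*)ₖ)`. -/
abbrev Alg : Type := ⨁ k, V.SSec k

/-- The inclusion of the smooth functions. -/
def ofFun (f : M.Fun) : V.Alg := DirectSum.lof ℝ ℤ (fun k => V.SSec k) 0 ⟨_, V.funSection_mem f⟩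

/-- The inclusion of the smooth sections of the dual of `Vᵢ`. -/
def ofSec (i : ℤ) (σ : (V i).dual.Sec) : V.Alg :=
  DirectSum.lof ℝ ℤ (fun k => V.SSec k) (-i) ⟨_, V.dualSection_mem i σ⟩

theorem alg_comm {k l : ℤ} {a b : V.Alg} (ha : a ∈ sumGrading V.SSec k)
    (hb : b ∈ sumGrading V.SSec l) : a * b = (-1 : ℤˣ) ^ (k * l) • (b * a) := by
  obtain ⟨a, rfl⟩ := ha
  obtain ⟨b, rfl⟩ := hb
  have h : (a : ∀ x, V.SFib x) * (b : ∀ x, V.SFib x) = (-1 : ℤˣ) ^ (k * l) • (b.1 * a.1) := by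
    funext x
    exact GSym.homog_comm _ _ (a.2.2 x) (b.2.2 x)
  simp only [DirectSum.lof_eq_of, DirectSum.of_mul_of]
  rw [Units.smul_def, ← map_zsmul (DirectSum.of (fun k => V.SSec k) (l + k))]
  refine DirectSum.of_eq_of_gradedMonoid_eq (Sigma.subtype_ext (add_comm _ _) ?_)
  exact h

/-! ### Functoriality -/

variable {V} {W : GVB N} {φ : M.Map N}

/-- The dual `(W_i)*_{φ x} → (V_i)*_x` of a morphism of graded vector bundles. -/
def Hom.dualMap (L : Hom V W φ) (x : M) (i : ℤ) : (W i).dual.fib (φ x) →ₗ[ℝ] (V i).dual.fib x where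
  toFun ξ := VB.covector ((VB.functional ξ).comp ((L i).app x))
  map_add' _ _ := rfl
  map_smul' _ _ := rfl

/-- The fibrewise algebra morphism induced by (the dual of) a morphism of graded vector bundles. -/
def Hom.fibMap (L : Hom V W φ) (x : M) : W.SFib (φ x) →ₐ[ℝ] V.SFib x :=
  GSym.map (fun i : ℤ => -i) (P := fun i => (W i).dual.fib (φ x))
    (Q := fun i => (V i).dual.fib x) (L.dualMap x)

/-- Pull-back of sections along a morphism of graded vector bundles. -/
def Hom.pull (L : Hom V W φ) : (∀ y, W.SFib y) →ₐ[ℝ] ∀ x, V.SFib x :=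
  AlgHom.pi fun x => (L.fibMap x).comp (Pi.evalAlgHom ℝ _ (φ x))

theorem Hom.pull_poly (L : Hom V W φ) {a : ∀ y, W.SFib y} (ha : a ∈ W.polySections) :
    L.pull a ∈ V.polySections := by
  have h : W.polySections ≤ V.polySections.comap L.pull := by
    refine Algebra.adjoin_le ?_
    rintro _ (⟨f, rfl⟩ | h)
    · refine Algebra.subset_adjoin (Or.inl ⟨f.comp φ, ?_⟩)
      funext x
      exact ((L.fibMap x).commutes _).symm
    · obtain ⟨i, σ, rfl⟩ := Set.mem_iUnion.1 h
      refine Algebra.subset_adjoin (Or.inr (Set.mem_iUnion.2 ⟨i, (L i).pullSec σ, ?_⟩))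
      funext x
      exact (GSym.map_gen (fun i : ℤ => -i) (P := fun i => (W i).dual.fib (φ x))
        (Q := fun i => (V i).dual.fib x) (L.dualMap x) i (σ (φ x))).symm
  exact h ha

theorem Hom.pull_mem (L : Hom V W φ) {k : ℤ} {a : ∀ y, W.SFib y} (ha : a ∈ W.SSec k) :
    L.pull a ∈ V.SSec k := by
  refine ⟨fun x₀ => ?_, fun x => GSym.map_mem_homog _ _ (ha.2 (φ x))⟩
  obtain ⟨U, hU, b, hb, h⟩ := ha.1 (φ x₀)
  exact ⟨φ ⁻¹' U, φ.contMDiff.continuous.continuousAt hU, L.pull b, L.pull_poly hb,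
    fun x hx => congrArg (L.fibMap x) (h (φ x) hx)⟩

/-- The restriction of the pull-back to sections of degree `k`. -/
def Hom.pullDeg (L : Hom V W φ) (k : ℤ) : W.SSec k →ₗ[ℝ] V.SSec k :=
  L.pull.toLinearMap.restrict fun _ ha => L.pull_mem ha

/-- The morphism of graded algebras `Γ(S W*) → Γ(S V*)` induced by a morphism `V → W`. -/
def Hom.algMap (L : Hom V W φ) : sumGrading W.SSec →ₐᵍ[ℝ] sumGrading V.SSec where
  toAlgHom := DirectSum.toAlgebra ℝ (fun k => W.SSec k)
    (fun k => DirectSum.lof ℝ ℤ (fun k => V.SSec k) k ∘ₗ L.pullDeg k)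
    (by
      refine DirectSum.of_eq_of_gradedMonoid_eq (A := fun k => V.SSec k)
        (Sigma.subtype_ext rfl ?_)
      exact map_one L.pull)
    (by
      intro i j a b
      simp only [LinearMap.comp_apply, DirectSum.lof_eq_of, DirectSum.of_mul_of]
      refine DirectSum.of_eq_of_gradedMonoid_eq (A := fun k => V.SSec k)
        (Sigma.subtype_ext rfl ?_)
      exact map_mul L.pull a.1 b.1)
  map_mem := by
    rintro k _ ⟨a, rfl⟩
    refine ⟨L.pullDeg k a, ?_⟩
    symm
    exact DirectSum.toModule_lof ℝ (φ := fun k =>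
      DirectSum.lof ℝ ℤ (fun k => V.SSec k) k ∘ₗ L.pullDeg k) k a

end GVB

/-! ### Graded manifolds -/

/-- A `ℤ`-graded manifold: a graded-commutative `ℤ`-graded algebra isomorphic to `Γ(S V*)` for some
`ℤ`-graded vector bundle `V`. -/
structure GrMfd : Type 1 where
  alg : Type
  [ring : Ring alg]
  [algebra : Algebra ℝ alg]
  gr : ℤ → Submodule ℝ alg
  [graded : GradedAlgebra gr]
  comm : ∀ {k l : ℤ} {a b : alg}, a ∈ gr k → b ∈ gr l → a * b = (-1 : ℤˣ) ^ (k * l) • (b * a)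
  split : ∃ (M : Mfd) (V : GVB M) (e : alg ≃ₐ[ℝ] V.Alg),
    ∀ k a, a ∈ gr k ↔ e a ∈ sumGrading V.SSec k

attribute [instance] GrMfd.ring GrMfd.algebra GrMfd.graded

/-- A morphism `X ⟶ Y` is a morphism of graded algebras from the functions on `Y` to those on `X`. -/
instance : Category GrMfd where
  Hom X Y := Y.gr →ₐᵍ[ℝ] X.gr
  id X := GradedAlgHom.id ℝ X.gr
  comp f g := f.comp g

/-- The graded algebra morphism underlying a morphism of graded manifolds. -/
def GrMfd.pull {X Y : GrMfd} (f : X ⟶ Y) : Y.gr →ₐᵍ[ℝ] X.gr := f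

/-- The graded manifold `𝔖(V)` with function algebra `Γ(S V*)`. -/
def GVB.toGrMfd {M : Mfd} (V : GVB M) : GrMfd where
  alg := V.Alg
  gr := sumGrading V.SSec
  comm := V.alg_comm
  split := ⟨M, V, AlgEquiv.refl, fun _ _ => Iff.rfl⟩

/-- The morphism `𝔖(L) : 𝔖(V) ⟶ 𝔖(W)`. -/
def GVB.Hom.toGrMfd {M N : Mfd} {V : GVB M} {W : GVB N} {φ : M.Map N} (L : GVB.Hom V W φ) :
    V.toGrMfd ⟶ W.toGrMfd := L.algMap

/-! ### The odd line `D` and the shifted tangent presheaf -/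

/-- The grading of `C(D) = ℝ[ε]`, with `ε` of degree `-1`. -/
def fatGrading (k : ℤ) : Submodule ℝ (DualNumber ℝ) where
  carrier := {a | (k ≠ 0 → TrivSqZeroExt.fst a = 0) ∧ (k ≠ -1 → TrivSqZeroExt.snd a = 0)}
  zero_mem' := by simp
  add_mem' := by
    rintro a b ⟨h1, h2⟩ ⟨h3, h4⟩
    exact ⟨fun h => by simp [h1 h, h3 h], fun h => by simp [h2 h, h4 h]⟩
  smul_mem' := by
    rintro r a ⟨h1, h2⟩
    exact ⟨fun h => by simp [h1 h], fun h => by simp [h2 h]⟩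

instance fatGrading.gradedMonoid : SetLike.GradedMonoid fatGrading where
  one_mem := ⟨fun h => (h rfl).elim, fun _ => by simp⟩
  mul_mem := by
    rintro i j a b ⟨h1, h2⟩ ⟨h3, h4⟩
    refine ⟨fun h => ?_, fun h => ?_⟩
    · rw [TrivSqZeroExt.fst_mul]
      by_cases hi : i = 0
      · rw [h3 (by omega), mul_zero]
      · rw [h1 hi, zero_mul]
    · have e1 : a.fst * b.snd = 0 := by
        by_cases hi : i = 0
        · rw [h4 (by omega), mul_zero]
        · rw [h1 hi, zero_mul]
      have e2 : b.fst * a.snd = 0 := by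
        by_cases hj : j = 0
        · rw [h2 (by omega), mul_zero]
        · rw [h3 hj, zero_mul]
      rw [TrivSqZeroExt.snd_mul, smul_eq_mul, MulOpposite.smul_eq_mul_unop, MulOpposite.unop_op,
        e1, mul_comm, e2, add_zero]

/-- The constant part of an element of `ℝ[ε]`. -/
def fatZero : DualNumber ℝ →ₗ[ℝ] fatGrading 0 where
  toFun a := ⟨TrivSqZeroExt.inl a.fst, fun h => (h rfl).elim, fun _ => by simp⟩
  map_add' a b := by ext <;> simp
  map_smul' r a := by ext <;> simp

/-- The `ε`-part of an element of `ℝ[ε]`. -/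
def fatOne : DualNumber ℝ →ₗ[ℝ] fatGrading (-1) where
  toFun a := ⟨TrivSqZeroExt.inr a.snd, fun _ => by simp, fun h => (h rfl).elim⟩
  map_add' a b := by ext <;> simp
  map_smul' r a := by ext <;> simp

instance fatGrading.gradedAlgebra : GradedAlgebra fatGrading where
  toGradedMonoid := fatGrading.gradedMonoid
  decompose' a := DirectSum.of (fun k => fatGrading k) 0 (fatZero a) +
    DirectSum.of (fun k => fatGrading k) (-1) (fatOne a)
  left_inv a := by
    rw [map_add, DirectSum.coeAddMonoidHom_of, DirectSum.coeAddMonoidHom_of]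
    ext <;> simp [fatZero, fatOne]
  right_inv x := by
    induction x using DirectSum.induction_on with
    | zero => simp
    | add x y hx hy =>
      beta_reduce at hx hy ⊢
      rw [map_add, map_add, map_add, map_add, map_add, add_add_add_comm, hx, hy]
    | of k a =>
      obtain ⟨a, h1, h2⟩ := a
      rw [DirectSum.coeAddMonoidHom_of]
      by_cases h0 : k = 0
      · subst h0
        have e1 : fatZero a = ⟨a, h1, h2⟩ := by
          ext <;> simp [fatZero, h2]
        have e2 : fatOne a = 0 := by
          ext <;> simp [fatOne, h2]
        simp [e1, e2]
      · by_cases h3 : k = -1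
        · subst h3
          have e1 : fatZero a = 0 := by
            ext <;> simp [fatZero, h1]
          have e2 : fatOne a = ⟨a, h1, h2⟩ := by
            ext <;> simp [fatOne, h1]
          simp [e1, e2]
        · have : a = 0 := by ext <;> simp [h1 h0, h2 h3]
          subst this
          have e : (⟨0, h1, h2⟩ : fatGrading k) = 0 := rfl
          simp [e]

/-- `C(D × T) = C(D) ⊗ C(T)`, the graded tensor product. -/
abbrev GrMfd.FatAlg (T : GrMfd) : Type := fatGrading ᵍ⊗[ℝ] T.gr

/-- The homogeneous elements of degree `k` in `C(D) ⊗ C(T)`. -/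
def GrMfd.fatDeg (T : GrMfd) (k : ℤ) : Submodule ℝ T.FatAlg :=
  Submodule.span ℝ {x | ∃ i j : ℤ, i + j = k ∧ ∃ a ∈ fatGrading i, ∃ b ∈ T.gr j, x = a ᵍ⊗ₜ[ℝ] b}

/-- The component `x₀` of `x = x₀ + ε x₁`. -/
def GrMfd.comp₀ (T : GrMfd) : T.FatAlg →ₗ[ℝ] T.alg :=
  (TensorProduct.lid ℝ T.alg).toLinearMap ∘ₗ
    (TrivSqZeroExt.fstHom ℝ ℝ ℝ).toLinearMap.rTensor T.alg ∘ₗ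
      (GradedTensorProduct.of ℝ fatGrading T.gr).symm.toLinearMap

/-- The component `x₁` of `x = x₀ + ε x₁`. -/
def GrMfd.comp₁ (T : GrMfd) : T.FatAlg →ₗ[ℝ] T.alg :=
  (TensorProduct.lid ℝ T.alg).toLinearMap ∘ₗ
    (TrivSqZeroExt.sndHom ℝ ℝ).rTensor T.alg ∘ₗ
      (GradedTensorProduct.of ℝ fatGrading T.gr).symm.toLinearMap

/-- Functoriality of `C(D) ⊗ C(T)` in `T`. -/
def GrMfd.fatMap {T T' : GrMfd} (g : T' ⟶ T) : T.FatAlg →ₐ[ℝ] T'.FatAlg :=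
  GradedTensorProduct.lift fatGrading T.gr (GradedTensorProduct.includeLeft fatGrading T'.gr)
    ((GradedTensorProduct.includeRight fatGrading T'.gr).comp (GrMfd.pull g).toAlgHom) (by
      intro i j a b
      have hb : GrMfd.pull g b.1 ∈ T'.gr j := (GrMfd.pull g).map_mem b.2
      have h1 := GradedTensorProduct.tmul_one_mul_one_tmul fatGrading T'.gr (R := ℝ) a.1
        (GrMfd.pull g b.1)
      have h2 := GradedTensorProduct.tmul_coe_mul_coe_tmul fatGrading T'.gr (R := ℝ) 1
        (⟨_, hb⟩ : T'.gr j) a 1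
      rw [one_mul, mul_one] at h2
      refine h1.trans ?_
      refine Eq.trans ?_ (congrArg (fun z => (-1 : ℤˣ) ^ (j * i) • z) h2.symm)
      rw [smul_smul, Int.units_mul_self, one_smul])

theorem GrMfd.fatMap_tmul {T T' : GrMfd} (g : T' ⟶ T) (a : DualNumber ℝ) (b : T.alg) :
    GrMfd.fatMap g (a ᵍ⊗ₜ[ℝ] b) = a ᵍ⊗ₜ[ℝ] (GrMfd.pull g b) := by
  refine (GradedTensorProduct.lift_tmul _ _ _ _ _ a b).trans ?_
  exact GradedTensorProduct.tmul_one_mul_one_tmul fatGrading T'.gr (R := ℝ) a (GrMfd.pull g b)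

theorem GrMfd.fatMap_mem {T T' : GrMfd} (g : T' ⟶ T) {k : ℤ} {x : T.FatAlg}
    (hx : x ∈ T.fatDeg k) : GrMfd.fatMap g x ∈ T'.fatDeg k := by
  have h : T.fatDeg k ≤ (T'.fatDeg k).comap (GrMfd.fatMap g).toLinearMap := by
    refine Submodule.span_le.2 ?_
    rintro _ ⟨i, j, hij, a, ha, b, hb, rfl⟩
    exact Submodule.subset_span ⟨i, j, hij, a, ha, _, (GrMfd.pull g).map_mem hb,
      GrMfd.fatMap_tmul g a b⟩
  exact h hx

theorem GrMfd.fatMap_id (T : GrMfd) : GrMfd.fatMap (𝟙 T) = AlgHom.id ℝ T.FatAlg := by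
  refine AlgHom.toLinearMap_injective (GradedTensorProduct.hom_ext _ _ (TensorProduct.ext' ?_))
  intro a b
  exact GrMfd.fatMap_tmul (𝟙 T) a b

theorem GrMfd.fatMap_comp {T T' T'' : GrMfd} (g : T' ⟶ T) (g' : T'' ⟶ T') :
    GrMfd.fatMap (g' ≫ g) = (GrMfd.fatMap g').comp (GrMfd.fatMap g) := by
  refine AlgHom.toLinearMap_injective (GradedTensorProduct.hom_ext _ _ (TensorProduct.ext' ?_))
  intro a b
  refine (GrMfd.fatMap_tmul (g' ≫ g) a b).trans ?_
  refine Eq.trans ?_ (congrArg (GrMfd.fatMap g') (GrMfd.fatMap_tmul g a b)).symm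
  exact (GrMfd.fatMap_tmul g' a _).symm

/-- A morphism `D × T → X` of graded manifolds, i.e. a morphism of graded algebras
`Ψ : C(X) → C(D) ⊗ C(T)`. -/
structure FatPoint (X T : GrMfd) : Type where
  hom : X.alg →ₐ[ℝ] T.FatAlg
  map_mem : ∀ k, ∀ a ∈ X.gr k, hom a ∈ T.fatDeg k

namespace FatPoint

variable {X Y T T' : GrMfd}

@[ext]
theorem ext {Ψ Ψ' : FatPoint X T} (h : ∀ a, Ψ.hom a = Ψ'.hom a) : Ψ = Ψ' := by
  cases Ψ
  cases Ψ'
  congr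
  exact AlgHom.ext h

/-- The part `Ψ₀` of `Ψ = Ψ₀ + ε Ψ₁`. -/
def part₀ (Ψ : FatPoint X T) : X.alg →ₗ[ℝ] T.alg := T.comp₀ ∘ₗ Ψ.hom.toLinearMap

/-- The part `Ψ₁` of `Ψ = Ψ₀ + ε Ψ₁`. -/
def part₁ (Ψ : FatPoint X T) : X.alg →ₗ[ℝ] T.alg := T.comp₁ ∘ₗ Ψ.hom.toLinearMap

/-- Precomposition with `id × g : D × T' → D × T`. -/
def restrict (Ψ : FatPoint X T) (g : T' ⟶ T) : FatPoint X T' where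
  hom := (GrMfd.fatMap g).comp Ψ.hom
  map_mem k a ha := GrMfd.fatMap_mem g (Ψ.map_mem k a ha)

/-- Composition with a morphism `X ⟶ Y`. -/
def push (Ψ : FatPoint X T) (h : X ⟶ Y) : FatPoint Y T where
  hom := Ψ.hom.comp (GrMfd.pull h).toAlgHom
  map_mem k _ ha := Ψ.map_mem k _ ((GrMfd.pull h).map_mem ha)

end FatPoint

/-- The presheaf `T[1]X = Hom(D, X) : T ↦ hom(D × T, X)` on graded manifolds, functorially
in `X`. -/
def tangentPresheaf : GrMfd ⥤ (GrMfdᵒᵖ ⥤ Type) where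
  obj X :=
    { obj := fun T => FatPoint X T.unop
      map := fun g => TypeCat.ofHom fun Ψ => Ψ.restrict g.unop
      map_id := fun T => by
        ext Ψ : 3
        exact FatPoint.ext fun a => AlgHom.congr_fun (GrMfd.fatMap_id T.unop) (Ψ.hom a)
      map_comp := fun g g' => by
        ext Ψ : 3
        exact FatPoint.ext fun a => AlgHom.congr_fun (GrMfd.fatMap_comp g.unop g'.unop) (Ψ.hom a) }
  map h := { app := fun T => TypeCat.ofHom fun Ψ => Ψ.push h }

/-! ### Jets and connections -/

namespace VB

variable {M N : Mfd}

/-- The sections of `V` of the form `∑ f g σ` with functions `f`, `g` vanishing at `x`, i.e. the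
sections whose `1`-jet at `x` vanishes. -/
def jetKer (V : VB M) (x : M) : Submodule ℝ V.Sec :=
  Submodule.span ℝ {τ | ∃ (f g : M.Fun) (σ : V.Sec), f x = 0 ∧ g x = 0 ∧
    τ = V.smulSec f (V.smulSec g σ)}

/-- The fibre at `x` of the first jet bundle `J¹V`. -/
abbrev J1 (V : VB M) (x : M) : Type := V.Sec ⧸ V.jetKer x

/-- The `1`-jet at `x` of a section. -/
def jet (V : VB M) (x : M) : V.Sec →ₗ[ℝ] V.J1 x := (V.jetKer x).mkQ

/-- Evaluation of sections at a point. -/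
def evalSec (V : VB M) (x : M) : V.Sec →ₗ[ℝ] V.fib x where
  toFun σ := σ x
  map_add' _ _ := rfl
  map_smul' _ _ := rfl

/-- The projection `J¹V → V`. -/
def jetProj (V : VB M) (x : M) : V.J1 x →ₗ[ℝ] V.fib x :=
  (V.jetKer x).liftQ (V.evalSec x) (Submodule.span_le.2 (by
    rintro _ ⟨f, g, σ, hf, hg, rfl⟩
    change f x • (g x • σ x) = 0
    rw [hf, zero_smul]))

/-- A section of `J¹V` is smooth if it is locally of the form `∑ gᵢ j¹τᵢ`. -/
def IsSmoothJet (V : VB M) (θ : ∀ x, V.J1 x) : Prop :=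
  ∀ x₀ : M, ∃ U ∈ 𝓝 x₀, ∃ (n : ℕ) (g : Fin n → M.Fun) (τ : Fin n → V.Sec),
    ∀ x ∈ U, θ x = ∑ i, g i x • V.jet x (τ i)

/-- `Γ(J¹V)`. -/
def JetSec (V : VB M) : Submodule ℝ (∀ x, V.J1 x) where
  carrier := {θ | V.IsSmoothJet θ}
  zero_mem' := fun _ => ⟨Set.univ, Filter.univ_mem, 0, Fin.elim0, Fin.elim0, fun _ _ => by simp⟩
  add_mem' := by
    intro θ θ' h h' x₀
    obtain ⟨U, hU, n, g, τ, e⟩ := h x₀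
    obtain ⟨U', hU', n', g', τ', e'⟩ := h' x₀
    refine ⟨U ∩ U', Filter.inter_mem hU hU', n + n', Fin.append g g', Fin.append τ τ',
      fun x hx => ?_⟩
    rw [Fin.sum_univ_add]
    simp [e x hx.1, e' x hx.2]
  smul_mem' := by
    intro r θ h x₀
    obtain ⟨U, hU, n, g, τ, e⟩ := h x₀
    exact ⟨U, hU, n, fun i => r • g i, τ, fun x hx => by simp [e x hx, Finset.smul_sum, smul_smul]⟩

/-- The section `j¹σ` of `J¹V`. -/
def jetSec (V : VB M) (σ : V.Sec) : V.JetSec :=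
  ⟨fun x => V.jet x σ, fun _ => ⟨Set.univ, Filter.univ_mem, 1, fun _ => 1, fun _ => σ,
    fun _ _ => by simp⟩⟩

/-- Multiplication of a section of `J¹V` by a smooth function. -/
def smulJet (V : VB M) (f : M.Fun) (θ : V.JetSec) : V.JetSec :=
  ⟨fun x => f x • θ.1 x, fun x₀ => by
    obtain ⟨U, hU, n, g, τ, e⟩ := θ.2 x₀
    exact ⟨U, hU, n, fun i => f * g i, τ, fun x hx => by
      simp [e x hx, Finset.smul_sum, smul_smul]⟩⟩

/-- A connection on `V`: a smooth splitting `s : V → J¹V` of the projection `J¹V → V`. -/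
structure Connection (V : VB M) where
  app : ∀ x, V.fib x →ₗ[ℝ] V.J1 x
  proj_app : ∀ x v, V.jetProj x (app x v) = v
  smooth : ∀ σ : V.Sec, V.IsSmoothJet fun x => app x (σ x)

/-- The section `s ∘ σ` of `J¹V`. -/
def Connection.lift {V : VB M} (s : V.Connection) (σ : V.Sec) : V.JetSec :=
  ⟨fun x => s.app x (σ x), s.smooth σ⟩

namespace Hom

variable {φ : M.Map N} {V : VB M} {W : VB N} (L : Hom V W φ)

/-- The dual comorphism of `L` at `x`, i.e. the map `(W*)_{φ x} → (V*)_x`. -/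
def dualApp (x : M) : W.dual.fib (φ x) →ₗ[ℝ] V.dual.fib x where
  toFun ξ := covector ((functional ξ).comp (L.app x))
  map_add' _ _ := rfl
  map_smul' _ _ := rfl

/-- The map on sections induced by the dual comorphism, as a linear map. -/
def pullSecₗ : W.dual.Sec →ₗ[ℝ] V.dual.Sec where
  toFun := L.pullSec
  map_add' _ _ := rfl
  map_smul' _ _ := rfl

/-- The comorphism `J¹(W*)_{φ x} → J¹(V*)_x`, `j¹σ ↦ j¹(L* σ)`. -/
def jetMap (x : M) : W.dual.J1 (φ x) →ₗ[ℝ] V.dual.J1 x :=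
  (W.dual.jetKer (φ x)).mapQ (V.dual.jetKer x) L.pullSecₗ (Submodule.span_le.2 (by
    rintro _ ⟨f, g, σ, hf, hg, rfl⟩
    exact Submodule.subset_span ⟨f.comp φ, g.comp φ, L.pullSec σ, hf, hg, rfl⟩))

/-- Connections `s` on `V*` and `s'` on `W*` are compatible with respect to the dual comorphism
of `L` if `J¹L* ∘ s' = s ∘ L*`. -/
def Compatible (s : V.dual.Connection) (s' : W.dual.Connection) : Prop :=
  ∀ (x : M) (ξ : W.dual.fib (φ x)), L.jetMap x (s'.app (φ x) ξ) = s.app x (L.dualApp x ξ)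

end Hom

/-- For a map `D` on sections of `V` which is a first order differential operator over `ψ`: the
map `J¹D : Γ(J¹V) → A`, linear over `ψ`, with `J¹D (j¹σ) = D σ`. -/
structure JetExtension (V : VB M) {A : Type} [Ring A] [Algebra ℝ A] (ψ : M.Fun → A)
    (D : V.Sec → A) where
  toLin : V.JetSec →ₗ[ℝ] A
  map_smul : ∀ f θ, toLin (V.smulJet f θ) = ψ f * toLin θ
  map_jet : ∀ σ, toLin (V.jetSec σ) = D σ

end VB

/-! ### The splitting of `T[1]𝔖(V)` induced by a connection -/

namespace GVB

variable {M N : Mfd}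

/-- A connection on the graded vector bundle `V*`. -/
abbrev DualConnection (V : GVB M) : Type := ∀ i, (V i).dual.Connection

/-- Levelwise compatibility of connections with respect to the dual comorphism of `L`. -/
def Hom.Compatible {E : GVB M} {F : GVB N} {φ : M.Map N} (L : Hom E F φ) (s : E.DualConnection)
    (s' : F.DualConnection) : Prop :=
  ∀ i, (L i).Compatible (s i) (s' i)

variable (V : GVB M)

/-- The section of the dual of `(V ⊕ T[1]M ⊕ V[1])ᵢ` given by a section of the dual of `Vᵢ`. -/
def inclBase (i : ℤ) (σ : (V i).dual.Sec) : (V.T1 i).dual.Sec := (VB.Hom.fst _ _).pullSec σ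

/-- The section of the dual of `(V ⊕ T[1]M ⊕ V[1])₋₁` given by a differential form. -/
def inclForm (α : (VB.tangent M).dual.Sec) : (V.T1 (-1)).dual.Sec :=
  (VB.Hom.snd _ _).pullSec ((VB.Hom.fst (shiftedTangent M (-1)) (V (-1 + 1))).pullSec α)

/-- The section of the dual of `(V ⊕ T[1]M ⊕ V[1])ᵢ` given by a section of the dual of
`V[1]ᵢ = Vᵢ₊₁`. -/
def inclShift (i : ℤ) (σ : (V (i + 1)).dual.Sec) : (V.T1 i).dual.Sec :=
  (VB.Hom.snd _ _).pullSec ((VB.Hom.snd (shiftedTangent M i) (V (i + 1))).pullSec σ)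

variable {V}

/-- The relation between `Ψ = Ψ₀ + ε Ψ₁ : C(𝔖(V)) → C(D) ⊗ C(T)` and the morphism
`χ : C(𝔖(V ⊕ T[1]M ⊕ V[1])) → C(T)` encoding it by means of a connection `s` on `V*`: on generators,
`χ` is given by `Ψ₀` on `C^∞(M)` and `Γ(V*)`, by (the linear extension of) `df ↦ Ψ₁ f` on `Γ(T*M)`
and by `J¹Ψ₁ ∘ s` on `Γ(V[1]*)`. -/
structure Encodes (s : V.DualConnection) {T : GrMfd} (Ψ : FatPoint V.toGrMfd T)
    (χ : T ⟶ V.T1.toGrMfd) : Prop where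
  on_fun : ∀ f, GrMfd.pull χ (V.T1.ofFun f) = Ψ.part₀ (V.ofFun f)
  on_base : ∀ i σ, GrMfd.pull χ (V.T1.ofSec i (V.inclBase i σ)) = Ψ.part₀ (V.ofSec i σ)
  on_form : ∀ f, GrMfd.pull χ (V.T1.ofSec (-1) (V.inclForm (VB.d f))) = Ψ.part₁ (V.ofFun f)
  on_shift : ∀ i, ∃ J : (V (i + 1)).dual.JetExtension (fun f => Ψ.part₀ (V.ofFun f))
      (fun σ => Ψ.part₁ (V.ofSec (i + 1) σ)),
    ∀ σ, GrMfd.pull χ (V.T1.ofSec i (V.inclShift i σ)) = J.toLin ((s (i + 1)).lift σ)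

/-- The isomorphism `sp : T[1]𝔖(V) ≅ 𝔖(V ⊕ T[1]M ⊕ V[1])` is the splitting induced by the
connection `s` on `V*`. -/
def IsInducedSplitting (s : V.DualConnection) (sp : tangentPresheaf.obj V.toGrMfd ≅ yoneda.obj V.T1.toGrMfd) :
    Prop :=
  ∀ (T : GrMfd) (Ψ : FatPoint V.toGrMfd T), Encodes s Ψ (sp.hom.app (Opposite.op T) Ψ)

end GVB

end GradedGeometry

end

/-! The splitting comes from Yoneda's lemma applied to a universal point. Write `V.T1` for V ⊕ T[1]M
⊕ V[1]. A connection s determines a point of T[1]𝔖(V) over the test object 𝔖(V.T1): it is f ↦ f + ε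
df on functions and τ ↦ τ + ε([τ] + ∇τ) on sections of V*, where [τ] is the copy of τ in V[1]* and
∇τ is the covariant derivative, a combination of products of a form with a section of V*
(`univPoint`). Its jet extension sends s∘τ to [τ], so the identity of 𝔖(V.T1) encodes it
(`encodes_univPoint`). The restriction of this point along χ : T → 𝔖(V.T1) is encoded by χ, and
restriction is a bijection from morphisms to points. It is injective because a point determines its
encoding morphism (`Encodes.eq`). It is surjective because [τ] can be sent to Ψ₁τ minus the image of
∇τ, an expression linear over functions since both terms obey the same Leibniz rule
(`exists_eq_restrict`). The inverse bijection is the induced splitting; `Encodes.eq` also makes it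
unique. Every test object is a retract of some 𝔖(W), so the constructions are only needed there.

The work lies in the fact that Γ(SV*) is generated by functions and sections only locally, so that
values prescribed on generators have to be extended by a locality argument. An algebra morphism u :
C^∞(M) → Γ(SW*), followed by the augmentation at y, is a character of C^∞(M), hence evaluation at a
point b(y) (`Mfd.exists_eq_eval`). If h(b(y)) = 1, then u(h) has constant term 1 at y and can be
cancelled (`toSection_regular`). So only germs at b(y) matter. Local frames show that a formal
polynomial with zero germ at b(y) has value zero at y (`GenData.img_eq_zero`), and `GenData.hom` is
the resulting extension. Points Ψ₀ + εΨ₁ fit the same scheme with triangular 2 × 2 matrices as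
target.

Derivations of functions over u are extended to differential forms in coordinates. That they are
determined by their values on coordinates is Hadamard's lemma iterated along the arity filtration
(`derivation_eq_zero`): one application does not suffice, since u(f) at y is not just the number
f(b(y)).

For naturality, an encoding for s is pushed to an encoding for s' by precomposing the jet extension
with J¹L*; compatibility is exactly what the shifted generators require (`Encodes.push`). Uniqueness
of encodings then yields the equation. -/

open scoped Manifold ContDiff Bundle TensorProduct DirectSum Topology
open CategoryTheory

noncomputable section

namespace GradedGeometry

/-! ### Universal property and gradings of graded symmetric algebras -/

namespace GSym

variable {ι : Type} [DecidableEq ι] (deg : ι → ℤ) (P : ι → Type) [∀ i, AddCommGroup (P i)]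
  [∀ i, Module ℝ (P i)]

section lift

variable {B : Type} [Ring B] [Algebra ℝ B] (f : ∀ i, P i →ₗ[ℝ] B)
  (hf : ∀ i j a b, f i a * f j b = (-1 : ℤˣ) ^ (deg i * deg j) • (f j b * f i a))

/-- The universal property of the graded symmetric algebra. -/
def lift : GSym deg P →ₐ[ℝ] B :=
  RingQuot.liftAlgHom ℝ
    ⟨TensorAlgebra.lift ℝ (DirectSum.toModule ℝ ι _ f), by
      rintro _ _ ⟨i, j, a, b⟩
      rw [Units.smul_def, map_zsmul, map_mul, map_mul, TensorAlgebra.lift_ι_apply,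
        TensorAlgebra.lift_ι_apply, DirectSum.toModule_lof, DirectSum.toModule_lof, ← Units.smul_def]
      exact hf i j a b⟩

@[simp]
theorem lift_gen (i : ι) (a : P i) : lift deg P f hf (gen deg P i a) = f i a := by
  refine (RingQuot.liftAlgHom_mkAlgHom_apply ℝ _ (s := GSym.Rel deg P) _ _).trans ?_
  refine (TensorAlgebra.lift_ι_apply _ _).trans ?_
  rw [DirectSum.toModule_lof]

end lift

theorem induction {C : GSym deg P → Prop} (algebraMap : ∀ r, C (algebraMap ℝ _ r))
    (gen : ∀ i a, C (gen deg P i a)) (add : ∀ a b, C a → C b → C (a + b))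
    (mul : ∀ a b, C a → C b → C (a * b)) (a : GSym deg P) : C a := by
  obtain ⟨t, rfl⟩ : ∃ t, mk deg P t = a := RingQuot.mkAlgHom_surjective ℝ (GSym.Rel deg P) a
  induction t using TensorAlgebra.induction with
  | algebraMap r => simpa using algebraMap r
  | ι x =>
    induction x using DirectSum.induction_on with
    | zero => simpa using algebraMap 0
    | of i x => exact gen i x
    | add x y hx hy => simpa using add _ _ hx hy
  | mul a b ha hb => simpa using mul _ _ ha hb
  | add a b ha hb => simpa using add _ _ ha hb

/-! ### Separation of degrees by a coaction -/

/-- The algebra morphism `gen i a ↦ gen i a ⊗ T ^ w i` for a weight `w` of the generators. -/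
def coact {G : Type} [AddCommMonoid G] (w : ι → G) :
    GSym deg P →ₐ[ℝ] AddMonoidAlgebra (GSym deg P) G :=
  lift deg P (fun i => (AddMonoidAlgebra.lsingle (R := ℝ) (w i)) ∘ₗ gen deg P i) (by
    intro i j a b
    simp only [LinearMap.comp_apply, AddMonoidAlgebra.lsingle_apply]
    rw [AddMonoidAlgebra.single_mul_single, AddMonoidAlgebra.single_mul_single, gen_mul_gen,
      add_comm (w i), Units.smul_def, Units.smul_def, AddMonoidAlgebra.smul_single])

theorem coact_gen {G : Type} [AddCommMonoid G] (w : ι → G) (i : ι) (a : P i) :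
    coact deg P w (gen deg P i a) = AddMonoidAlgebra.single (w i) (gen deg P i a) :=
  lift_gen deg P _ _ i a

/-- The projection to the component of degree `n`. -/
def proj (n : ℤ) : GSym deg P →ₗ[ℝ] GSym deg P where
  toFun a := (coact deg P deg a).coeff n
  map_add' a b := by simp
  map_smul' r a := by simp

/-- The coaction is multiplicative and each generator carries its degree as exponent. The submodules
`homog` are defined only as spans; the exponents are what shows them to be independent. -/
theorem coact_of_mem {n : ℤ} {a : GSym deg P} (ha : a ∈ homog deg P n) :
    coact deg P deg a = AddMonoidAlgebra.single n a := by
  unfold homog at ha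
  induction ha using Submodule.span_induction with
  | mem x hx =>
    obtain ⟨l, rfl, rfl⟩ := hx
    induction l with
    | nil => exact map_one _
    | cons p l ih =>
      have h1 : monomial deg P (p :: l) = gen deg P p.1 p.2 * monomial deg P l := by simp [monomial]
      have h2 : monomialDeg deg P (p :: l) = deg p.1 + monomialDeg deg P l := by simp [monomialDeg]
      rw [h1, h2, map_mul, ih, coact_gen, AddMonoidAlgebra.single_mul_single]
  | zero => rw [map_zero, AddMonoidAlgebra.single_zero]
  | add y z _ _ hy hz => rw [map_add, hy, hz, AddMonoidAlgebra.single_add]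
  | smul r y _ hy => rw [map_smul, hy, AddMonoidAlgebra.smul_single]

theorem proj_of_mem {n : ℤ} {a : GSym deg P} (ha : a ∈ homog deg P n) : proj deg P n a = a := by
  change (coact deg P deg a).coeff n = a
  rw [coact_of_mem deg P ha, AddMonoidAlgebra.coeff_single, Finsupp.single_eq_same]

theorem proj_of_mem_ne {n m : ℤ} {a : GSym deg P} (ha : a ∈ homog deg P n) (h : n ≠ m) :
    proj deg P m a = 0 := by
  change (coact deg P deg a).coeff m = 0
  rw [coact_of_mem deg P ha, AddMonoidAlgebra.coeff_single, Finsupp.single_eq_of_ne h.symm]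

/-! ### Augmentation and the arity filtration -/

/-- The augmentation, killing the generators. -/
def aug : GSym deg P →ₐ[ℝ] ℝ := lift deg P (fun _ => 0) (by simp)

@[simp]
theorem aug_gen (i : ι) (a : P i) : aug deg P (gen deg P i a) = 0 := lift_gen deg P _ _ i a

/-- The expansion of an element by arity. -/
def arity : GSym deg P →ₐ[ℝ] Polynomial (GSym deg P) :=
  lift deg P (fun i => (Polynomial.monomial 1).restrictScalars ℝ ∘ₗ gen deg P i) (by
    intro i j a b
    simp only [LinearMap.comp_apply, LinearMap.restrictScalars_apply, Polynomial.monomial_mul_monomial]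
    rw [gen_mul_gen, Units.smul_def, Units.smul_def, Polynomial.smul_monomial])

theorem arity_gen (i : ι) (a : P i) :
    arity deg P (gen deg P i a) = Polynomial.monomial 1 (gen deg P i a) :=
  lift_gen deg P _ _ i a

theorem coeff_zero_arity (a : GSym deg P) :
    (arity deg P a).coeff 0 = algebraMap ℝ _ (aug deg P a) := by
  induction a using GSym.induction with
  | algebraMap r => simp [Polynomial.algebraMap_apply]
  | gen i a => simp [arity_gen, Polynomial.coeff_monomial]
  | add a b ha hb => simp [ha, hb]
  | mul a b ha hb => simp [ha, hb, Polynomial.mul_coeff_zero]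

theorem eval_one_arity (a : GSym deg P) : (arity deg P a).eval 1 = a := by
  induction a using GSym.induction with
  | algebraMap r => simp [Polynomial.algebraMap_apply]
  | gen i a => simp [arity_gen]
  | add a b ha hb => simp [ha, hb]
  | mul a b ha hb =>
    rw [map_mul]
    refine Eq.trans ?_ (congrArg₂ (· * ·) ha hb)
    -- The coefficients do not commute, so evaluation is not multiplicative in general; it is at 1,
    -- which is central.
    exact Polynomial.eval₂_mul_noncomm _ _ fun k => by simp

/-- The elements all of whose terms have arity at least `k`. -/
def fil (k : ℕ) : Submodule ℝ (GSym deg P) where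
  carrier := {a | ∀ j < k, (arity deg P a).coeff j = 0}
  zero_mem' := by simp
  add_mem' ha hb j hj := by simp [ha j hj, hb j hj]
  smul_mem' r a ha j hj := by simp [ha j hj]

/-- The arity expansion is a polynomial with sum `a`, so the filtration is separated. Infinite
descent in the arity is therefore a valid way to prove vanishing. -/
theorem eq_zero_of_mem_fil {a : GSym deg P} (h : ∀ k, a ∈ fil deg P k) : a = 0 := by
  have : arity deg P a = 0 := Polynomial.ext fun j => h (j + 1) j (Nat.lt_succ_self j)
  rw [← eval_one_arity deg P a, this, Polynomial.eval_zero]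

theorem mem_fil_one {a : GSym deg P} (h : aug deg P a = 0) : a ∈ fil deg P 1 := by
  intro j hj
  obtain rfl : j = 0 := by omega
  rw [coeff_zero_arity, h, map_zero]

theorem mul_mem_fil {a b : GSym deg P} {k l : ℕ} (ha : a ∈ fil deg P k) (hb : b ∈ fil deg P l) :
    a * b ∈ fil deg P (k + l) := by
  intro j hj
  rw [map_mul, Polynomial.coeff_mul]
  refine Finset.sum_eq_zero fun p hp => ?_
  rw [Finset.HasAntidiagonal.mem_antidiagonal] at hp
  by_cases h : p.1 < k
  · rw [ha _ h, zero_mul]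
  · rw [hb _ (by omega), mul_zero]

/-- The lowest arity term of `u * z` is the nonzero number `aug u` times the lowest term of `z`. All
cancellation of bump functions below rests on this, as `u` need not be invertible. -/
theorem eq_zero_of_mul_eq_zero {u z : GSym deg P} (hu : aug deg P u ≠ 0) (h : u * z = 0) :
    z = 0 := by
  refine eq_zero_of_mem_fil deg P fun k => ?_
  induction k with
  | zero => intro j hj; omega
  | succ k ih =>
    intro j hj
    rcases Nat.lt_succ_iff_lt_or_eq.1 hj with hj | rfl
    · exact ih j hj
    have h1 : (arity deg P u * arity deg P z).coeff j = 0 := by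
      rw [← map_mul, h, map_zero, Polynomial.coeff_zero]
    -- All other terms pair a coefficient of `u` with a coefficient of `z` of arity below `j`,
    -- already zero by induction.
    rw [Polynomial.coeff_mul, Finset.sum_eq_single (0, j)] at h1
    · rw [coeff_zero_arity, ← Algebra.smul_def] at h1
      exact (smul_eq_zero.1 h1).resolve_left hu
    · rintro ⟨p, q⟩ hp hne
      rw [Finset.HasAntidiagonal.mem_antidiagonal] at hp
      rw [ih q (by by_contra hq; exact hne (by ext <;> simp at * <;> omega)), mul_zero]
    · simp

end GSym


/-! ### Bump functions, local frames, coordinates -/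

namespace Mfd

instance (M : Mfd) : LocallyCompactSpace M :=
  ChartedSpace.locallyCompactSpace (EuclideanSpace ℝ (Fin M.dim)) M

theorem exists_bump {M : Mfd} {x : M} {U : Set M} (hU : U ∈ 𝓝 x) :
    ∃ h : M.Fun, (∀ᶠ y in 𝓝 x, h y = 1) ∧ tsupport h ⊆ U := by
  obtain ⟨f, -, hf⟩ := (SmoothBumpFunction.nhds_basis_tsupport (I := 𝓡 M.dim) x).mem_iff.1 hU
  exact ⟨⟨f, f.contMDiff⟩, f.eventuallyEq_one, hf⟩

/-- The form in which bump functions are used: after multiplication by `h`, an identity valid near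
`x` holds everywhere, by distinguishing whether `h y` vanishes. -/
theorem exists_bump_mem {M : Mfd} {x : M} {p : M → Prop} (hp : ∀ᶠ y in 𝓝 x, p y) :
    ∃ h : M.Fun, (∀ᶠ y in 𝓝 x, h y = 1) ∧ ∀ y, h y ≠ 0 → p y := by
  obtain ⟨h, h1, h2⟩ := exists_bump hp
  exact ⟨h, h1, fun y hy => h2 (subset_tsupport _ hy)⟩

end Mfd

namespace VB

variable {M N : Mfd}

@[simp] theorem smulSec_apply (V : VB M) (f : M.Fun) (σ : V.Sec) (x : M) :
    V.smulSec f σ x = f x • σ x := rfl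

/-- A local frame near `x`, cut off to global sections `sec a`, together with cut off coordinates
`coord` of the fibres. -/
structure LocalFrame (V : VB M) (x : M) where
  n : ℕ
  sec : Fin n → V.Sec
  coord : ∀ y, V.fib y →ₗ[ℝ] (Fin n → ℝ)
  smooth : ∀ (σ : V.Sec) (a : Fin n), ContMDiff (𝓡 M.dim) 𝓘(ℝ, ℝ) ∞ fun y => coord y (σ y) a
  expand : ∀ᶠ y in 𝓝 x, ∀ v : V.fib y, v = ∑ a, coord y v a • sec a y
  dual : ∀ᶠ y in 𝓝 x, ∀ a, coord y (sec a y) = Pi.single a 1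

/-- Both the frame of a trivialization and its coefficient functionals are multiplied by the same
bump function. They become global and smooth, and remain dual to each other where the bump function
is 1. -/
theorem exists_localFrame (V : VB M) (x : M) : Nonempty (V.LocalFrame x) := by
  let e := trivializationAt V.F V.fib x
  let b := Module.finBasis ℝ V.F
  have hx : x ∈ e.baseSet := FiberBundle.mem_baseSet_trivializationAt' x
  have : ContMDiffVectorBundle 1 V.F V.fib (𝓡 M.dim) :=
    ContMDiffVectorBundle.of_le (n := ∞) (by simp)
  obtain ⟨h, h1, hU⟩ := Mfd.exists_bump (e.open_baseSet.mem_nhds hx)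
  refine ⟨⟨_, fun a => ⟨fun y => h y • e.localFrame b a y, ?_⟩,
    fun y => LinearMap.pi fun a => h y • e.localFrameCoeff (𝓡 M.dim) b a y, fun σ a => ?_, ?_, ?_⟩⟩
  · exact ContMDiffOn.smul_section_of_tsupport h.contMDiff.contMDiffOn e.open_baseSet hU
      (e.contMDiffOn_localFrame_baseSet _ b a)
  · refine contMDiff_of_tsupport fun y hy => ?_
    have hy' : y ∈ e.baseSet := hU (tsupport_smul_subset_left h _ hy)
    exact h.contMDiff.contMDiffAt.smul
      (contMDiffAt_localFrameCoeff b hy' σ.contMDiff.contMDiffAt a)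
  · filter_upwards [h1, e.open_baseSet.mem_nhds hx] with y hy hy' v
    classical
    -- The expansion in a frame is stated for sections; no continuity is needed, so `v` is extended
    -- by zero.
    let s : ∀ z, V.fib z := Function.update 0 y v
    have hs : s y = v := Function.update_self ..
    have := e.eq_sum_localFrameCoeff_smul (I := 𝓡 M.dim) (b := b) (s := s) hy'
    rw [hs] at this
    refine this.trans (Finset.sum_congr rfl fun a _ => ?_)
    simp [hy]
  · filter_upwards [h1, e.open_baseSet.mem_nhds hx] with y hy hy' a
    funext c
    change h y • e.localFrameCoeff (𝓡 M.dim) b c y (h y • e.localFrame b a y) = _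
    rw [hy, one_smul, one_smul, e.localFrameCoeff_apply_of_mem_baseSet b hy' (e.localFrame b a) c,
      e.localFrame_apply_of_mem_baseSet b hy', Module.Basis.repr_self, Finsupp.single_apply,
      Pi.single_apply]
    exact if_congr eq_comm rfl rfl

/-- A chosen local frame near `x`. -/
def localFrame (V : VB M) (x : M) : V.LocalFrame x := (V.exists_localFrame x).some

namespace LocalFrame

variable {V : VB M} {x : M} (e : V.LocalFrame x)

/-- The coefficient functions of a section in a local frame. -/
def coeff (a : Fin e.n) : V.Sec →ₗ[ℝ] M.Fun where
  toFun σ := ⟨fun y => e.coord y (σ y) a, e.smooth σ a⟩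
  map_add' σ τ := by ext y; exact congrFun ((e.coord y).map_add (σ y) (τ y)) a
  map_smul' r σ := by ext y; exact congrFun ((e.coord y).map_smul r (σ y)) a

@[simp] theorem coeff_apply (a : Fin e.n) (σ : V.Sec) (y : M) :
    e.coeff a σ y = e.coord y (σ y) a := rfl

theorem coeff_smulSec (a : Fin e.n) (f : M.Fun) (σ : V.Sec) :
    e.coeff a (V.smulSec f σ) = f * e.coeff a σ := by
  ext y
  simp

theorem eventually_eq : ∀ᶠ y in 𝓝 x, ∀ σ : V.Sec, σ y = ∑ a, e.coeff a σ y • e.sec a y :=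
  e.expand.mono fun y h σ => h (σ y)

end LocalFrame

/-- The pairing of a section of the dual with a section. -/
def pairing {V : VB M} (α : V.dual.Sec) (X : V.Sec) : M.Fun :=
  ⟨fun x => functional (α x) (X x), (dual_smooth_total V α).comp X.contMDiff⟩

theorem d_mul (f g : M.Fun) (x : M) : d (f * g) x = f x • d g x + g x • d f x := by
  have hf := (f.contMDiff.mdifferentiable (by simp)) x
  have hg := (g.contMDiff.mdifferentiable (by simp)) x
  exact (hf.hasMFDerivAt.mul hg.hasMFDerivAt).mfderiv

theorem d_add (f g : M.Fun) (x : M) : d (f + g) x = d f x + d g x := by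
  have hf := (f.contMDiff.mdifferentiable (by simp)) x
  have hg := (g.contMDiff.mdifferentiable (by simp)) x
  exact (hf.hasMFDerivAt.add hg.hasMFDerivAt).mfderiv

theorem d_smul (r : ℝ) (f : M.Fun) (x : M) : d (r • f) x = r • d f x := by
  have hf := (f.contMDiff.mdifferentiable (by simp)) x
  exact (hf.hasMFDerivAt.const_smul r).mfderiv

theorem d_comp {φ : M.Map N} (f : N.Fun) :
    d (f.comp φ) = (Hom.tangent φ).pullSec (d f) := by
  ext x : 1
  have hf := (f.contMDiff.mdifferentiable (by simp)) (φ x)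
  have hφ := (φ.contMDiff.mdifferentiable (by simp)) x
  exact mfderiv_comp x hf hφ

end VB


/-! ### Hadamard's lemma -/

section Hadamard

variable {E : Type} [NormedAddCommGroup E] [NormedSpace ℝ E] [FiniteDimensional ℝ E]

/-- Differentiation under the integral sign, by induction on `n`. The target `G` varies because the
derivative takes values in `E →L[ℝ] G`. -/
theorem contDiff_integral_nat (n : ℕ) : ∀ {G : Type} [NormedAddCommGroup G] [NormedSpace ℝ G]
    [CompleteSpace G] {Φ : ℝ × E → G}, ContDiff ℝ n Φ →
      ContDiff ℝ n fun v => ∫ t in (0 : ℝ)..1, Φ (t, v) := by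
  induction n with
  | zero =>
    intro G _ _ _ Φ hΦ
    have hc : Continuous Φ := hΦ.continuous
    refine contDiff_zero.2 ?_
    exact intervalIntegral.continuous_parametric_intervalIntegral_of_continuous'
      (f := fun v t => Φ (t, v)) (by fun_prop) 0 1
  | succ n ih =>
    intro G _ _ _ Φ hΦ
    have hΦ' : ContDiff ℝ (n + 1) Φ := by exact_mod_cast hΦ
    have hd : Differentiable ℝ Φ := hΦ'.differentiable (by simp)
    have hf : ContDiff ℝ n (fderiv ℝ Φ) := hΦ'.fderiv_right le_rfl
    let Φ' : ℝ × E → E →L[ℝ] G := fun p => (fderiv ℝ Φ p).comp (ContinuousLinearMap.inr ℝ ℝ E)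
    have hΦ'c : ContDiff ℝ n Φ' := hf.clm_comp contDiff_const
    have hc : Continuous Φ := hΦ'.continuous
    have hc' : Continuous Φ' := hΦ'c.continuous
    have := contDiff_succ_iff_hasFDerivAt (𝕜 := ℝ) (n := n)
      (f := fun v => ∫ t in (0 : ℝ)..1, Φ (t, v))
    rw [Nat.cast_succ]
    refine this.2 ⟨fun v => ∫ t in (0 : ℝ)..1, Φ' (t, v), ih hΦ'c, fun v₀ => ?_⟩
    -- The dominating constant is a bound of the partial derivative on [0,1] times a closed ball,
    -- compact in finite dimension.
    obtain ⟨C, hC⟩ := ((isCompact_uIcc (a := (0 : ℝ)) (b := 1)).prod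
      (isCompact_closedBall v₀ 1)).exists_bound_of_continuousOn hc'.continuousOn
    refine intervalIntegral.hasFDerivAt_integral_of_dominated_of_fderiv_le
      (F := fun v t => Φ (t, v)) (F' := fun v t => Φ' (t, v)) (bound := fun _ => C)
      (Metric.closedBall_mem_nhds v₀ one_pos) ?_ ?_ ?_ ?_ ?_ ?_
    · exact Filter.Eventually.of_forall fun v =>
        (show Continuous fun t => Φ (t, v) by fun_prop).aestronglyMeasurable
    · exact (show Continuous fun t => Φ (t, v₀) by fun_prop).intervalIntegrable 0 1
    · exact (show Continuous fun t => Φ' (t, v₀) by fun_prop).aestronglyMeasurable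
    · exact Filter.Eventually.of_forall fun t ht v hv =>
        hC (t, v) ⟨Set.uIoc_subset_uIcc ht, hv⟩
    · exact intervalIntegrable_const
    · exact Filter.Eventually.of_forall fun t _ v _ =>
        (hd (t, v)).hasFDerivAt.comp v (hasFDerivAt_prodMk_right t v)

/-- Hadamard's lemma: integrate d/dt F(c + t(v − c)) over [0,1]; the functions `G l` are the
integrals of the partial derivatives along the segment. -/
theorem hadamard_vector {n : ℕ} {F : EuclideanSpace ℝ (Fin n) → ℝ} (hF : ContDiff ℝ ∞ F)
    (c : EuclideanSpace ℝ (Fin n)) :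
    ∃ G : Fin n → EuclideanSpace ℝ (Fin n) → ℝ, (∀ l, ContDiff ℝ ∞ (G l)) ∧
      ∀ v, F v = F c + ∑ l, (v l - c l) * G l v := by
  have hf : ContDiff ℝ ∞ (fderiv ℝ F) := hF.fderiv_right (by simp)
  let b := EuclideanSpace.basisFun (Fin n) ℝ
  let Φ : Fin n → ℝ × EuclideanSpace ℝ (Fin n) → ℝ :=
    fun l p => fderiv ℝ F (c + p.1 • (p.2 - c)) (b l)
  have hΦ : ∀ l, ContDiff ℝ ∞ (Φ l) := fun l =>
    (hf.comp (by fun_prop)).clm_apply contDiff_const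
  refine ⟨fun l v => ∫ t in (0 : ℝ)..1, Φ l (t, v), fun l => contDiff_infty.2 fun k =>
    contDiff_integral_nat k ((hΦ l).of_le (by exact_mod_cast le_top)), fun v => ?_⟩
  have h1 : ∀ t : ℝ, HasDerivAt (fun t : ℝ => F (c + t • (v - c)))
      (fderiv ℝ F (c + t • (v - c)) (v - c)) t := by
    intro t
    have h2 : HasDerivAt (fun t : ℝ => c + t • (v - c)) (v - c) t := by
      simpa using ((hasDerivAt_id t).smul_const (v - c)).const_add c
    exact ((hF.differentiable (by simp)) _).hasFDerivAt.comp_hasDerivAt t h2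
  have hcont : Continuous fun t : ℝ => fderiv ℝ F (c + t • (v - c)) (v - c) := by
    have := hf.continuous
    fun_prop
  have h3 := intervalIntegral.integral_eq_sub_of_hasDerivAt (a := 0) (b := 1)
    (fun t _ => h1 t) (hcont.intervalIntegrable 0 1)
  have h4 : ∀ t : ℝ, fderiv ℝ F (c + t • (v - c)) (v - c) = ∑ l, (v l - c l) * Φ l (t, v) := by
    intro t
    simp only [Φ]
    generalize fderiv ℝ F (c + t • (v - c)) = D
    conv_lhs => rw [← b.sum_repr (v - c), map_sum]
    exact Finset.sum_congr rfl fun l _ => by simp [b]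
  simp only [h4] at h3
  rw [intervalIntegral.integral_finsetSum] at h3
  · simp only [intervalIntegral.integral_const_mul] at h3
    rw [h3]
    simp
  · intro l _
    have := (hΦ l).continuous
    exact Continuous.intervalIntegrable (by fun_prop) 0 1

end Hadamard

/-! ### Local coordinates -/

namespace Mfd

open VB

/-- Functions `fn l` which are coordinates near `x`, and the dual vector fields `vec l`. -/
structure Coordinates (M : Mfd) (x : M) where
  fn : Fin M.dim → M.Fun
  vec : Fin M.dim → (VB.tangent M).Sec
  dual : ∀ᶠ y in 𝓝 x, ∀ l m, functional (d (fn l) y) (vec m y) = if l = m then 1 else 0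
  expand : ∀ᶠ y in 𝓝 x, ∀ v : (VB.tangent M).fib y, v = ∑ l, functional (d (fn l) y) v • vec l y
  hadamard : ∀ f : M.Fun, ∃ g : Fin M.dim → M.Fun,
    ∀ᶠ y in 𝓝 x, f y = f x + ∑ l, (fn l y - fn l x) * g l y

theorem exists_smul_smooth {M : Mfd} {U : Set M} (hU : IsOpen U) {h : M.Fun} (hh : tsupport h ⊆ U)
    {f : M → ℝ} (hf : ContMDiffOn (𝓡 M.dim) 𝓘(ℝ, ℝ) ∞ f U) :
    ContMDiff (𝓡 M.dim) 𝓘(ℝ, ℝ) ∞ fun y => h y * f y := by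
  refine contMDiff_of_tsupport fun y hy => ?_
  have hy' : y ∈ U := hh (tsupport_smul_subset_left h _ hy)
  exact h.contMDiff.contMDiffAt.smul ((hf y hy').contMDiffAt (hU.mem_nhds hy'))

/-- Euclidean space. -/
def euclid (n : ℕ) : Mfd where
  dim := n
  carrier := EuclideanSpace ℝ (Fin n)

theorem exists_coordinates (M : Mfd) (x : M) : Nonempty (M.Coordinates x) := by
  let e := trivializationAt (EuclideanSpace ℝ (Fin M.dim)) (fun y : M => TangentSpace (𝓡 M.dim) y) x
  let c := chartAt (EuclideanSpace ℝ (Fin M.dim)) x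
  have hbase : e.baseSet = c.source := rfl
  have hx : x ∈ c.source := mem_chart_source _ x
  let b := (EuclideanSpace.basisFun (Fin M.dim) ℝ).toBasis
  obtain ⟨h, h1, hU⟩ := Mfd.exists_bump (c.open_source.mem_nhds hx)
  have hcs : ContMDiffOn (𝓡 M.dim) (𝓡 M.dim) ∞ c c.source := contMDiffOn_chart
  have hcoord : ∀ l, ContMDiffOn (𝓡 M.dim) 𝓘(ℝ, ℝ) ∞ (fun y => c y l) c.source := fun l =>
    (EuclideanSpace.proj (𝕜 := ℝ) l).contMDiff.comp_contMDiffOn hcs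
  let ξ : Fin M.dim → M.Fun := fun l => ⟨fun y => h y * c y l,
    exists_smul_smooth c.open_source hU (hcoord l)⟩
  let X : Fin M.dim → (VB.tangent M).Sec := fun l => ⟨fun y => h y • e.localFrame b l y,
    ContMDiffOn.smul_section_of_tsupport h.contMDiff.contMDiffOn e.open_baseSet hU
      (e.contMDiffOn_localFrame_baseSet _ b l)⟩
  let A : ∀ y, (VB.tangent M).fib y →ₗ[ℝ] EuclideanSpace ℝ (Fin M.dim) :=
    fun y => (e.continuousLinearMapAt ℝ y).toLinearMap
  -- Near `x` the cut off coordinate agrees with the chart coordinate, and the derivative of the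
  -- chart is the trivialization of the tangent bundle it induces.
  have hdξ : ∀ᶠ y in 𝓝 x, ∀ l (v : (VB.tangent M).fib y),
      functional (d (ξ l) y) v = A y v l := by
    filter_upwards [h1.eventually_nhds, c.open_source.mem_nhds hx] with y hy hyc l v
    have h2 : (ξ l : M → ℝ) =ᶠ[𝓝 y] fun z => EuclideanSpace.proj (𝕜 := ℝ) l (c z) := by
      filter_upwards [hy] with z hz
      change h z * c z l = c z l
      rw [hz, one_mul]
    have h3 : MDifferentiableAt (𝓡 M.dim) (𝓡 M.dim) c y :=
      ((hcs y hyc).contMDiffAt (c.open_source.mem_nhds hyc)).mdifferentiableAt (by simp)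
    have h4 := TangentBundle.continuousLinearMapAt_trivializationAt (I := 𝓡 M.dim) hyc
    change mfderiv (𝓡 M.dim) 𝓘(ℝ, ℝ) (ξ l) y v = _
    rw [h2.mfderiv_eq]
    have h5 := mfderiv_comp y
      ((EuclideanSpace.proj (𝕜 := ℝ) l).mdifferentiable (c y)) h3
    refine (congrArg (fun D => D v) h5).trans ?_
    rw [ContinuousLinearMap.mfderiv_eq]
    refine congrArg (fun D : TangentSpace (𝓡 M.dim) y →L[ℝ] EuclideanSpace ℝ (Fin M.dim) =>
      D v l) ?_
    exact h4.symm
  have hX : ∀ᶠ y in 𝓝 x, ∀ m, A y (X m y) = b m := by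
    filter_upwards [h1, c.open_source.mem_nhds hx] with y hy hyc m
    change e.continuousLinearMapAt ℝ y (h y • e.localFrame b m y) = b m
    have hyc' : y ∈ e.baseSet := hyc
    rw [hy, one_smul, e.localFrame_apply_of_mem_baseSet b hyc']
    change e.continuousLinearMapAt ℝ y ((b.map (e.linearEquivAt ℝ y hyc').symm) m) = b m
    rw [Module.Basis.map_apply, e.continuousLinearMapAt_apply_of_mem ℝ hyc']
    exact (e.linearEquivAt ℝ y hyc').apply_symm_apply (b m)
  refine ⟨⟨ξ, X, ?_, ?_, fun f => ?_⟩⟩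
  · filter_upwards [hdξ, hX] with y h2 h3 l m
    rw [h2, h3]
    simp [b, EuclideanSpace.basisFun_apply]
  · filter_upwards [hdξ, hX, c.open_source.mem_nhds hx] with y h2 h3 hyc v
    have hinj : Function.Injective (A y) := by
      intro v w hvw
      change e.continuousLinearMapAt ℝ y v = e.continuousLinearMapAt ℝ y w at hvw
      exact (e.symmL_continuousLinearMapAt (R := ℝ) hyc v).symm.trans
        ((congrArg (e.symmL ℝ y) hvw).trans (e.symmL_continuousLinearMapAt hyc w))
    refine hinj ?_
    rw [map_sum]
    simp only [map_smul, h3, h2]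
    exact ((EuclideanSpace.basisFun (Fin M.dim) ℝ).sum_repr _).symm
  · obtain ⟨k, hk1, hkU⟩ := Mfd.exists_bump (M := euclid M.dim) (x := c x) (U := c.target)
      (c.open_target.mem_nhds (c.map_source hx))
    -- The chart image need not contain the segments used in Hadamard's lemma, so the local
    -- representative is first cut off to a function on all of Euclidean space.
    let F : EuclideanSpace ℝ (Fin M.dim) → ℝ := fun v => k v * f (c.symm v)
    have hF : ContDiff ℝ ∞ F := by
      refine ContMDiff.contDiff (exists_smul_smooth (M := euclid M.dim) (U := c.target)
        c.open_target hkU (f := fun v => f (c.symm v)) ?_)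
      have h2 : ContMDiffOn (𝓡 M.dim) 𝓘(ℝ, ℝ) ∞ (fun v => f (c.symm v)) c.target :=
        f.contMDiff.comp_contMDiffOn contMDiffOn_chart_symm
      exact h2
    obtain ⟨G, hG, hFG⟩ := hadamard_vector hF (c x)
    refine ⟨fun l => ⟨fun y => h y * G l (c y), exists_smul_smooth c.open_source hU
      ((hG l).contMDiff.comp_contMDiffOn hcs)⟩, ?_⟩
    have hFc : ∀ᶠ y in 𝓝 x, F (c y) = f y := by
      filter_upwards [(c.continuousAt hx).eventually hk1, c.open_source.mem_nhds hx] with y hy hyc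
      change k (c y) * f (c.symm (c y)) = f y
      rw [hy, one_mul, c.left_inv hyc]
    have hcx := hFc.self_of_nhds
    have hhx := h1.self_of_nhds
    filter_upwards [hFc, h1] with y hy hhy
    rw [← hy, ← hcx, hFG (c y)]
    congr 1
    refine Finset.sum_congr rfl fun l _ => ?_
    change _ = (h y * c y l - h x * c x l) * (h y * G l (c y))
    rw [hhy, hhx, one_mul, one_mul, one_mul]

/-- Chosen local coordinates near `x`. -/
def coordinates (M : Mfd) (x : M) : M.Coordinates x := (M.exists_coordinates x).some

/-! ### Characters of the algebra of smooth functions -/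

/-- A smooth function with compact sublevel sets. -/
theorem exists_exhaustion (M : Mfd) : ∃ f : M.Fun, ∀ c : ℝ, IsCompact {x | f x ≤ c} := by
  let K := CompactExhaustion.choice M
  -- A partition of unity gives `f` above the index of the first compact set containing the point.
  -- Half lines are convex, and near `x` the index exceeds that of `x` by at most 1.
  obtain ⟨f, hf⟩ := exists_contMDiffMap_forall_mem_convex_of_local_const (n := (⊤ : ℕ∞)) (𝓡 M.dim)
    (t := fun x => Set.Ici ((K.find x : ℕ) : ℝ)) (fun x => convex_Ici _) (fun x => by
      refine ⟨((K.find x + 1 : ℕ) : ℝ), ?_⟩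
      have h1 : x ∈ interior (K (K.find x + 1)) := K.subset_interior_succ _ (K.mem_find x)
      filter_upwards [isOpen_interior.mem_nhds h1] with y hy
      refine (Nat.cast_le (α := ℝ)).2 ?_
      exact K.mem_iff_find_le.1 (interior_subset hy))
  refine ⟨f, fun c => ?_⟩
  refine (K.isCompact ⌈c⌉₊).of_isClosed_subset
    (isClosed_le f.contMDiff.continuous continuous_const) fun x hx => ?_
  refine K.mem_iff_find_le.2 ?_
  have h2 : ((K.find x : ℕ) : ℝ) ≤ ⌈c⌉₊ := (hf x).trans (le_trans hx (Nat.le_ceil c))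
  exact_mod_cast h2

theorem isUnit_of_ne_zero {M : Mfd} {f : M.Fun} (h : ∀ x, f x ≠ 0) : IsUnit f := by
  refine IsUnit.of_mul_eq_one ⟨fun x => (f x)⁻¹, f.contMDiff.inv₀ h⟩ ?_
  ext x
  exact mul_inv_cancel₀ (h x)

/-- Evaluation at a point. -/
def evalAt {M : Mfd} (x : M) : M.Fun →ₐ[ℝ] ℝ :=
  (Pi.evalAlgHom ℝ (fun _ : M => ℝ) x).comp ContMDiffMap.coeFnAlgHom

/-- If `χ` is no evaluation, each point `x` has a function `g x` with `χ (g x) ≠ g x x`. Compactness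
of a sublevel set leaves finitely many of these, and a sum of squares becomes a nowhere vanishing
function, hence a unit, in the kernel of `χ`. -/
theorem exists_eq_eval {M : Mfd} (χ : M.Fun →ₐ[ℝ] ℝ) : ∃ x : M, ∀ f, χ f = f x := by
  by_contra! hcon
  choose g hg using hcon
  obtain ⟨f, hf⟩ := exists_exhaustion M
  have hK := hf (χ f)
  obtain ⟨t, ht⟩ := hK.elim_finite_subcover (fun x : M => {y | g x y ≠ χ (g x)})
    (fun x => isOpen_ne_fun (g x).contMDiff.continuous continuous_const)
    (fun x _ => Set.mem_iUnion.2 ⟨x, (hg x).symm⟩)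
  -- The first square is positive outside the compact set {f ≤ χ f}; on it, one of the others is.
  let q : M.Fun := (f - algebraMap ℝ _ (χ f)) ^ 2 + ∑ x ∈ t, (g x - algebraMap ℝ _ (χ (g x))) ^ 2
  have hq0 : χ q = 0 := by simp [q]
  have hq : ∀ y, q y ≠ 0 := by
    intro y
    have hqy : q y = (f y - χ f) ^ 2 + ∑ x ∈ t, (g x y - χ (g x)) ^ 2 := by
      change evalAt y q = _
      simp only [q, map_add, map_sum, map_pow, map_sub, AlgHom.commutes]
      rfl
    rw [hqy]
    by_cases hy : f y ≤ χ f
    · obtain ⟨x, hx, hxy⟩ := Set.mem_iUnion₂.1 (ht hy)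
      have h1 : 0 < (g x y - χ (g x)) ^ 2 := by
        have : g x y - χ (g x) ≠ 0 := sub_ne_zero.2 hxy
        positivity
      have h2 := Finset.single_le_sum (f := fun x => (g x y - χ (g x)) ^ 2)
        (fun i _ => sq_nonneg _) hx
      have := sq_nonneg (f y - χ f)
      linarith
    · have h1 : 0 < (f y - χ f) ^ 2 := by
        have : f y - χ f ≠ 0 := by
          intro h
          exact hy (by linarith)
        positivity
      have h2 := Finset.sum_nonneg (s := t) (f := fun x => (g x y - χ (g x)) ^ 2)
        (fun i _ => sq_nonneg _)
      linarith
  have := (isUnit_of_ne_zero hq).map χ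
  rw [hq0] at this
  exact not_isUnit_zero this

end Mfd


/-! ### The algebra `Γ(S V*)` -/

namespace GVB

variable {M : Mfd} (V : GVB M)

/-- The section underlying an element of `Γ(S V*)`. -/
def toSection : V.Alg →ₐ[ℝ] ∀ x, V.SFib x := DirectSum.coeAlgHom V.SSec

@[simp] theorem toSection_lof (k : ℤ) (a : V.SSec k) :
    V.toSection (DirectSum.lof ℝ ℤ (fun k => V.SSec k) k a) = a :=
  DirectSum.coeAlgHom_of V.SSec k a

/-- Homogeneous components can be read off fibrewise since the fibre degrees are independent.
Identities in the direct sum `V.Alg` may thus be checked at each point, which is how most of them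
are proved. -/
theorem proj_toSection (k : ℤ) (a : V.Alg) (x : M) :
    GSym.proj (fun i : ℤ => -i) (fun i => (V i).dual.fib x) k (V.toSection a x) = (a k).1 x := by
  induction a using DirectSum.induction_on with
  | zero => simp
  | add a b ha hb =>
    rw [map_add, Pi.add_apply, map_add, ha, hb]
    simp
  | of j a =>
    rw [← DirectSum.lof_eq_of ℝ, toSection_lof]
    by_cases h : j = k
    · subst h
      rw [GSym.proj_of_mem _ _ (a.2.2 x), DirectSum.lof_apply]
    · rw [GSym.proj_of_mem_ne _ _ (a.2.2 x) h, DirectSum.lof_eq_of, DirectSum.of_eq_of_ne _ _ _ (Ne.symm h)]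
      rfl

variable {V} in
theorem toSection_injective {a b : V.Alg} (h : ∀ x, V.toSection a x = V.toSection b x) : a = b := by
  refine DFinsupp.ext fun k => Subtype.ext (funext fun x => ?_)
  rw [← proj_toSection, h, proj_toSection]

theorem toSection_isSmooth (a : V.Alg) : V.IsSmooth (V.toSection a) := by
  induction a using DirectSum.induction_on with
  | zero =>
    rw [map_zero]
    exact V.isSmooth_of_mem (zero_mem _)
  | add a b ha hb =>
    rw [map_add]
    exact ha.add V hb
  | of k a =>
    rw [← DirectSum.lof_eq_of ℝ, toSection_lof]
    exact a.2.1

/-- A homogeneous smooth section, as an element of the algebra. -/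
def ofSection (k : ℤ) : V.SSec k →ₗ[ℝ] V.Alg := DirectSum.lof ℝ ℤ (fun k => V.SSec k) k

/-- The smooth functions inside `Γ(S V*)`, as an algebra morphism. -/
def funHom : M.Fun →ₐ[ℝ] V.Alg where
  toFun := V.ofFun
  map_one' := toSection_injective fun x => by simp [ofFun, funSection]
  map_mul' f g := toSection_injective fun x => by simp [ofFun, funSection]
  map_zero' := toSection_injective fun x => by simp [ofFun, funSection]
  map_add' f g := toSection_injective fun x => by simp [ofFun, funSection]
  commutes' r := toSection_injective fun x => by
    rw [AlgHom.commutes]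
    simp [ofFun, funSection]
    rfl

@[simp] theorem toSection_ofFun (f : M.Fun) (x : M) :
    V.toSection (V.ofFun f) x = algebraMap ℝ _ (f x) := by
  simp [ofFun, funSection]

@[simp] theorem toSection_ofSec (i : ℤ) (σ : (V i).dual.Sec) (x : M) :
    V.toSection (V.ofSec i σ) x =
      GSym.gen (fun i : ℤ => -i) (fun i => (V i).dual.fib x) i (σ x) := by
  simp [ofSec, dualSection]

/-- The sections of the dual of `Vᵢ` inside `Γ(S V*)`, as a linear map. -/
def secHom (i : ℤ) : (V i).dual.Sec →ₗ[ℝ] V.Alg where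
  toFun := V.ofSec i
  map_add' σ τ := toSection_injective fun x => by simp
  map_smul' r σ := toSection_injective fun x => by simp

theorem ofSec_smulSec (i : ℤ) (f : M.Fun) (σ : (V i).dual.Sec) :
    V.ofSec i ((V i).dual.smulSec f σ) = V.ofFun f * V.ofSec i σ :=
  toSection_injective fun x => by simp [Algebra.smul_def]

theorem ofFun_mem (f : M.Fun) : V.ofFun f ∈ sumGrading V.SSec 0 := ⟨_, rfl⟩

theorem ofSec_mem (i : ℤ) (σ : (V i).dual.Sec) : V.ofSec i σ ∈ sumGrading V.SSec (-i) := ⟨_, rfl⟩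

/-- The polynomials in smooth functions and smooth sections. -/
def polys : Subalgebra ℝ V.Alg :=
  Algebra.adjoin ℝ (Set.range V.ofFun ∪ ⋃ i, Set.range (V.ofSec i))

theorem exists_polys {a : ∀ x, V.SFib x} (ha : a ∈ V.polySections) :
    ∃ q ∈ V.polys, V.toSection q = a := by
  have h : V.polySections ≤ V.polys.map V.toSection := by
    refine Algebra.adjoin_le ?_
    rintro _ (⟨f, rfl⟩ | h)
    · exact ⟨V.ofFun f, Algebra.subset_adjoin (Or.inl ⟨f, rfl⟩), by simp [ofFun]⟩
    · obtain ⟨i, σ, rfl⟩ := Set.mem_iUnion.1 h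
      exact ⟨V.ofSec i σ, Algebra.subset_adjoin (Or.inr (Set.mem_iUnion.2 ⟨i, σ, rfl⟩)),
        by simp [ofSec]⟩
  exact h ha

/-- Up to multiplication by a bump function, an element of `Γ(S V*)` is a polynomial. -/
theorem exists_bump_mul_eq (a : V.Alg) (x : M) :
    ∃ (h : M.Fun) (q : V.Alg), h x = 1 ∧ q ∈ V.polys ∧ V.ofFun h * a = V.ofFun h * q := by
  obtain ⟨U, hU, b, hb, hab⟩ := V.toSection_isSmooth a x
  obtain ⟨q, hq, rfl⟩ := V.exists_polys hb
  obtain ⟨h, h1, h2⟩ := Mfd.exists_bump hU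
  refine ⟨h, q, h1.self_of_nhds, hq, toSection_injective fun y => ?_⟩
  rw [map_mul, map_mul, Pi.mul_apply, Pi.mul_apply]
  by_cases hy : y ∈ U
  · rw [hab y hy]
  · have : h y = 0 := by
      by_contra hne
      exact hy (h2 (subset_tsupport _ hne))
    simp [this]

end GVB

/-! ### Extension of maps given on generators -/

/-- Values on generators of a morphism from `Γ(S V*)` to a product of algebras, over a map of base
spaces. -/
structure GenData {M : Mfd} (V : GVB M) (N : Type) [TopologicalSpace N] (B : N → Type)
    [∀ y, Ring (B y)] [∀ y, Algebra ℝ (B y)] where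
  base : N → M
  cont : Continuous base
  onFun : M.Fun →ₐ[ℝ] ∀ y, B y
  onSec : ∀ i, (V i).dual.Sec →ₗ[ℝ] ∀ y, B y
  onSec_smul : ∀ i f σ, onSec i ((V i).dual.smulSec f σ) = onFun f * onSec i σ
  fun_comm : ∀ f i σ, onFun f * onSec i σ = onSec i σ * onFun f
  sec_comm : ∀ i j σ τ,
    onSec i σ * onSec j τ = (-1 : ℤˣ) ^ (-i * -j) • (onSec j τ * onSec i σ)
  reg : ∀ y (h : M.Fun) (z : B y), h (base y) = 1 → onFun h y * z = 0 → z = 0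

namespace GenData

variable {M : Mfd} {V : GVB M} {N : Type} [TopologicalSpace N] {B : N → Type}
  [∀ y, Ring (B y)] [∀ y, Algebra ℝ (B y)] (D : GenData V N B)

/-- A bump function `k` with `k * f = 0` and value 1 at the base point is cancelled by `reg`: the
value at `y` sees only the germ at `D.base y`. -/
theorem onFun_local {f : M.Fun} {y : N} (h : ∀ᶠ x in 𝓝 (D.base y), f x = 0) :
    D.onFun f y = 0 := by
  obtain ⟨k, h1, h2⟩ := Mfd.exists_bump_mem h
  refine D.reg y k _ h1.self_of_nhds ?_
  have : k * f = 0 := by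
    ext x
    by_cases hx : k x = 0
    · simp [hx]
    · simp [h2 x hx]
  rw [← Pi.mul_apply, ← map_mul, this, map_zero, Pi.zero_apply]

theorem onSec_local {i : ℤ} {σ : (V i).dual.Sec} {y : N}
    (h : ∀ᶠ x in 𝓝 (D.base y), σ x = 0) : D.onSec i σ y = 0 := by
  obtain ⟨k, h1, h2⟩ := Mfd.exists_bump_mem h
  refine D.reg y k _ h1.self_of_nhds ?_
  have : (V i).dual.smulSec k σ = 0 := by
    ext x : 1
    by_cases hx : k x = 0
    · simp [hx]
    · simp [h2 x hx]
  rw [← Pi.mul_apply, ← D.onSec_smul, this, map_zero, Pi.zero_apply]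

variable (V) in
/-- Formal polynomials in the generators. -/
abbrev Free : Type := FreeAlgebra ℝ (M.Fun ⊕ Σ i, (V i).dual.Sec)

variable (V) in
/-- The section of `S V*` given by a formal polynomial. -/
def ev : Free V →ₐ[ℝ] ∀ x, V.SFib x :=
  FreeAlgebra.lift ℝ (Sum.elim V.funSection fun p => V.dualSection p.1 p.2)

/-- The value of a formal polynomial in the target. -/
def img : Free V →ₐ[ℝ] ∀ y, B y :=
  FreeAlgebra.lift ℝ (Sum.elim D.onFun fun p => D.onSec p.1 p.2)

theorem exists_ev_eq {b : ∀ x, V.SFib x} (hb : b ∈ V.polySections) : ∃ p, ev V p = b := by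
  have h : V.polySections ≤ (ev V).range := by
    refine Algebra.adjoin_le ?_
    rintro _ (⟨f, rfl⟩ | h)
    · exact ⟨FreeAlgebra.ι ℝ (Sum.inl f), FreeAlgebra.lift_ι_apply _ _⟩
    · obtain ⟨i, σ, rfl⟩ := Set.mem_iUnion.1 h
      exact ⟨FreeAlgebra.ι ℝ (Sum.inr ⟨i, σ⟩), FreeAlgebra.lift_ι_apply _ _⟩
  exact h hb

/-! ### Formal polynomials in a local frame -/

section frame

variable (V) in
/-- The coordinate spaces of chosen frames near a point. -/
abbrev Coord (x : M) (i : ℤ) : Type := Fin ((V i).dual.localFrame x).n → ℝ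

variable (V) in
/-- The fibrewise linear map given by a chosen frame. -/
def frameMap (x y : M) (i : ℤ) : Coord V x i →ₗ[ℝ] (V i).dual.fib y :=
  Fintype.linearCombination ℝ fun a => ((V i).dual.localFrame x).sec a y

variable (V) in
/-- Evaluation of formal polynomials in a chosen frame. -/
def frameEv (x y : M) : M.Fun ⊗[ℝ] GSym (fun i : ℤ => -i) (Coord V x) →ₐ[ℝ] V.SFib y :=
  Algebra.TensorProduct.lift
    ((Algebra.ofId ℝ (V.SFib y)).comp (Mfd.evalAt y))
    (GSym.map (fun i : ℤ => -i) (Q := fun i => (V i).dual.fib y) (frameMap V x y))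
    (fun f _ => Algebra.commutes (f y) _)

theorem frameEv_tmul (x y : M) (f : M.Fun) (s : GSym (fun i : ℤ => -i) (Coord V x)) :
    frameEv V x y (f ⊗ₜ s) = f y •
      GSym.map (fun i : ℤ => -i) (Q := fun i => (V i).dual.fib y) (frameMap V x y) s := by
  refine (Algebra.TensorProduct.lift_tmul _ _ _ f s).trans ?_
  rw [Algebra.smul_def]
  rfl

theorem frameMap_single (x y : M) (i : ℤ) (a : Fin ((V i).dual.localFrame x).n) :
    frameMap V x y i (Pi.single a 1) = ((V i).dual.localFrame x).sec a y := by
  rw [frameMap, Fintype.linearCombination_apply_single, one_smul]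

/-- The images of the elements of a chosen frame. -/
def frameGen (y : N) (i : ℤ) : Coord V (D.base y) i →ₗ[ℝ] B y :=
  Fintype.linearCombination ℝ fun a => D.onSec i (((V i).dual.localFrame (D.base y)).sec a) y

theorem frameGen_apply (y : N) (i : ℤ) (v : Coord V (D.base y) i) :
    D.frameGen y i v =
      D.onSec i (∑ a, v a • ((V i).dual.localFrame (D.base y)).sec a) y := by
  simp [frameGen, Fintype.linearCombination_apply]

/-- The images of polynomials in a chosen frame. -/
def frameLift (y : N) : GSym (fun i : ℤ => -i) (Coord V (D.base y)) →ₐ[ℝ] B y :=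
  GSym.lift _ _ (D.frameGen y) (by
    intro i j a b
    rw [frameGen_apply, frameGen_apply]
    exact congrFun (D.sec_comm i j _ _) y)

/-- The images of formal polynomials in a chosen frame. -/
def frameImg (y : N) :
    M.Fun ⊗[ℝ] GSym (fun i : ℤ => -i) (Coord V (D.base y)) →ₐ[ℝ] B y :=
  Algebra.TensorProduct.lift ((Pi.evalAlgHom ℝ B y).comp D.onFun) (D.frameLift y) (by
    intro f z
    induction z using GSym.induction with
    | algebraMap r =>
      rw [AlgHom.commutes]
      exact Algebra.commute_algebraMap_right _ _
    | gen i a =>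
      rw [frameLift, GSym.lift_gen, frameGen_apply]
      exact congrFun (D.fun_comm f i _) y
    | add a b ha hb =>
      rw [map_add]
      exact ha.add_right hb
    | mul a b ha hb =>
      rw [map_mul]
      exact ha.mul_right hb)

theorem frameImg_tmul (y : N) (f : M.Fun) (s : GSym (fun i : ℤ => -i) (Coord V (D.base y))) :
    D.frameImg y (f ⊗ₜ s) = D.onFun f y * D.frameLift y s :=
  Algebra.TensorProduct.lift_tmul _ _ _ f s

/-- A normal form for formal polynomials: sections are replaced by their expansions in the frame,
with functions as coefficients. The same `t` computes both the germ of `p` and its value in the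
target. -/
theorem exists_frame_eq (y : N) (p : Free V) :
    ∃ t, (∀ᶠ x in 𝓝 (D.base y), ev V p x = frameEv V (D.base y) x t) ∧
      D.img p y = D.frameImg y t := by
  induction p using FreeAlgebra.induction with
  | grade0 r =>
    exact ⟨algebraMap ℝ _ r, Filter.Eventually.of_forall fun x => by
      rw [AlgHom.commutes, AlgHom.commutes]; rfl, by rw [AlgHom.commutes, AlgHom.commutes]; rfl⟩
  | grade1 g =>
    rcases g with f | ⟨i, σ⟩
    · refine ⟨f ⊗ₜ 1, Filter.Eventually.of_forall fun x => ?_, ?_⟩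
      · rw [frameEv_tmul, map_one, ev, FreeAlgebra.lift_ι_apply]
        exact Algebra.algebraMap_eq_smul_one _
      · simp [img, frameImg_tmul]
    · set e := (V i).dual.localFrame (D.base y) with he
      have hσ : ∀ᶠ x in 𝓝 (D.base y), σ x = ∑ a, e.coeff a σ x • e.sec a x :=
        e.eventually_eq.mono fun x h => h σ
      refine ⟨∑ a, e.coeff a σ ⊗ₜ GSym.gen (fun i : ℤ => -i) (Coord V (D.base y)) i
        (Pi.single a 1), hσ.mono fun x hx => ?_, ?_⟩
      · simp only [ev, FreeAlgebra.lift_ι_apply, Sum.elim_inr, GVB.dualSection, map_sum,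
          frameEv_tmul, GSym.map_gen]
        rw [hx, map_sum]
        refine Finset.sum_congr rfl fun a _ => ?_
        rw [map_smul, frameMap_single]
      -- The expansion holds only near the base point; by locality the difference has value zero at
      -- `y`.
      · have h0 : D.onSec i (σ - ∑ a, (V i).dual.smulSec (e.coeff a σ) (e.sec a)) y = 0 := by
          refine D.onSec_local (hσ.mono fun x hx => ?_)
          have h1 : (∑ a, (V i).dual.smulSec (e.coeff a σ) (e.sec a) : (V i).dual.Sec) x =
              ∑ a, (V i).dual.smulSec (e.coeff a σ) (e.sec a) x :=
            map_sum ((V i).dual.evalSec x) _ _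
          rw [ContMDiffSection.coe_sub, Pi.sub_apply, h1, sub_eq_zero]
          exact hx
        rw [map_sub, Pi.sub_apply, sub_eq_zero] at h0
        simp only [img, FreeAlgebra.lift_ι_apply, Sum.elim_inr, h0, map_sum, D.onSec_smul,
          frameImg_tmul, frameLift, GSym.lift_gen, Finset.sum_apply,
          Pi.mul_apply]
        refine Finset.sum_congr rfl fun a _ => ?_
        congr 1
        rw [frameGen_apply, Finset.sum_eq_single a]
        · simp [e]
        · intro b _ hb
          simp [hb]
        · simp
  | mul p q hp hq =>
    obtain ⟨t, h1, h2⟩ := hp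
    obtain ⟨u, h3, h4⟩ := hq
    refine ⟨t * u, ?_, by rw [map_mul, map_mul, ← h2, ← h4]; rfl⟩
    filter_upwards [h1, h3] with x h5 h6
    rw [map_mul, map_mul, ← h5, ← h6]
    rfl
  | add p q hp hq =>
    obtain ⟨t, h1, h2⟩ := hp
    obtain ⟨u, h3, h4⟩ := hq
    refine ⟨t + u, ?_, by rw [map_add, map_add, ← h2, ← h4]; rfl⟩
    filter_upwards [h1, h3] with x h5 h6
    rw [map_add, map_add, ← h5, ← h6]
    rfl

/-- The coordinates of the frame elements are the standard vectors near `x`. The neighbourhood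
depends on `s`: only finitely many degrees occur in it, whereas the frames in all degrees need not
be dual on a common neighbourhood. -/
theorem map_coord_frameMap (x : M) (s : GSym (fun i : ℤ => -i) (Coord V x)) :
    ∀ᶠ y in 𝓝 x, GSym.map (fun i : ℤ => -i) (P := fun i => (V i).dual.fib y)
      (fun i => ((V i).dual.localFrame x).coord y)
      (GSym.map (fun i : ℤ => -i) (Q := fun i => (V i).dual.fib y) (frameMap V x y) s) = s := by
  induction s using GSym.induction with
  | algebraMap r => exact Filter.Eventually.of_forall fun y => by simp only [AlgHom.commutes]
  | gen i v =>
    refine ((V i).dual.localFrame x).dual.mono fun y hy => ?_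
    rw [GSym.map_gen, GSym.map_gen]
    congr 1
    simp only [frameMap, Fintype.linearCombination_apply, map_sum, map_smul, hy]
    exact (pi_eq_sum_univ' v).symm
  | add a b ha hb =>
    filter_upwards [ha, hb] with y h1 h2
    rw [map_add, map_add, h1, h2]
  | mul a b ha hb =>
    filter_upwards [ha, hb] with y h1 h2
    rw [map_mul, map_mul, h1, h2]

/-- A basis of the constant vector space `GSym` turns `t` into finitely many functions. Applying the
frame coordinates to the vanishing germ leaves a linear relation between basis vectors, so each of
these functions vanishes near the base point and has value zero at `y`. -/
theorem frameImg_eq_zero (y : N) (t : M.Fun ⊗[ℝ] GSym (fun i : ℤ => -i) (Coord V (D.base y)))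
    (h : ∀ᶠ x in 𝓝 (D.base y), frameEv V (D.base y) x t = 0) : D.frameImg y t = 0 := by
  classical
  let b := Module.Basis.ofVectorSpace ℝ (GSym (fun i : ℤ => -i) (Coord V (D.base y)))
  let c := TensorProduct.equivFinsuppOfBasisRight (M := M.Fun) b t
  have ht : t = c.sum fun k f => f ⊗ₜ b k := by
    have := TensorProduct.equivFinsuppOfBasisRight_symm_apply (M := M.Fun) b c
    rw [← this]
    exact ((TensorProduct.equivFinsuppOfBasisRight (M := M.Fun) b).symm_apply_apply t).symm
  have hc : ∀ k, D.onFun (c k) y = 0 := by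
    intro k
    refine D.onFun_local ?_
    have hb : ∀ᶠ x in 𝓝 (D.base y), ∀ k ∈ c.support, GSym.map (fun i : ℤ => -i)
        (P := fun i => (V i).dual.fib x) (fun i => ((V i).dual.localFrame (D.base y)).coord x)
        (GSym.map (fun i : ℤ => -i) (Q := fun i => (V i).dual.fib x)
          (frameMap V (D.base y) x) (b k)) = b k :=
      (Filter.eventually_all_finset _).2 fun k _ => map_coord_frameMap (D.base y) (b k)
    filter_upwards [h, hb] with x hx hbx
    rw [ht] at hx
    have h2 := congrArg (GSym.map (fun i : ℤ => -i) (P := fun i => (V i).dual.fib x)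
      (fun i => ((V i).dual.localFrame (D.base y)).coord x)) hx
    rw [Finsupp.sum, map_sum, map_sum, map_zero] at h2
    have h3 : ∑ k ∈ c.support, c k x • b k = 0 := by
      rw [← h2]
      refine Finset.sum_congr rfl fun k hk => ?_
      rw [frameEv_tmul, map_smul, hbx k hk]
    by_cases hk : k ∈ c.support
    · exact linearIndependent_iff'.1 b.linearIndependent c.support (fun k => c k x) h3 k hk
    · rw [Finsupp.notMem_support_iff.1 hk]
      rfl
  rw [ht, Finsupp.sum, map_sum]
  refine Finset.sum_eq_zero fun k _ => ?_
  rw [frameImg_tmul, hc k, zero_mul]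

/-- This is the well-definedness of the extension: relations between germs of sections, not merely
formal ones, are respected by the target. -/
theorem img_eq_zero {p : Free V} {y : N} (h : ∀ᶠ x in 𝓝 (D.base y), ev V p x = 0) :
    D.img p y = 0 := by
  obtain ⟨t, h1, h2⟩ := D.exists_frame_eq y p
  rw [h2]
  refine D.frameImg_eq_zero y t ?_
  filter_upwards [h, h1] with x h3 h4
  rw [← h4, h3]

end frame

theorem exists_local (a : V.Alg) (x : M) : ∃ p, ∀ᶠ z in 𝓝 x, V.toSection a z = ev V p z := by
  obtain ⟨U, hU, b, hb, hab⟩ := V.toSection_isSmooth a x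
  obtain ⟨p, rfl⟩ := exists_ev_eq hb
  exact ⟨p, Filter.mem_of_superset hU hab⟩

/-- The extension of given values on generators, as a function. -/
def ext (a : V.Alg) (y : N) : B y := D.img (exists_local a (D.base y)).choose y

theorem ext_eq {a : V.Alg} {y : N} {p : Free V}
    (h : ∀ᶠ x in 𝓝 (D.base y), V.toSection a x = ev V p x) : D.ext a y = D.img p y := by
  rw [← sub_eq_zero, ext, ← Pi.sub_apply, ← map_sub]
  refine D.img_eq_zero ?_
  filter_upwards [h, (exists_local a (D.base y)).choose_spec] with x h1 h2
  rw [map_sub, Pi.sub_apply, ← h1, ← h2, sub_self]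

/-- The algebra morphism with given values on generators. -/
def hom : V.Alg →ₐ[ℝ] ∀ y, B y :=
  AlgHom.ofLinearMap
    { toFun := D.ext
      map_add' := fun a b => funext fun y => by
        obtain ⟨p, hp⟩ := exists_local a (D.base y)
        obtain ⟨q, hq⟩ := exists_local b (D.base y)
        rw [Pi.add_apply, D.ext_eq hp, D.ext_eq hq, ← Pi.add_apply, ← map_add]
        refine D.ext_eq ?_
        filter_upwards [hp, hq] with x h1 h2
        rw [map_add, map_add, Pi.add_apply, h1, h2, Pi.add_apply]
      map_smul' := fun r a => funext fun y => by
        obtain ⟨p, hp⟩ := exists_local a (D.base y)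
        rw [Pi.smul_apply, D.ext_eq hp, ← Pi.smul_apply, RingHom.id_apply, ← map_smul]
        refine D.ext_eq ?_
        filter_upwards [hp] with x h1
        rw [map_smul, map_smul, Pi.smul_apply, h1, Pi.smul_apply] }
    (funext fun y => by
      refine (D.ext_eq (p := 1) (Filter.Eventually.of_forall fun x => ?_)).trans ?_
      · rw [map_one, map_one]
      · rw [map_one])
    (fun a b => funext fun y => by
      obtain ⟨p, hp⟩ := exists_local a (D.base y)
      obtain ⟨q, hq⟩ := exists_local b (D.base y)
      change D.ext (a * b) y = D.ext a y * D.ext b y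
      rw [D.ext_eq hp, D.ext_eq hq, ← Pi.mul_apply, ← map_mul]
      refine D.ext_eq ?_
      filter_upwards [hp, hq] with x h1 h2
      rw [map_mul, map_mul, Pi.mul_apply, h1, h2, Pi.mul_apply])

theorem hom_eq {a : V.Alg} {y : N} {p : Free V}
    (h : ∀ᶠ x in 𝓝 (D.base y), V.toSection a x = ev V p x) : D.hom a y = D.img p y :=
  D.ext_eq h

theorem hom_ofFun (f : M.Fun) : D.hom (V.ofFun f) = D.onFun f := by
  funext y
  rw [D.hom_eq (p := FreeAlgebra.ι ℝ (Sum.inl f)) (Filter.Eventually.of_forall fun x => by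
    simp [ev, GVB.funSection])]
  simp [img]

theorem hom_ofSec (i : ℤ) (σ : (V i).dual.Sec) : D.hom (V.ofSec i σ) = D.onSec i σ := by
  funext y
  rw [D.hom_eq (p := FreeAlgebra.ι ℝ (Sum.inr ⟨i, σ⟩)) (Filter.Eventually.of_forall fun x => by
    simp [ev, GVB.dualSection])]
  simp [img]

/-- Locally, the values of the extension lie in any subalgebra containing the values on
generators. -/
theorem hom_local (S : Subalgebra ℝ (∀ y, B y)) (h1 : ∀ f, D.onFun f ∈ S)
    (h2 : ∀ i σ, D.onSec i σ ∈ S) (a : V.Alg) (y₀ : N) :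
    ∃ b ∈ S, ∀ᶠ y in 𝓝 y₀, D.hom a y = b y := by
  obtain ⟨p, hp⟩ := exists_local a (D.base y₀)
  refine ⟨D.img p, ?_, ?_⟩
  · have h : Algebra.adjoin ℝ (Set.range (FreeAlgebra.ι ℝ)) ≤ S.comap D.img := by
      refine Algebra.adjoin_le ?_
      rintro _ ⟨f | ⟨i, σ⟩, rfl⟩
      · simpa [img] using h1 f
      · simpa [img] using h2 i σ
    rw [FreeAlgebra.adjoin_range_ι] at h
    exact h Algebra.mem_top
  -- The polynomial chosen at `y₀` must represent `a` in a neighbourhood of `D.base y` for every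
  -- nearby `y`; continuity of the base map provides this.
  · filter_upwards [D.cont.continuousAt.eventually hp.eventually_nhds] with y hy
    exact D.hom_eq hy

/-! ### Degrees of the extension -/

section degree

variable (G : ∀ y, ℤ → Submodule ℝ (B y)) [∀ y, SetLike.GradedMonoid (G y)]

/-- The formal polynomials which are homogeneous of degree `k` in both senses. -/
def freeDeg (k : ℤ) : Submodule ℝ (Free V) where
  carrier := {p | (∀ x, ev V p x ∈ V.SFibDeg x k) ∧ ∀ y, D.img p y ∈ G y k}
  zero_mem' := ⟨fun x => by simp, fun y => by simp⟩
  add_mem' ha hb := ⟨fun x => by rw [map_add]; exact add_mem (ha.1 x) (hb.1 x),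
    fun y => by rw [map_add]; exact add_mem (ha.2 y) (hb.2 y)⟩
  smul_mem' r a ha := ⟨fun x => by rw [map_smul]; exact Submodule.smul_mem _ r (ha.1 x),
    fun y => by rw [map_smul]; exact Submodule.smul_mem _ r (ha.2 y)⟩

instance : SetLike.GradedMonoid (D.freeDeg G) where
  one_mem := ⟨fun x => by rw [map_one]; exact GSym.one_mem_homog _ _,
    fun y => by rw [map_one]; exact SetLike.GradedOne.one_mem⟩
  mul_mem _ _ _ _ ha hb := ⟨fun x => by rw [map_mul]; exact GSym.mul_mem_homog _ _ (ha.1 x) (hb.1 x),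
    fun y => by rw [map_mul]; exact SetLike.GradedMul.mul_mem (ha.2 y) (hb.2 y)⟩

/-- A polynomial representing a homogeneous section need not be homogeneous. Its part of degree `k`
represents the section too, because projecting to degree `k` in the fibres does not change the
section. -/
theorem hom_mem (h1 : ∀ f y, D.onFun f y ∈ G y 0) (h2 : ∀ i σ y, D.onSec i σ y ∈ G y (-i))
    {k : ℤ} {a : V.Alg} (ha : a ∈ sumGrading V.SSec k) (y : N) : D.hom a y ∈ G y k := by
  obtain ⟨a, rfl⟩ := ha
  obtain ⟨p, hp⟩ := exists_local (DirectSum.lof ℝ ℤ (fun k => V.SSec k) k a) (D.base y)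
  -- The generators of the free algebra are homogeneous on both sides at once, so every formal
  -- polynomial is a sum of bihomogeneous parts of equal degrees.
  obtain ⟨d, rfl⟩ : ∃ d, DirectSum.coeAlgHom (D.freeDeg G) d = p := by
    have h : Algebra.adjoin ℝ (Set.range (FreeAlgebra.ι ℝ)) ≤
        (DirectSum.coeAlgHom (D.freeDeg G)).range := by
      refine Algebra.adjoin_le ?_
      rintro _ ⟨f | ⟨i, σ⟩, rfl⟩
      · refine ⟨DirectSum.of (fun k => D.freeDeg G k) 0 ⟨FreeAlgebra.ι ℝ (Sum.inl f), ?_, ?_⟩,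
          DirectSum.coeAlgHom_of _ _ _⟩
        · intro x
          simpa [ev] using (V.funSection_mem f).2 x
        · intro y
          simpa [img] using h1 f y
      · refine ⟨DirectSum.of (fun k => D.freeDeg G k) (-i)
          ⟨FreeAlgebra.ι ℝ (Sum.inr ⟨i, σ⟩), ?_, ?_⟩, DirectSum.coeAlgHom_of _ _ _⟩
        · intro x
          simpa [ev] using (V.dualSection_mem i σ).2 x
        · intro y
          simpa [img] using h2 i σ y
    rw [FreeAlgebra.adjoin_range_ι] at h
    exact h Algebra.mem_top
  have key : ∀ x, GSym.proj (fun i : ℤ => -i) (fun i => (V i).dual.fib x) k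
      (ev V (DirectSum.coeAlgHom (D.freeDeg G) d) x) = ev V (d k) x := by
    intro x
    clear hp
    induction d using DirectSum.induction_on with
    | zero => simp
    | add a b ha hb =>
      rw [map_add, map_add, Pi.add_apply, map_add, ha, hb]
      simp
    | of j b =>
      rw [DirectSum.coeAlgHom_of]
      by_cases h : j = k
      · subst h
        rw [GSym.proj_of_mem _ _ (b.2.1 x), DirectSum.of_eq_same]
      · rw [GSym.proj_of_mem_ne _ _ (b.2.1 x) h, DirectSum.of_eq_of_ne _ _ _ (Ne.symm h)]
        simp
  rw [D.hom_eq (p := d k)]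
  · exact (d k).2.2 y
  · filter_upwards [hp] with x hx
    rw [← key, ← hx, GVB.toSection_lof, GSym.proj_of_mem _ _ (a.2.2 x)]

end degree

end GenData


/-! ### Morphisms between the algebras `Γ(S V*)` -/

namespace GVB

variable {M N : Mfd} {V : GVB M} {W : GVB N}

theorem continuous_aug {a : ∀ y, W.SFib y} (ha : W.IsSmooth a) :
    Continuous fun y => GSym.aug (fun i : ℤ => -i) (fun i => (W i).dual.fib y) (a y) := by
  have hp : ∀ b ∈ W.polySections,
      Continuous fun y => GSym.aug (fun i : ℤ => -i) (fun i => (W i).dual.fib y) (b y) := by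
    intro b hb
    induction hb using Algebra.adjoin_induction with
    | mem b hb =>
      rcases hb with ⟨f, rfl⟩ | hb
      · simpa [funSection] using f.contMDiff.continuous
      · obtain ⟨i, σ, rfl⟩ := Set.mem_iUnion.1 hb
        simpa [dualSection] using continuous_const
    | algebraMap r => simpa using continuous_const
    | add b c _ _ hb hc =>
      simp only [Pi.add_apply, map_add]
      exact hb.add hc
    | mul b c _ _ hb hc =>
      simp only [Pi.mul_apply, map_mul]
      exact hb.mul hc
  refine continuous_iff_continuousAt.2 fun y => ?_
  obtain ⟨U, hU, b, hb, hab⟩ := ha y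
  refine (hp b hb).continuousAt.congr ?_
  filter_upwards [hU] with z hz
  rw [hab z hz]

/-- The augmentation of an element of `Γ(S W*)` at a point. -/
def augAt (W : GVB N) (y : N) : W.Alg →ₐ[ℝ] ℝ :=
  (GSym.aug (fun i : ℤ => -i) (fun i => (W i).dual.fib y)).comp
    ((Pi.evalAlgHom ℝ W.SFib y).comp W.toSection)

/-- The map of base manifolds underlying an algebra morphism. -/
def basePoint (u : M.Fun →ₐ[ℝ] W.Alg) (y : N) : M :=
  (Mfd.exists_eq_eval ((W.augAt y).comp u)).choose

theorem aug_eq_basePoint (u : M.Fun →ₐ[ℝ] W.Alg) (y : N) (f : M.Fun) :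
    GSym.aug _ _ (W.toSection (u f) y) = f (basePoint u y) :=
  (Mfd.exists_eq_eval ((W.augAt y).comp u)).choose_spec f

/-- For a bump function `h` supported in `U`, the composite with the base map is the augmentation of
`u h`, hence continuous; where it is nonzero the base point lies in `U`. -/
theorem continuous_basePoint (u : M.Fun →ₐ[ℝ] W.Alg) : Continuous (basePoint u) := by
  refine continuous_iff_continuousAt.2 fun y U hU => ?_
  obtain ⟨h, h1, h2⟩ := Mfd.exists_bump hU
  have hc : Continuous fun y => h (basePoint u y) := by
    simp only [← aug_eq_basePoint]
    exact continuous_aug (W.toSection_isSmooth _)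
  have hy : h (basePoint u y) ≠ 0 := by
    rw [h1.self_of_nhds]
    exact one_ne_zero
  exact Filter.mem_of_superset (hc.continuousAt.eventually_ne hy)
    fun z hz => h2 (subset_tsupport _ hz)

/-- The constant term of `u h` at `y` is the value of `h` at the base point, here 1. This provides
the field `reg` of `GenData`. -/
theorem toSection_regular (u : M.Fun →ₐ[ℝ] W.Alg) {y : N} {h : M.Fun} (hh : h (basePoint u y) = 1)
    {z : W.SFib y} (hz : W.toSection (u h) y * z = 0) : z = 0 := by
  refine GSym.eq_zero_of_mul_eq_zero _ _ ?_ hz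
  rw [aug_eq_basePoint, hh]
  exact one_ne_zero

theorem eqOn_polys {B : Type} [Semiring B] [Algebra ℝ B] {χ χ' : V.Alg →ₐ[ℝ] B}
    (hf : ∀ f, χ (V.ofFun f) = χ' (V.ofFun f)) (hs : ∀ i σ, χ (V.ofSec i σ) = χ' (V.ofSec i σ))
    {q : V.Alg} (hq : q ∈ V.polys) : χ q = χ' q := by
  have h : V.polys ≤ AlgHom.equalizer χ χ' := by
    refine Algebra.adjoin_le ?_
    rintro _ (⟨f, rfl⟩ | h)
    · exact hf f
    · obtain ⟨i, σ, rfl⟩ := Set.mem_iUnion.1 h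
      exact hs i σ
  exact h hq

/-- An algebra morphism between the algebras of graded manifolds is determined by its values on
functions and sections. -/
theorem algHom_ext {χ χ' : V.Alg →ₐ[ℝ] W.Alg} (hf : ∀ f, χ (V.ofFun f) = χ' (V.ofFun f))
    (hs : ∀ i σ, χ (V.ofSec i σ) = χ' (V.ofSec i σ)) : χ = χ' := by
  refine AlgHom.ext fun a => toSection_injective fun y => ?_
  obtain ⟨h, q, h1, hq, e⟩ := V.exists_bump_mul_eq a (basePoint (χ.comp V.funHom) y)
  rw [← sub_eq_zero]
  refine toSection_regular (χ.comp V.funHom) h1 ?_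
  have e1 : χ (V.ofFun h) * χ a = χ (V.ofFun h) * χ' a := by
    rw [← map_mul, hf, ← map_mul, e, map_mul, map_mul, hf]
    exact congrArg _ (eqOn_polys hf hs hq)
  have e2 := congrFun (congrArg W.toSection e1) y
  rw [map_mul, map_mul, ← sub_eq_zero] at e2
  exact (mul_sub _ _ _).trans e2

/-- A linear map to sections which shifts degrees by `d`, as a map to the algebra. -/
def linLift (d : ℤ) (Φ : V.Alg →ₗ[ℝ] ∀ y, W.SFib y)
    (h : ∀ k, ∀ a ∈ sumGrading V.SSec k, Φ a ∈ W.SSec (k + d)) : V.Alg →ₗ[ℝ] W.Alg :=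
  DirectSum.toModule ℝ ℤ _ fun k => W.ofSection (k + d) ∘ₗ
    (Φ ∘ₗ V.ofSection k).codRestrict (W.SSec (k + d)) fun a => h k _ ⟨a, rfl⟩

theorem linLift_lof (d : ℤ) (Φ : V.Alg →ₗ[ℝ] ∀ y, W.SFib y)
    (h : ∀ k, ∀ a ∈ sumGrading V.SSec k, Φ a ∈ W.SSec (k + d)) (k : ℤ) (a : V.SSec k) :
    linLift d Φ h (V.ofSection k a) = W.ofSection (k + d) ⟨Φ (V.ofSection k a), h k _ ⟨a, rfl⟩⟩ :=
  DirectSum.toModule_lof ℝ (φ := fun k => W.ofSection (k + d) ∘ₗ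
    (Φ ∘ₗ V.ofSection k).codRestrict (W.SSec (k + d)) fun a => h k _ ⟨a, rfl⟩) k a

theorem toSection_linLift (d : ℤ) (Φ : V.Alg →ₗ[ℝ] ∀ y, W.SFib y)
    (h : ∀ k, ∀ a ∈ sumGrading V.SSec k, Φ a ∈ W.SSec (k + d)) (a : V.Alg) :
    W.toSection (linLift d Φ h a) = Φ a := by
  induction a using DirectSum.induction_on with
  | zero => simp
  | add a b ha hb => rw [map_add, map_add, map_add, ha, hb]
  | of k a =>
    refine (congrArg W.toSection (linLift_lof d Φ h k a)).trans ?_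
    exact W.toSection_lof _ _

theorem linLift_mem (d : ℤ) (Φ : V.Alg →ₗ[ℝ] ∀ y, W.SFib y)
    (h : ∀ k, ∀ a ∈ sumGrading V.SSec k, Φ a ∈ W.SSec (k + d)) {k : ℤ} {a : V.Alg}
    (ha : a ∈ sumGrading V.SSec k) : linLift d Φ h a ∈ sumGrading W.SSec (k + d) := by
  obtain ⟨a, rfl⟩ := ha
  exact ⟨_, (linLift_lof d Φ h k a).symm⟩

theorem mem_SSec_add_zero {Φ : V.Alg →ₐ[ℝ] ∀ y, W.SFib y}
    (h : ∀ k, ∀ a ∈ sumGrading V.SSec k, Φ a ∈ W.SSec k) (k : ℤ) (a : V.Alg)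
    (ha : a ∈ sumGrading V.SSec k) : Φ.toLinearMap a ∈ W.SSec (k + 0) := by
  rw [add_zero]
  exact h k a ha

/-- An algebra morphism to sections which preserves degrees, as a morphism of graded algebras. -/
def algLift (Φ : V.Alg →ₐ[ℝ] ∀ y, W.SFib y)
    (h : ∀ k, ∀ a ∈ sumGrading V.SSec k, Φ a ∈ W.SSec k) :
    sumGrading V.SSec →ₐᵍ[ℝ] sumGrading W.SSec where
  toAlgHom := AlgHom.ofLinearMap (linLift 0 Φ.toLinearMap (mem_SSec_add_zero h))
    (toSection_injective fun y => by
      rw [toSection_linLift, AlgHom.toLinearMap_apply, map_one, map_one])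
    (fun a b => toSection_injective fun y => by
      rw [map_mul W.toSection]
      simp only [toSection_linLift, AlgHom.toLinearMap_apply]
      rw [map_mul])
  map_mem {k a} ha := by
    have := linLift_mem 0 Φ.toLinearMap (mem_SSec_add_zero h) ha
    rw [add_zero] at this
    exact this

theorem toSection_algLift (Φ : V.Alg →ₐ[ℝ] ∀ y, W.SFib y)
    (h : ∀ k, ∀ a ∈ sumGrading V.SSec k, Φ a ∈ W.SSec k) (a : V.Alg) :
    W.toSection (algLift Φ h a) = Φ a :=
  toSection_linLift 0 Φ.toLinearMap (mem_SSec_add_zero h) a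

/-- The smooth sections, as a subalgebra. -/
def smoothSections (W : GVB N) : Subalgebra ℝ (∀ y, W.SFib y) where
  carrier := {a | W.IsSmooth a}
  add_mem' ha hb := ha.add W hb
  mul_mem' ha hb := ha.mul W hb
  algebraMap_mem' r := W.isSmooth_of_mem (algebraMap_mem _ r)

theorem isSmooth_of_local {a : ∀ y, W.SFib y}
    (h : ∀ y₀, ∃ b, W.IsSmooth b ∧ ∀ᶠ y in 𝓝 y₀, a y = b y) : W.IsSmooth a := by
  intro y₀
  obtain ⟨b, hb, hab⟩ := h y₀
  obtain ⟨U, hU, c, hc, hbc⟩ := hb y₀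
  exact ⟨_, Filter.inter_mem hU hab, c, hc, fun y hy => hy.2.trans (hbc y hy.1)⟩

theorem mem_SSec_of_mem_sumGrading {k : ℤ} {a : W.Alg} (ha : a ∈ sumGrading W.SSec k) :
    W.toSection a ∈ W.SSec k := by
  obtain ⟨a, rfl⟩ := ha
  rw [toSection_lof]
  exact a.2

instance (y : N) : SetLike.GradedMonoid (W.SFibDeg y) where
  one_mem := GSym.one_mem_homog _ _
  mul_mem _ _ _ _ ha hb := GSym.mul_mem_homog _ _ ha hb

/-- The universal property of `Γ(S V*)`. -/
theorem exists_algHom (u : M.Fun →ₐ[ℝ] W.Alg) (hu : ∀ f, u f ∈ sumGrading W.SSec 0)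
    (g : ∀ i, (V i).dual.Sec →ₗ[ℝ] W.Alg) (hg : ∀ i σ, g i σ ∈ sumGrading W.SSec (-i))
    (hgu : ∀ i f σ, g i ((V i).dual.smulSec f σ) = u f * g i σ) :
    ∃ χ : sumGrading V.SSec →ₐᵍ[ℝ] sumGrading W.SSec,
      (∀ f, χ (V.ofFun f) = u f) ∧ ∀ i σ, χ (V.ofSec i σ) = g i σ := by
  let D : GenData V N W.SFib :=
    { base := basePoint u
      cont := continuous_basePoint u
      onFun := W.toSection.comp u
      onSec := fun i => W.toSection.toLinearMap ∘ₗ g i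
      onSec_smul := fun i f σ => by simp [hgu]
      fun_comm := fun f i σ => by
        have := W.alg_comm (hu f) (hg i σ)
        rw [zero_mul, zpow_zero, one_smul] at this
        simp only [AlgHom.comp_apply, LinearMap.comp_apply, AlgHom.toLinearMap_apply, ← map_mul, this]
      sec_comm := fun i j σ τ => by
        have := W.alg_comm (hg i σ) (hg j τ)
        simp only [LinearMap.comp_apply, AlgHom.toLinearMap_apply, ← map_mul, this]
        rw [Units.smul_def, Units.smul_def, map_zsmul]
      reg := fun y h z hh hz => toSection_regular u hh hz }
  have hD : ∀ k, ∀ a ∈ sumGrading V.SSec k, D.hom a ∈ W.SSec k := fun k a ha =>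
    ⟨isSmooth_of_local fun y₀ => D.hom_local W.smoothSections (fun f => W.toSection_isSmooth _)
      (fun i σ => W.toSection_isSmooth _) a y₀,
      D.hom_mem (fun y => W.SFibDeg y) (fun f y => (mem_SSec_of_mem_sumGrading (hu f)).2 y)
        (fun i σ y => (mem_SSec_of_mem_sumGrading (hg i σ)).2 y) ha⟩
  refine ⟨algLift D.hom hD, fun f => toSection_injective fun y => ?_,
    fun i σ => toSection_injective fun y => ?_⟩
  · rw [toSection_algLift, D.hom_ofFun]
    rfl
  · rw [toSection_algLift, D.hom_ofSec]
    rfl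

end GVB

/-! ### The algebra `C(D) ⊗ C(T)` -/

namespace GrMfd

variable (T : GrMfd)

instance : SMulCommClass ℝ T.FatAlg T.FatAlg :=
  ⟨fun r x y => (Algebra.mul_smul_comm r x y).symm⟩

instance : SMulCommClass ℤ T.FatAlg T.FatAlg :=
  ⟨fun r x y => ((AddMonoidHom.mulLeft x).map_zsmul r y).symm⟩

instance : IsScalarTower ℤ T.FatAlg T.FatAlg :=
  ⟨fun r x y => (AddMonoidHom.mulRight y).map_zsmul r x⟩

/-- The inclusion of `C(T)`. -/
abbrev fatIncl : T.alg →ₐ[ℝ] T.FatAlg := GradedTensorProduct.includeRight fatGrading T.gr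

/-- The element `ε`. -/
def fatEps : T.FatAlg := GradedTensorProduct.includeLeft fatGrading T.gr DualNumber.eps

/-- The element `a + ε b`. -/
def fatMk (a b : T.alg) : T.FatAlg := T.fatIncl a + T.fatEps * T.fatIncl b

theorem fatEps_mul_incl (b : T.alg) :
    T.fatEps * T.fatIncl b = (DualNumber.eps ᵍ⊗ₜ[ℝ] b : T.FatAlg) :=
  GradedTensorProduct.tmul_one_mul_one_tmul fatGrading T.gr (R := ℝ) DualNumber.eps b

@[simp] theorem comp₀_tmul (c : DualNumber ℝ) (a : T.alg) :
    T.comp₀ (c ᵍ⊗ₜ[ℝ] a) = c.fst • a := rfl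

@[simp] theorem comp₁_tmul (c : DualNumber ℝ) (a : T.alg) :
    T.comp₁ (c ᵍ⊗ₜ[ℝ] a) = c.snd • a := rfl

theorem comp₀_incl (a : T.alg) : T.comp₀ (T.fatIncl a) = a :=
  (T.comp₀_tmul 1 a).trans (by simp)

theorem comp₁_incl (a : T.alg) : T.comp₁ (T.fatIncl a) = 0 :=
  (T.comp₁_tmul 1 a).trans (by simp)

@[simp] theorem comp₀_fatMk (a b : T.alg) : T.comp₀ (T.fatMk a b) = a := by
  rw [fatMk, fatEps_mul_incl, map_add, comp₀_incl, comp₀_tmul]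
  simp

@[simp] theorem comp₁_fatMk (a b : T.alg) : T.comp₁ (T.fatMk a b) = b := by
  rw [fatMk, fatEps_mul_incl, map_add, comp₁_incl, comp₁_tmul]
  simp

/-- The element `a + ε b`, linearly in `(a, b)`. -/
def fatMkₗ : T.alg × T.alg →ₗ[ℝ] T.FatAlg :=
  LinearMap.coprod T.fatIncl.toLinearMap (LinearMap.mulLeft ℝ T.fatEps ∘ₗ T.fatIncl.toLinearMap)

theorem fatMk_comp (x : T.FatAlg) : T.fatMk (T.comp₀ x) (T.comp₁ x) = x := by
  have h : T.fatMkₗ ∘ₗ (T.comp₀.prod T.comp₁) = LinearMap.id := by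
    refine GradedTensorProduct.hom_ext _ _ (TensorProduct.ext' fun c a => ?_)
    change T.fatMk (c.fst • a) (c.snd • a) = (c ᵍ⊗ₜ[ℝ] a : T.FatAlg)
    have h1 : (c ᵍ⊗ₜ[ℝ] a : T.FatAlg) =
        GradedTensorProduct.includeLeft fatGrading T.gr c * T.fatIncl a :=
      (GradedTensorProduct.tmul_one_mul_one_tmul fatGrading T.gr (R := ℝ) c a).symm
    have h2 : c = algebraMap ℝ _ c.fst + c.snd • DualNumber.eps := by
      ext <;> simp [TrivSqZeroExt.algebraMap_eq_inl]
    rw [h1, fatMk]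
    conv_rhs => rw [h2]
    rw [map_add, AlgHom.commutes, map_smul, map_smul, map_smul, add_mul, ← Algebra.smul_def,
      mul_smul_comm, smul_mul_assoc]
    rfl
  exact LinearMap.congr_fun h x

variable {T} in
theorem fat_ext {x y : T.FatAlg} (h₀ : T.comp₀ x = T.comp₀ y) (h₁ : T.comp₁ x = T.comp₁ y) :
    x = y := by
  rw [← T.fatMk_comp x, h₀, h₁, T.fatMk_comp]

theorem eps_mem : (DualNumber.eps : DualNumber ℝ) ∈ fatGrading (-1) :=
  ⟨fun _ => by simp, fun h => (h rfl).elim⟩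

theorem incl_mul_eps {k : ℤ} {a : T.alg} (ha : a ∈ T.gr k) :
    T.fatIncl a * T.fatEps = (-1 : ℤˣ) ^ k • (T.fatEps * T.fatIncl a) := by
  have h := GradedTensorProduct.tmul_coe_mul_coe_tmul (R := ℝ) fatGrading T.gr 1 ⟨a, ha⟩
    ⟨DualNumber.eps, eps_mem⟩ 1
  rw [one_mul, mul_one] at h
  rw [fatEps_mul_incl]
  refine h.trans ?_
  -- Moving ε, of degree −1, past `a` gives the sign (−1)^(−k), which equals (−1)^k.
  rw [mul_neg_one, zpow_neg, ← inv_zpow]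
  rfl

theorem eps_mul_incl_mul_eps (a : T.alg) : T.fatEps * T.fatIncl a * T.fatEps = 0 := by
  have he : T.fatEps * T.fatEps = 0 := by
    rw [fatEps, ← map_mul, DualNumber.eps_mul_eps, map_zero]
  induction a using DirectSum.Decomposition.inductionOn T.gr with
  | zero => rw [map_zero, mul_zero, zero_mul]
  | homogeneous a =>
    rw [mul_assoc, incl_mul_eps T a.2, Units.smul_def, mul_smul_comm, ← mul_assoc, he, zero_mul,
      smul_zero]
  | add a b ha hb => rw [map_add, mul_add, add_mul, ha, hb, add_zero]

/-- The only sign comes from moving ε to the left past `a`, so only `a` has to be homogeneous; the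
ε² term vanishes. -/
theorem fatMk_mul {k : ℤ} {a : T.alg} (ha : a ∈ T.gr k) (b c d : T.alg) :
    T.fatMk a b * T.fatMk c d = T.fatMk (a * c) (b * c + (-1 : ℤˣ) ^ k • (a * d)) := by
  have h1 : T.fatIncl a * (T.fatEps * T.fatIncl d) =
      (-1 : ℤˣ) ^ k • (T.fatEps * T.fatIncl (a * d)) := by
    rw [← mul_assoc, incl_mul_eps T ha, Units.smul_def, smul_mul_assoc, mul_assoc, ← map_mul, Units.smul_def]
  have h2 : T.fatEps * T.fatIncl b * (T.fatEps * T.fatIncl d) = 0 := by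
    rw [← mul_assoc, eps_mul_incl_mul_eps, zero_mul]
  simp only [fatMk]
  rw [add_mul, mul_add, mul_add, h1, h2, add_zero, map_add, mul_add, Units.smul_def,
    Units.smul_def, map_zsmul, mul_smul_comm, map_mul, map_mul, map_mul, mul_assoc]
  abel

theorem comp₀_mem {k : ℤ} {x : T.FatAlg} (hx : x ∈ T.fatDeg k) : T.comp₀ x ∈ T.gr k := by
  have h : T.fatDeg k ≤ (T.gr k).comap T.comp₀ := by
    refine Submodule.span_le.2 ?_
    rintro _ ⟨i, j, rfl, c, hc, b, hb, rfl⟩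
    change T.comp₀ (c ᵍ⊗ₜ[ℝ] b) ∈ T.gr (i + j)
    rw [comp₀_tmul]
    by_cases hi : i = 0
    · subst hi
      rw [zero_add]
      exact Submodule.smul_mem _ _ hb
    · rw [hc.1 hi, zero_smul]
      exact zero_mem _
  exact h hx

theorem comp₁_mem {k : ℤ} {x : T.FatAlg} (hx : x ∈ T.fatDeg k) : T.comp₁ x ∈ T.gr (k + 1) := by
  have h : T.fatDeg k ≤ (T.gr (k + 1)).comap T.comp₁ := by
    refine Submodule.span_le.2 ?_
    rintro _ ⟨i, j, rfl, c, hc, b, hb, rfl⟩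
    change T.comp₁ (c ᵍ⊗ₜ[ℝ] b) ∈ T.gr (i + j + 1)
    rw [comp₁_tmul]
    by_cases hi : i = -1
    · subst hi
      rw [show -1 + j + 1 = j by ring]
      exact Submodule.smul_mem _ _ hb
    · rw [hc.2 hi, zero_smul]
      exact zero_mem _
  exact h hx

theorem fatMk_mem {k : ℤ} {a b : T.alg} (ha : a ∈ T.gr k) (hb : b ∈ T.gr (k + 1)) :
    T.fatMk a b ∈ T.fatDeg k := by
  rw [fatMk, fatEps_mul_incl]
  refine add_mem (Submodule.subset_span ⟨0, k, zero_add k, 1, ?_, a, ha, rfl⟩)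
    (Submodule.subset_span ⟨-1, k + 1, by ring, DualNumber.eps, eps_mem, b, hb, rfl⟩)
  exact SetLike.GradedOne.one_mem

theorem comp₀_mul (x y : T.FatAlg) : T.comp₀ (x * y) = T.comp₀ x * T.comp₀ y := by
  rw [← T.fatMk_comp x, ← T.fatMk_comp y]
  generalize T.comp₀ x = a
  induction a using DirectSum.Decomposition.inductionOn T.gr with
  | zero =>
    have := T.fatMk_mul (zero_mem (T.gr 0)) (T.comp₁ x) (T.comp₀ y) (T.comp₁ y)
    rw [this]
    simp only [comp₀_fatMk]
  | homogeneous a =>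
    rw [T.fatMk_mul a.2]
    simp only [comp₀_fatMk]
  | add a b ha hb =>
    -- The induction splits only the first entry, so the fixed ε-part is counted twice and has to be
    -- subtracted once.
    have h1 : T.fatMk (a + b) (T.comp₁ x) = T.fatMk a (T.comp₁ x) + T.fatMk b (T.comp₁ x) -
        T.fatMk 0 (T.comp₁ x) := by
      simp only [fatMk, map_add, map_zero]
      abel
    have h0 : T.comp₀ (T.fatMk 0 (T.comp₁ x) * T.fatMk (T.comp₀ y) (T.comp₁ y)) = 0 := by
      rw [T.fatMk_mul (zero_mem (T.gr 0)), comp₀_fatMk, zero_mul]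
    rw [h1, sub_mul, add_mul, map_sub, map_add, ha, hb, h0]
    simp only [comp₀_fatMk, map_sub, map_add, sub_zero, add_mul]

theorem comp₁_mul {k : ℤ} {x : T.FatAlg} (hx : T.comp₀ x ∈ T.gr k) (y : T.FatAlg) :
    T.comp₁ (x * y) = T.comp₁ x * T.comp₀ y + (-1 : ℤˣ) ^ k • (T.comp₀ x * T.comp₁ y) := by
  conv_lhs => rw [← T.fatMk_comp x, ← T.fatMk_comp y, T.fatMk_mul hx, comp₁_fatMk]

variable {T} {T' : GrMfd} (g : T' ⟶ T)

theorem comp₀_fatMap (x : T.FatAlg) : T'.comp₀ (fatMap g x) = pull g (T.comp₀ x) := by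
  have h : T'.comp₀ ∘ₗ (fatMap g).toLinearMap = (pull g).toAlgHom.toLinearMap ∘ₗ T.comp₀ := by
    refine GradedTensorProduct.hom_ext _ _ (TensorProduct.ext' fun c a => ?_)
    change T'.comp₀ (fatMap g (c ᵍ⊗ₜ[ℝ] a)) = (pull g).toAlgHom (c.fst • a)
    rw [fatMap_tmul, comp₀_tmul, map_smul]
    rfl
  exact LinearMap.congr_fun h x

theorem comp₁_fatMap (x : T.FatAlg) : T'.comp₁ (fatMap g x) = pull g (T.comp₁ x) := by
  have h : T'.comp₁ ∘ₗ (fatMap g).toLinearMap = (pull g).toAlgHom.toLinearMap ∘ₗ T.comp₁ := by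
    refine GradedTensorProduct.hom_ext _ _ (TensorProduct.ext' fun c a => ?_)
    change T'.comp₁ (fatMap g (c ᵍ⊗ₜ[ℝ] a)) = (pull g).toAlgHom (c.snd • a)
    rw [fatMap_tmul, comp₁_tmul, map_smul]
    rfl
  exact LinearMap.congr_fun h x

end GrMfd

namespace FatPoint

variable {X Y T T' : GrMfd} (Ψ : FatPoint X T)

theorem part₀_one : Ψ.part₀ 1 = 1 := by
  change T.comp₀ (Ψ.hom 1) = 1
  rw [map_one, ← map_one T.fatIncl, T.comp₀_incl]

/-- The part `Ψ₀`, as an algebra morphism. -/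
def part₀Hom : X.alg →ₐ[ℝ] T.alg :=
  AlgHom.ofLinearMap Ψ.part₀ Ψ.part₀_one fun a b =>
    (congrArg T.comp₀ (map_mul Ψ.hom a b)).trans (T.comp₀_mul _ _)

theorem part₀_mem {k : ℤ} {a : X.alg} (ha : a ∈ X.gr k) : Ψ.part₀ a ∈ T.gr k :=
  T.comp₀_mem (Ψ.map_mem k a ha)

theorem part₁_mem {k : ℤ} {a : X.alg} (ha : a ∈ X.gr k) : Ψ.part₁ a ∈ T.gr (k + 1) :=
  T.comp₁_mem (Ψ.map_mem k a ha)

theorem part₁_mul {k : ℤ} {a : X.alg} (ha : a ∈ X.gr k) (b : X.alg) :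
    Ψ.part₁ (a * b) = Ψ.part₁ a * Ψ.part₀ b + (-1 : ℤˣ) ^ k • (Ψ.part₀ a * Ψ.part₁ b) :=
  (congrArg T.comp₁ (map_mul Ψ.hom a b)).trans (T.comp₁_mul (Ψ.part₀_mem ha) _)

@[simp] theorem part₀_restrict (g : T' ⟶ T) (a : X.alg) :
    (Ψ.restrict g).part₀ a = GrMfd.pull g (Ψ.part₀ a) := GrMfd.comp₀_fatMap g _

@[simp] theorem part₁_restrict (g : T' ⟶ T) (a : X.alg) :
    (Ψ.restrict g).part₁ a = GrMfd.pull g (Ψ.part₁ a) := GrMfd.comp₁_fatMap g _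

/-- The point `Ψ₀ + ε Ψ₁` given by an algebra morphism `Ψ₀` and a derivation `Ψ₁` over it. -/
def ofParts (χ : X.alg →ₐ[ℝ] T.alg) (hχ : ∀ k, ∀ a ∈ X.gr k, χ a ∈ T.gr k) (δ : X.alg →ₗ[ℝ] T.alg)
    (hδ : ∀ k, ∀ a ∈ X.gr k, δ a ∈ T.gr (k + 1))
    (hm : ∀ k, ∀ a ∈ X.gr k, ∀ b, δ (a * b) = δ a * χ b + (-1 : ℤˣ) ^ k • (χ a * δ b)) :
    FatPoint X T where
  hom := AlgHom.ofLinearMap (T.fatMkₗ ∘ₗ χ.toLinearMap.prod δ)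
    (by
      have h1 : δ 1 = 0 := by
        have := hm 0 1 SetLike.GradedOne.one_mem 1
        rw [map_one χ, mul_one, mul_one, one_mul, zpow_zero, one_smul] at this
        exact left_eq_add.1 this
      change T.fatMk (χ 1) (δ 1) = 1
      rw [h1, map_one, GrMfd.fatMk, map_zero, mul_zero, add_zero, map_one])
    (fun a b => by
      change T.fatMk (χ (a * b)) (δ (a * b)) = T.fatMk (χ a) (δ a) * T.fatMk (χ b) (δ b)
      induction a using DirectSum.Decomposition.inductionOn X.gr with
      | zero =>
        have h0 : T.fatMk 0 0 = 0 := map_zero T.fatMkₗ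
        rw [zero_mul, map_zero, map_zero, h0, zero_mul]
      | homogeneous a =>
        rw [T.fatMk_mul (hχ _ a a.2), hm _ a a.2, map_mul]
      | add a a' ha ha' =>
        have h1 : ∀ p q p' q' : T.alg, T.fatMk (p + p') (q + q') = T.fatMk p q + T.fatMk p' q' :=
          fun p q p' q' => map_add T.fatMkₗ (p, q) (p', q')
        rw [add_mul, map_add, map_add, h1, ha, ha', ← add_mul, ← h1, map_add, map_add])
  map_mem k a ha := T.fatMk_mem (hχ k a ha) (hδ k a ha)

theorem part₀_ofParts {χ : X.alg →ₐ[ℝ] T.alg} {hχ} {δ : X.alg →ₗ[ℝ] T.alg} {hδ hm} (a : X.alg) :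
    (ofParts (X := X) (T := T) χ hχ δ hδ hm).part₀ a = χ a := T.comp₀_fatMk _ _

theorem part₁_ofParts {χ : X.alg →ₐ[ℝ] T.alg} {hχ} {δ : X.alg →ₗ[ℝ] T.alg} {hδ hm} (a : X.alg) :
    (ofParts (X := X) (T := T) χ hχ δ hδ hm).part₁ a = δ a := T.comp₁_fatMk _ _

theorem ext_parts {Ψ Ψ' : FatPoint X T} (h₀ : ∀ a, Ψ.part₀ a = Ψ'.part₀ a)
    (h₁ : ∀ a, Ψ.part₁ a = Ψ'.part₁ a) : Ψ = Ψ' :=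
  FatPoint.ext fun a => GrMfd.fat_ext (h₀ a) (h₁ a)

end FatPoint


/-! ### Points of the shifted tangent presheaf given on generators -/

section MatrixGrading

variable {R : Type} [Ring R] [Algebra ℝ R] (gr : ℤ → Submodule ℝ R)

/-- The grading on upper triangular matrices `(±a, b; 0, a)` which encode elements `a + ε b`. -/
def matDeg (k : ℤ) : Submodule ℝ (Matrix (Fin 2) (Fin 2) R) where
  carrier := {A | A 1 0 = 0 ∧ A 1 1 ∈ gr k ∧ A 0 1 ∈ gr (k + 1) ∧ A 0 0 = (-1 : ℤˣ) ^ k • A 1 1}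
  zero_mem' := by simp
  add_mem' := by
    rintro A B ⟨h1, h2, h3, h4⟩ ⟨h5, h6, h7, h8⟩
    exact ⟨by simp [h1, h5], add_mem h2 h6, add_mem h3 h7, by
      simp only [Matrix.add_apply]; rw [h4, h8, smul_add]⟩
  smul_mem' := by
    rintro r A ⟨h1, h2, h3, h4⟩
    exact ⟨by simp [h1], Submodule.smul_mem _ r h2, Submodule.smul_mem _ r h3, by
      simp only [Matrix.smul_apply]; rw [h4, smul_comm]⟩

instance [SetLike.GradedMonoid gr] : SetLike.GradedMonoid (matDeg gr) where
  one_mem := ⟨by simp, by simpa using SetLike.GradedOne.one_mem, by simp, by simp⟩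
  mul_mem := by
    rintro k l A B ⟨h1, h2, h3, h4⟩ ⟨h5, h6, h7, h8⟩
    refine ⟨?_, ?_, ?_, ?_⟩
    · rw [Matrix.mul_apply, Fin.sum_univ_two, h1, h5, zero_mul, mul_zero, add_zero]
    · rw [Matrix.mul_apply, Fin.sum_univ_two, h1, zero_mul, zero_add]
      exact SetLike.GradedMul.mul_mem h2 h6
    · rw [Matrix.mul_apply, Fin.sum_univ_two, h4]
      refine add_mem ?_ ?_
      · have h9 := SetLike.GradedMul.mul_mem h2 h7
        rw [← add_assoc] at h9
        rcases Int.units_eq_one_or ((-1 : ℤˣ) ^ k) with h | h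
        · rw [h, one_smul]
          exact h9
        · rw [h, Units.neg_smul, one_smul, neg_mul]
          exact neg_mem h9
      · have h9 := SetLike.GradedMul.mul_mem h3 h6
        rw [add_right_comm] at h9
        exact h9
    · rw [Matrix.mul_apply, Matrix.mul_apply, Fin.sum_univ_two, Fin.sum_univ_two, h1, h5, h4, h8,
        zero_mul, mul_zero, add_zero, zero_add, zpow_add, smul_mul_assoc, mul_smul_comm, smul_smul]

end MatrixGrading

namespace GVB

variable {M N : Mfd} {V : GVB M} {W : GVB N}

/-- The sections of matrices over `S W*` with smooth entries. -/
def smoothMatrices (W : GVB N) : Subalgebra ℝ (∀ y, Matrix (Fin 2) (Fin 2) (W.SFib y)) where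
  carrier := {A | ∀ i j, W.IsSmooth fun y => A y i j}
  add_mem' ha hb i j := (ha i j).add W (hb i j)
  mul_mem' := by
    intro A B ha hb i j
    have h : (fun y => (A * B) y i j) =
        (fun y => A y i 0) * (fun y => B y 0 j) + (fun y => A y i 1) * fun y => B y 1 j := by
      funext y
      simp [Matrix.mul_apply, Fin.sum_univ_two]
    rw [h]
    exact ((ha i 0).mul W (hb 0 j)).add W ((ha i 1).mul W (hb 1 j))
  algebraMap_mem' r i j := by
    have h : (fun y => (algebraMap ℝ (∀ y, Matrix (Fin 2) (Fin 2) (W.SFib y)) r) y i j) =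
        algebraMap ℝ (∀ y, W.SFib y) (if i = j then r else 0) := by
      funext y
      by_cases hij : i = j <;> simp [hij, Matrix.algebraMap_matrix_apply]
    rw [h]
    exact W.isSmooth_of_mem (algebraMap_mem _ _)

/-- The matrix encoding `a + ε b` for `a` of degree `k`. -/
def fatMat (k : ℤ) (a b : W.Alg) (y : N) : Matrix (Fin 2) (Fin 2) (W.SFib y) :=
  !![(-1 : ℤˣ) ^ k • W.toSection a y, W.toSection b y; 0, W.toSection a y]

theorem fatMat_mem_smooth (k : ℤ) (a b : W.Alg) : fatMat k a b ∈ W.smoothMatrices := by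
  have ha := W.toSection_isSmooth a
  have hb := W.toSection_isSmooth b
  have h0 : W.IsSmooth 0 := W.isSmooth_of_mem (zero_mem _)
  have hs : W.IsSmooth ((-1 : ℤˣ) ^ k • W.toSection a) := by
    rcases Int.units_eq_one_or ((-1 : ℤˣ) ^ k) with h | h
    · rw [h, one_smul]
      exact ha
    · rw [h, Units.neg_smul, one_smul, ← map_neg]
      exact W.toSection_isSmooth _
  intro i j
  fin_cases i <;> fin_cases j
  exacts [hs, hb, h0, ha]

theorem fatMat_mem_deg {k : ℤ} {a b : W.Alg} (ha : a ∈ sumGrading W.SSec k)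
    (hb : b ∈ sumGrading W.SSec (k + 1)) (y : N) : fatMat k a b y ∈ matDeg (W.SFibDeg y) k :=
  ⟨rfl, (mem_SSec_of_mem_sumGrading ha).2 y, (mem_SSec_of_mem_sumGrading hb).2 y, rfl⟩

/-- The sign in the upper left corner reproduces the Koszul sign, so these matrices multiply as the
elements a + εb do. This gives points an algebra of sections over `N` as target, to which `GenData`
applies. -/
theorem fatMat_mul (k l : ℤ) (a b c d : W.Alg) :
    fatMat k a b * fatMat l c d = fatMat (k + l) (a * c) (b * c + (-1 : ℤˣ) ^ k • (a * d)) := by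
  funext y
  have e1 : (-1 : ℤˣ) ^ k • W.toSection a y * (-1 : ℤˣ) ^ l • W.toSection c y =
      (-1 : ℤˣ) ^ (k + l) • (W.toSection a y * W.toSection c y) := by
    rw [smul_mul_assoc, mul_smul_comm, smul_smul, zpow_add]
  rw [Pi.mul_apply]
  simp only [fatMat, Matrix.mul_fin_two]
  rw [e1, map_add, map_mul, map_mul, Units.smul_def ((-1 : ℤˣ) ^ k) (a * d), map_zsmul, map_mul,
    mul_zero, add_zero, zero_mul, zero_mul, zero_add, mul_zero, zero_add,
    add_comm ((-1 : ℤˣ) ^ k • W.toSection a y * W.toSection d y), smul_mul_assoc,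
    Units.smul_def ((-1 : ℤˣ) ^ k) (_ * _)]
  rfl

theorem fatMat_add (k : ℤ) (a b c d : W.Alg) :
    fatMat k (a + c) (b + d) = fatMat k a b + fatMat k c d := by
  funext y
  ext i j
  fin_cases i <;> fin_cases j <;> simp [fatMat]

theorem fatMat_smul (k : ℤ) (r : ℝ) (a b : W.Alg) :
    fatMat k (r • a) (r • b) = r • fatMat k a b := by
  funext y
  have e : (-1 : ℤˣ) ^ k • r • W.toSection a y = r • (-1 : ℤˣ) ^ k • W.toSection a y :=
    smul_comm _ _ _
  simp only [fatMat, map_smul, Pi.smul_apply, Matrix.smul_of, Matrix.smul_cons, Matrix.smul_empty,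
    smul_zero]
  rw [e]

theorem fatMat_sign (k : ℤ) (e : ℤˣ) (a b : W.Alg) :
    fatMat k (e • a) (e • b) = e • fatMat k a b := by
  rcases Int.units_eq_one_or e with rfl | rfl
  · simp
  · have h : ∀ {A : Type} [AddCommGroup A] [Module ℝ A] (x : A), (-1 : ℤˣ) • x = (-1 : ℝ) • x :=
      fun x => by rw [Units.neg_smul, one_smul, neg_one_smul]
    exact (congrArg₂ (fatMat k) (h a) (h b)).trans ((fatMat_smul k (-1) a b).trans (h _).symm)

/-- Values on generators of a point `Ψ₀ + ε Ψ₁` with values in `C(D) ⊗ Γ(S W*)`. -/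
structure FatData (V : GVB M) (W : GVB N) where
  onFun₀ : M.Fun →ₐ[ℝ] W.Alg
  onFun₁ : M.Fun →ₗ[ℝ] W.Alg
  onSec₀ : ∀ i, (V i).dual.Sec →ₗ[ℝ] W.Alg
  onSec₁ : ∀ i, (V i).dual.Sec →ₗ[ℝ] W.Alg
  onFun₀_mem : ∀ f, onFun₀ f ∈ sumGrading W.SSec 0
  onFun₁_mem : ∀ f, onFun₁ f ∈ sumGrading W.SSec 1
  onSec₀_mem : ∀ i σ, onSec₀ i σ ∈ sumGrading W.SSec (-i)
  onSec₁_mem : ∀ i σ, onSec₁ i σ ∈ sumGrading W.SSec (-i + 1)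
  onFun₁_mul : ∀ f g, onFun₁ (f * g) = onFun₁ f * onFun₀ g + onFun₀ f * onFun₁ g
  onSec₀_smul : ∀ i f σ, onSec₀ i ((V i).dual.smulSec f σ) = onFun₀ f * onSec₀ i σ
  onSec₁_smul : ∀ i f σ,
    onSec₁ i ((V i).dual.smulSec f σ) = onFun₁ f * onSec₀ i σ + onFun₀ f * onSec₁ i σ

namespace FatData

variable (D : FatData V W)

/-- Graded commutativity of elements `a + ε b`. -/
theorem fatMat_comm {k l : ℤ} {a b c d : W.Alg} (ha : a ∈ sumGrading W.SSec k)
    (hb : b ∈ sumGrading W.SSec (k + 1)) (hc : c ∈ sumGrading W.SSec l)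
    (hd : d ∈ sumGrading W.SSec (l + 1)) :
    fatMat k a b * fatMat l c d = (-1 : ℤˣ) ^ (k * l) • (fatMat l c d * fatMat k a b) := by
  rw [fatMat_mul, fatMat_mul, ← fatMat_sign, add_comm l k]
  have h1 := W.alg_comm ha hc
  have h2 := W.alg_comm hb hc
  have h3 := W.alg_comm ha hd
  -- Commuting exchanges the two summands of the ε-part; the factors (−1)^l and (−1)^k beyond the
  -- common sign account for the sign in `fatMat_mul`.
  have e1 : (-1 : ℤˣ) ^ ((k + 1) * l) = (-1 : ℤˣ) ^ (k * l) * (-1 : ℤˣ) ^ l := by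
    rw [← zpow_add]; ring_nf
  have e2 : (-1 : ℤˣ) ^ (k * (l + 1)) = (-1 : ℤˣ) ^ (k * l) * (-1 : ℤˣ) ^ k := by
    rw [← zpow_add]; ring_nf
  have e3 : ((-1 : ℤˣ) ^ k) * ((-1 : ℤˣ) ^ k) = 1 := Int.units_mul_self _
  rw [h1, h2, h3, e1, e2]
  congr 1
  rw [smul_smul, smul_add, smul_smul, add_comm]
  congr 2
  rw [mul_comm, mul_assoc, e3, mul_one]

/-- The values on generators as matrices. -/
def genData : GenData V N fun y => Matrix (Fin 2) (Fin 2) (W.SFib y) where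
  base := basePoint D.onFun₀
  cont := continuous_basePoint D.onFun₀
  onFun := AlgHom.ofLinearMap
    { toFun := fun f => fatMat 0 (D.onFun₀ f) (D.onFun₁ f)
      map_add' := fun f g => by rw [map_add, map_add, fatMat_add]
      map_smul' := fun r f => by rw [map_smul, map_smul, fatMat_smul]; rfl }
    (by
      have h1 : D.onFun₁ 1 = 0 := by
        have := D.onFun₁_mul 1 1
        rw [map_one D.onFun₀, mul_one, mul_one, one_mul] at this
        refine toSection_injective fun y => ?_
        have e := congrFun (congrArg W.toSection this) y
        rw [map_add] at e
        rw [map_zero]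
        exact left_eq_add.1 e
      funext y
      change fatMat 0 (D.onFun₀ 1) (D.onFun₁ 1) y = 1
      rw [h1, map_one, fatMat, map_one, map_zero]
      simp [Matrix.one_fin_two])
    (fun f g => by
      change fatMat 0 (D.onFun₀ (f * g)) (D.onFun₁ (f * g)) =
        fatMat 0 (D.onFun₀ f) (D.onFun₁ f) * fatMat 0 (D.onFun₀ g) (D.onFun₁ g)
      rw [fatMat_mul, map_mul, D.onFun₁_mul, zpow_zero, one_smul, add_zero])
  onSec i :=
    { toFun := fun σ => fatMat (-i) (D.onSec₀ i σ) (D.onSec₁ i σ)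
      map_add' := fun f g => by rw [map_add, map_add, fatMat_add]
      map_smul' := fun r f => by rw [map_smul, map_smul, fatMat_smul]; rfl }
  onSec_smul i f σ := by
    change fatMat (-i) (D.onSec₀ i _) (D.onSec₁ i _) =
      fatMat 0 (D.onFun₀ f) (D.onFun₁ f) * fatMat (-i) (D.onSec₀ i σ) (D.onSec₁ i σ)
    rw [fatMat_mul, D.onSec₀_smul, D.onSec₁_smul, zero_add, zpow_zero, one_smul]
  fun_comm f i σ := by
    change fatMat 0 (D.onFun₀ f) (D.onFun₁ f) * fatMat (-i) (D.onSec₀ i σ) (D.onSec₁ i σ) =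
      fatMat (-i) (D.onSec₀ i σ) (D.onSec₁ i σ) * fatMat 0 (D.onFun₀ f) (D.onFun₁ f)
    rw [fatMat_comm (D.onFun₀_mem f) (D.onFun₁_mem f) (D.onSec₀_mem i σ) (D.onSec₁_mem i σ), zero_mul,
      zpow_zero, one_smul]
  sec_comm i j σ τ :=
    fatMat_comm (D.onSec₀_mem i σ) (D.onSec₁_mem i σ) (D.onSec₀_mem j τ) (D.onSec₁_mem j τ)
  reg y h z hh hz := by
    change fatMat 0 (D.onFun₀ h) (D.onFun₁ h) y * z = 0 at hz
    have hr : ∀ w, W.toSection (D.onFun₀ h) y * w = 0 → w = 0 :=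
      fun w hw => toSection_regular D.onFun₀ hh hw
    have e : ∀ i j, (fatMat 0 (D.onFun₀ h) (D.onFun₁ h) y * z) i j = 0 := fun i j => by rw [hz]; rfl
    simp only [Matrix.mul_apply, Fin.sum_univ_two] at e
    -- Back substitution in a triangular system: the lower row is cancelled first, then the upper
    -- one.
    have e1 : ∀ j, z 1 j = 0 := fun j => hr _ (by simpa [fatMat] using e 1 j)
    have e0 : ∀ j, z 0 j = 0 := fun j => hr _ (by simpa [fatMat, e1] using e 0 j)
    ext i j
    fin_cases i
    exacts [e0 j, e1 j]

theorem hom_mem {k : ℤ} {a : V.Alg} (ha : a ∈ sumGrading V.SSec k) (y : N) :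
    D.genData.hom a y ∈ matDeg (W.SFibDeg y) k :=
  D.genData.hom_mem (fun y => matDeg (W.SFibDeg y))
    (fun f y => fatMat_mem_deg (D.onFun₀_mem f) (D.onFun₁_mem f) y)
    (fun i σ y => fatMat_mem_deg (D.onSec₀_mem i σ) (D.onSec₁_mem i σ) y) ha y

theorem hom_smooth (a : V.Alg) (i j : Fin 2) : W.IsSmooth fun y => D.genData.hom a y i j :=
  isSmooth_of_local fun y₀ => by
    obtain ⟨b, hb, hab⟩ := D.genData.hom_local W.smoothMatrices
      (fun f => fatMat_mem_smooth _ _ _) (fun i σ => fatMat_mem_smooth _ _ _) a y₀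
    exact ⟨_, hb i j, hab.mono fun y hy => congrFun (congrFun hy i) j⟩

theorem hom_one_zero (a : V.Alg) (y : N) : D.genData.hom a y 1 0 = 0 := by
  induction a using DirectSum.induction_on with
  | zero => simp
  | add a b ha hb => rw [map_add, Pi.add_apply, Matrix.add_apply, ha, hb, add_zero]
  | of k a => exact (D.hom_mem ⟨a, rfl⟩ y).1

/-- The part `Ψ₀`. -/
def part₀ : sumGrading V.SSec →ₐᵍ[ℝ] sumGrading W.SSec :=
  algLift
    (AlgHom.ofLinearMap
      { toFun := fun a y => D.genData.hom a y 1 1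
        map_add' := fun a b => by rw [map_add]; rfl
        map_smul' := fun r a => by rw [map_smul]; rfl }
      (by
        funext y
        change D.genData.hom 1 y 1 1 = 1
        rw [map_one]
        rfl)
      (fun a b => by
        funext y
        change D.genData.hom (a * b) y 1 1 = D.genData.hom a y 1 1 * D.genData.hom b y 1 1
        rw [map_mul, Pi.mul_apply, Matrix.mul_apply, Fin.sum_univ_two, hom_one_zero, zero_mul,
          zero_add]))
    fun _ a ha => ⟨D.hom_smooth a 1 1, fun y => (D.hom_mem ha y).2.1⟩

theorem toSection_part₀ (a : V.Alg) (y : N) :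
    W.toSection (D.part₀ a) y = D.genData.hom a y 1 1 :=
  congrFun (toSection_algLift _ _ a) y

/-- The part `Ψ₁`. -/
def part₁ : V.Alg →ₗ[ℝ] W.Alg :=
  linLift 1
    { toFun := fun a y => D.genData.hom a y 0 1
      map_add' := fun a b => by rw [map_add]; rfl
      map_smul' := fun r a => by rw [map_smul]; rfl }
    fun _ a ha => ⟨D.hom_smooth a 0 1, fun y => (D.hom_mem ha y).2.2.1⟩

theorem toSection_part₁ (a : V.Alg) (y : N) :
    W.toSection (D.part₁ a) y = D.genData.hom a y 0 1 :=
  congrFun (toSection_linLift _ _ _ a) y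

theorem part₁_mem {k : ℤ} {a : V.Alg} (ha : a ∈ sumGrading V.SSec k) :
    D.part₁ a ∈ sumGrading W.SSec (k + 1) := linLift_mem _ _ _ ha

/-- The Leibniz rule is the upper right entry of a matrix product, the upper left entry being (−1)^k
times the lower right one in degree `k`. -/
theorem part₁_mul {k : ℤ} {a : V.Alg} (ha : a ∈ sumGrading V.SSec k) (b : V.Alg) :
    D.part₁ (a * b) = D.part₁ a * D.part₀ b + (-1 : ℤˣ) ^ k • (D.part₀ a * D.part₁ b) := by
  refine toSection_injective fun y => ?_
  have e : W.toSection (D.part₁ a * D.part₀ b + (-1 : ℤˣ) ^ k • (D.part₀ a * D.part₁ b)) y =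
      W.toSection (D.part₁ a) y * W.toSection (D.part₀ b) y +
        (-1 : ℤˣ) ^ k • (W.toSection (D.part₀ a) y * W.toSection (D.part₁ b) y) := by
    rw [map_add, map_mul, Units.smul_def, map_zsmul, map_mul]
    rfl
  rw [e]
  simp only [toSection_part₀, toSection_part₁]
  rw [map_mul, Pi.mul_apply, Matrix.mul_apply, Fin.sum_univ_two, (D.hom_mem ha y).2.2.2, add_comm,
    smul_mul_assoc]

/-- The point with the given values on generators. -/
def point : FatPoint V.toGrMfd W.toGrMfd :=
  FatPoint.ofParts (X := V.toGrMfd) (T := W.toGrMfd) D.part₀.toAlgHom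
    (fun _ _ ha => D.part₀.map_mem ha) D.part₁ (fun _ _ ha => D.part₁_mem ha)
    (fun _ _ ha b => D.part₁_mul ha b)

theorem point_part₀_ofFun (f : M.Fun) : D.point.part₀ (V.ofFun f) = D.onFun₀ f := by
  refine (FatPoint.part₀_ofParts _).trans (toSection_injective fun y => ?_)
  refine (D.toSection_part₀ _ y).trans ?_
  rw [D.genData.hom_ofFun]
  rfl

theorem point_part₁_ofFun (f : M.Fun) : D.point.part₁ (V.ofFun f) = D.onFun₁ f := by
  refine (FatPoint.part₁_ofParts _).trans (toSection_injective fun y => ?_)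
  refine (D.toSection_part₁ _ y).trans ?_
  rw [D.genData.hom_ofFun]
  rfl

theorem point_part₀_ofSec (i : ℤ) (σ : (V i).dual.Sec) :
    D.point.part₀ (V.ofSec i σ) = D.onSec₀ i σ := by
  refine (FatPoint.part₀_ofParts _).trans (toSection_injective fun y => ?_)
  refine (D.toSection_part₀ _ y).trans ?_
  rw [D.genData.hom_ofSec]
  rfl

theorem point_part₁_ofSec (i : ℤ) (σ : (V i).dual.Sec) :
    D.point.part₁ (V.ofSec i σ) = D.onSec₁ i σ := by
  refine (FatPoint.part₁_ofParts _).trans (toSection_injective fun y => ?_)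
  refine (D.toSection_part₁ _ y).trans ?_
  rw [D.genData.hom_ofSec]
  rfl

end FatData

end GVB


/-! ### The universal point of `T[1]𝔖(V)` given by a connection -/

namespace GVB

variable {M N : Mfd} (V : GVB M)

/-- A covector of `Vᵢ` as a generator of the fibre of `S (V ⊕ T[1]M ⊕ V[1])*`. -/
def baseGen (i : ℤ) (x : M) : (V i).dual.fib x →ₗ[ℝ] V.T1.SFib x :=
  GSym.gen (fun i : ℤ => -i) (fun i => (V.T1 i).dual.fib x) i ∘ₗ
    ((VB.Hom.fst (V i) ((shiftedTangent M i).sum (V (i + 1)))).dualApp x :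
      (V i).dual.fib x →ₗ[ℝ] (V.T1 i).dual.fib x)

/-- A covector of `M` as a generator of the fibre of `S (V ⊕ T[1]M ⊕ V[1])*`. -/
def formGen (x : M) : (VB.tangent M).dual.fib x →ₗ[ℝ] V.T1.SFib x :=
  GSym.gen (fun i : ℤ => -i) (fun i => (V.T1 i).dual.fib x) (-1) ∘ₗ
    ((VB.Hom.snd (V (-1)) ((shiftedTangent M (-1)).sum (V (-1 + 1)))).dualApp x :
      ((shiftedTangent M (-1)).sum (V (-1 + 1))).dual.fib x →ₗ[ℝ] (V.T1 (-1)).dual.fib x) ∘ₗ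
    ((VB.Hom.fst (shiftedTangent M (-1)) (V (-1 + 1))).dualApp x :
      (shiftedTangent M (-1)).dual.fib x →ₗ[ℝ] _)

/-- A covector of `V[1]ᵢ` as a generator of the fibre of `S (V ⊕ T[1]M ⊕ V[1])*`. -/
def shiftGen (i : ℤ) (x : M) : (V (i + 1)).dual.fib x →ₗ[ℝ] V.T1.SFib x :=
  GSym.gen (fun i : ℤ => -i) (fun i => (V.T1 i).dual.fib x) i ∘ₗ
    ((VB.Hom.snd (V i) ((shiftedTangent M i).sum (V (i + 1)))).dualApp x :
      ((shiftedTangent M i).sum (V (i + 1))).dual.fib x →ₗ[ℝ] (V.T1 i).dual.fib x) ∘ₗ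
    ((VB.Hom.snd (shiftedTangent M i) (V (i + 1))).dualApp x :
      (V (i + 1)).dual.fib x →ₗ[ℝ] _)

theorem toSection_inclBase (i : ℤ) (σ : (V i).dual.Sec) (x : M) :
    V.T1.toSection (V.T1.ofSec i (V.inclBase i σ)) x = V.baseGen i x (σ x) :=
  V.T1.toSection_ofSec i _ x

theorem toSection_inclForm (α : (VB.tangent M).dual.Sec) (x : M) :
    V.T1.toSection (V.T1.ofSec (-1) (V.inclForm α)) x = V.formGen x (α x) :=
  V.T1.toSection_ofSec (-1) _ x

theorem toSection_inclShift (i : ℤ) (σ : (V (i + 1)).dual.Sec) (x : M) :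
    V.T1.toSection (V.T1.ofSec i (V.inclShift i σ)) x = V.shiftGen i x (σ x) :=
  V.T1.toSection_ofSec i _ x

theorem baseGen_mem (i : ℤ) (x : M) (ξ : (V i).dual.fib x) :
    V.baseGen i x ξ ∈ V.T1.SFibDeg x (-i) := GSym.gen_mem_homog _ _ i _

theorem formGen_mem (x : M) (ξ : (VB.tangent M).dual.fib x) :
    V.formGen x ξ ∈ V.T1.SFibDeg x 1 := by
  have h := GSym.gen_mem_homog (fun i : ℤ => -i) (fun i => (V.T1 i).dual.fib x) (-1)
  simp only [neg_neg] at h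
  exact h _

theorem shiftGen_mem (i : ℤ) (x : M) (ξ : (V (i + 1)).dual.fib x) :
    V.shiftGen i x ξ ∈ V.T1.SFibDeg x (-i) := GSym.gen_mem_homog _ _ i _

/-- The rule `ℓ (f τ) = f ℓ τ + df τ` at the point `x`. -/
def IsLeibniz (i : ℤ) (x : M) (ℓ : (V i).dual.Sec →ₗ[ℝ] V.T1.SFib x) : Prop :=
  ∀ (f : M.Fun) (τ : (V i).dual.Sec), ℓ ((V i).dual.smulSec f τ) =
    f x • ℓ τ + V.formGen x (VB.d f x) * V.baseGen i x (τ x)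

variable {V}

/-- The Leibniz terms cancel in the difference of two such operators, which is then linear over
functions and depends only on the value of the section at `x`. This makes covariant derivatives
independent of the frame. -/
theorem IsLeibniz.eq_of_apply_eq_zero {i : ℤ} {x : M} {ℓ ℓ' : (V i).dual.Sec →ₗ[ℝ] V.T1.SFib x}
    (h : V.IsLeibniz i x ℓ) (h' : V.IsLeibniz i x ℓ') {τ : (V i).dual.Sec} (hτ : τ x = 0) :
    ℓ τ = ℓ' τ := by
  let e := (V i).dual.localFrame x
  have hδ : ∀ (f : M.Fun) (τ : (V i).dual.Sec),
      (ℓ - ℓ') ((V i).dual.smulSec f τ) = f x • (ℓ - ℓ') τ := fun f τ => by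
    rw [LinearMap.sub_apply, LinearMap.sub_apply, h, h', add_sub_add_right_eq_sub, smul_sub]
  obtain ⟨k, h1, h2⟩ := Mfd.exists_bump_mem e.eventually_eq
  have e1 : (V i).dual.smulSec k τ = ∑ a, (V i).dual.smulSec (k * e.coeff a τ) (e.sec a) := by
    ext y : 1
    have hsum : (∑ a, (V i).dual.smulSec (k * e.coeff a τ) (e.sec a)) y =
        ∑ a, k y • (e.coeff a τ y • e.sec a y) :=
      (map_sum ((V i).dual.evalSec y) _ _).trans
        (Finset.sum_congr rfl fun a _ => mul_smul (k y) (e.coeff a τ y) (e.sec a y))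
    rw [hsum, ← Finset.smul_sum]
    by_cases hk : k y = 0
    · rw [VB.smulSec_apply, hk, zero_smul, zero_smul]
    · rw [← h2 y hk τ]
      rfl
  have e2 : (ℓ - ℓ') τ = (ℓ - ℓ') ((V i).dual.smulSec k τ) := by
    rw [hδ, h1.self_of_nhds, one_smul]
  rw [← sub_eq_zero, ← LinearMap.sub_apply, e2, e1, map_sum]
  refine Finset.sum_eq_zero fun a _ => ?_
  rw [hδ]
  have : (k * e.coeff a τ) x = 0 := by
    change k x * e.coord x (τ x) a = 0
    rw [hτ, map_zero, Pi.zero_apply, mul_zero]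
  rw [this, zero_smul]

/-- The flat derivative of sections in a local frame. -/
def frameDer (i : ℤ) {x₀ : M} (e : (V i).dual.LocalFrame x₀) (x : M) :
    (V i).dual.Sec →ₗ[ℝ] V.T1.SFib x where
  toFun τ := ∑ a, V.formGen x (VB.d (e.coeff a τ) x) * V.baseGen i x (e.sec a x)
  map_add' σ τ := by
    rw [← Finset.sum_add_distrib]
    refine Finset.sum_congr rfl fun a _ => ?_
    rw [map_add, VB.d_add, map_add, add_mul]
  map_smul' r σ := by
    rw [Finset.smul_sum]
    refine Finset.sum_congr rfl fun a _ => ?_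
    rw [map_smul, VB.d_smul, map_smul, smul_mul_assoc, RingHom.id_apply]

theorem frameDer_leibniz (i : ℤ) {x₀ : M} (e : (V i).dual.LocalFrame x₀) :
    ∀ᶠ x in 𝓝 x₀, V.IsLeibniz i x (frameDer i e x) := by
  filter_upwards [e.eventually_eq] with x hx f τ
  have e1 : V.baseGen i x (τ x) = ∑ a, e.coeff a τ x • V.baseGen i x (e.sec a x) := by
    conv_lhs => rw [hx τ]
    rw [map_sum]
    simp only [map_smul]
  change ∑ a, V.formGen x (VB.d (e.coeff a _) x) * V.baseGen i x (e.sec a x) =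
    f x • ∑ a, V.formGen x (VB.d (e.coeff a τ) x) * V.baseGen i x (e.sec a x) + _
  rw [e1, Finset.smul_sum, Finset.mul_sum, ← Finset.sum_add_distrib]
  refine Finset.sum_congr rfl fun a _ => ?_
  rw [e.coeff_smulSec, VB.d_mul, map_add, map_smul, map_smul, add_mul, smul_mul_assoc,
    smul_mul_assoc, mul_smul_comm]

variable (V) in
/-- The subalgebra generated by functions, exact forms and sections of `V*`. -/
def noShift : Subalgebra ℝ V.T1.Alg :=
  Algebra.adjoin ℝ ((Set.range V.T1.ofFun ∪
    Set.range fun f => V.T1.ofSec (-1) (V.inclForm (VB.d f))) ∪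
      ⋃ i, Set.range fun σ => V.T1.ofSec i (V.inclBase i σ))

theorem ofFun_mem_noShift (f : M.Fun) : V.T1.ofFun f ∈ V.noShift :=
  Algebra.subset_adjoin (Or.inl (Or.inl ⟨f, rfl⟩))

theorem exists_frameDer_eq (i : ℤ) {x₀ : M} (e : (V i).dual.LocalFrame x₀) (τ : (V i).dual.Sec) :
    ∃ q ∈ V.noShift, ∀ x, frameDer i e x τ = V.T1.toSection q x := by
  refine ⟨∑ a, V.T1.ofSec (-1) (V.inclForm (VB.d (e.coeff a τ))) *
    V.T1.ofSec i (V.inclBase i (e.sec a)), sum_mem fun a _ => mul_mem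
      (Algebra.subset_adjoin (Or.inl (Or.inr ⟨_, rfl⟩)))
      (Algebra.subset_adjoin (Or.inr (Set.mem_iUnion.2 ⟨i, _, rfl⟩))), fun x => ?_⟩
  refine Eq.trans ?_ ((congrFun (map_sum V.T1.toSection (fun a =>
    V.T1.ofSec (-1) (V.inclForm (VB.d (e.coeff a τ))) *
      V.T1.ofSec i (V.inclBase i (e.sec a))) Finset.univ) x).trans (Finset.sum_apply _ _ _)).symm
  change ∑ a, V.formGen x (VB.d (e.coeff a τ) x) * V.baseGen i x (e.sec a x) = _
  refine Finset.sum_congr rfl fun a _ => ?_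
  rw [map_mul, Pi.mul_apply, toSection_inclForm, toSection_inclBase]

theorem frameDer_mem (i : ℤ) {x₀ : M} (e : (V i).dual.LocalFrame x₀) (x : M) (τ : (V i).dual.Sec) :
    frameDer i e x τ ∈ V.T1.SFibDeg x (1 + -i) := by
  change ∑ a, V.formGen x (VB.d (e.coeff a τ) x) * V.baseGen i x (e.sec a x) ∈ _
  exact sum_mem fun _ _ => GSym.mul_mem_homog _ _ (V.formGen_mem x _) (V.baseGen_mem i x _)

/-- The flat derivative on jets in the chosen frame. -/
def frameJet (i : ℤ) (x : M) : (V i).dual.J1 x →ₗ[ℝ] V.T1.SFib x :=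
  ((V i).dual.jetKer x).liftQ (frameDer i ((V i).dual.localFrame x) x) (Submodule.span_le.2 (by
    rintro _ ⟨f, g, σ, hf, hg, rfl⟩
    have h := (frameDer_leibniz i ((V i).dual.localFrame x)).self_of_nhds
    change frameDer i ((V i).dual.localFrame x) x _ = 0
    -- In ℓ(f·gσ) = f(x)ℓ(gσ) + df·(gσ)(x) the first term dies with `f x` and the second with `g x`.
    rw [h, hf, zero_smul, zero_add, VB.smulSec_apply, hg, zero_smul, map_zero, mul_zero]))

theorem frameJet_jet (i : ℤ) (x : M) (τ : (V i).dual.Sec) :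
    frameJet i x ((V i).dual.jet x τ) = frameDer i ((V i).dual.localFrame x) x τ := rfl

theorem jetProj_jet {V : VB M} (x : M) (τ : V.Sec) : V.jetProj x (V.jet x τ) = τ x := rfl

/-! ### The covariant derivative of the connection and the universal point -/

variable (s : V.DualConnection)

/-- The universal covariant derivative on jets. -/
def univJet (i : ℤ) (x : M) : (V (i + 1)).dual.J1 x →ₗ[ℝ] V.T1.SFib x :=
  V.shiftGen i x ∘ₗ (V (i + 1)).dual.jetProj x + frameJet (i + 1) x -
    frameJet (i + 1) x ∘ₗ (s (i + 1)).app x ∘ₗ (V (i + 1)).dual.jetProj x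

/-- On jets in the image of `s` the two frame terms cancel and only the shifted generator is left,
as the splitting requires. -/
theorem univJet_app (i : ℤ) (x : M) (ξ : (V (i + 1)).dual.fib x) :
    univJet s i x ((s (i + 1)).app x ξ) = V.shiftGen i x ξ := by
  simp only [univJet, LinearMap.sub_apply, LinearMap.add_apply, LinearMap.comp_apply,
    (s (i + 1)).proj_app, add_sub_cancel_right]

/-- The frame derivative enters only through `τ - τ'`, which vanishes at `x`, so any operator with
the Leibniz rule may replace it. Although `univJet` uses a frame chosen separately for each `x`, one
frame therefore computes it at all nearby points. -/
theorem univJet_jet {i : ℤ} {x : M} {ℓ : (V (i + 1)).dual.Sec →ₗ[ℝ] V.T1.SFib x}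
    (h : V.IsLeibniz (i + 1) x ℓ) {τ τ' : (V (i + 1)).dual.Sec}
    (hτ : (s (i + 1)).app x (τ x) = (V (i + 1)).dual.jet x τ') :
    univJet s i x ((V (i + 1)).dual.jet x τ) = V.shiftGen i x (τ x) + ℓ τ - ℓ τ' := by
  have h0 := (frameDer_leibniz (i + 1) ((V (i + 1)).dual.localFrame x)).self_of_nhds
  have h1 : (τ - τ') x = 0 := by
    have := congrArg ((V (i + 1)).dual.jetProj x) hτ
    rw [(s (i + 1)).proj_app, jetProj_jet] at this
    change τ x - τ' x = 0
    rw [this, sub_self]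
  have h2 := h0.eq_of_apply_eq_zero h h1
  rw [map_sub, map_sub] at h2
  simp only [univJet, LinearMap.sub_apply, LinearMap.add_apply, LinearMap.comp_apply, jetProj_jet,
    hτ, frameJet_jet]
  rw [add_sub_assoc, h2, add_sub_assoc]

theorem univJet_smulSec (i : ℤ) (x : M) (f : M.Fun) (τ : (V (i + 1)).dual.Sec) :
    univJet s i x ((V (i + 1)).dual.jet x ((V (i + 1)).dual.smulSec f τ)) =
      f x • univJet s i x ((V (i + 1)).dual.jet x τ) +
        V.formGen x (VB.d f x) * V.baseGen (i + 1) x (τ x) := by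
  have h0 := (frameDer_leibniz (i + 1) ((V (i + 1)).dual.localFrame x)).self_of_nhds
  obtain ⟨τ', hτ'⟩ := Submodule.mkQ_surjective _ ((s (i + 1)).app x (τ x))
  have hf : (s (i + 1)).app x ((V (i + 1)).dual.smulSec f τ x) =
      (V (i + 1)).dual.jet x (f x • τ') := by
    rw [VB.smulSec_apply, map_smul, map_smul, ← hτ']
    rfl
  rw [univJet_jet s h0 hf, univJet_jet s h0 hτ'.symm, h0, VB.smulSec_apply, map_smul, map_smul,
    smul_sub, smul_add]
  abel

/-- Near `x₀` the connection is a combination of jets g_k j¹σ_k, and the derivatives in a frame at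
`x₀` involve only exact forms and sections of V*. Besides giving smoothness, this shows the
triangular form "shifted generator plus terms without shift", used later to solve for the shifted
generator. -/
theorem exists_univJet_eq (i : ℤ) (τ : (V (i + 1)).dual.Sec) (x₀ : M) :
    ∃ q ∈ V.noShift, ∀ᶠ x in 𝓝 x₀, univJet s i x ((V (i + 1)).dual.jet x τ) =
      V.T1.toSection (V.T1.ofSec i (V.inclShift i τ) + q) x := by
  obtain ⟨U, hU, n, g, σ, hσ⟩ := (s (i + 1)).smooth τ x₀
  let e := (V (i + 1)).dual.localFrame x₀
  obtain ⟨p, hp, hpe⟩ := exists_frameDer_eq (i + 1) e τ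
  choose q hq hqe using fun k => exists_frameDer_eq (i + 1) e (σ k)
  refine ⟨p + ∑ k, (-1 : ℝ) • V.T1.ofFun (g k) * q k, add_mem hp (sum_mem fun k _ =>
    mul_mem (V.noShift.smul_mem (ofFun_mem_noShift (g k)) _) (hq k)), ?_⟩
  filter_upwards [hU, frameDer_leibniz (i + 1) e] with x hx hl
  have h1 : (s (i + 1)).app x (τ x) = (V (i + 1)).dual.jet x (∑ k, g k x • σ k) := by
    refine (hσ x hx).trans ?_
    rw [map_sum]
    simp only [map_smul]
  have h2 : V.T1.toSection (∑ k, (-1 : ℝ) • V.T1.ofFun (g k) * q k) x =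
      ∑ k, -(g k x • frameDer (i + 1) e x (σ k)) := by
    refine ((congrFun (map_sum V.T1.toSection (fun k => (-1 : ℝ) • V.T1.ofFun (g k) * q k)
      Finset.univ) x).trans (Finset.sum_apply _ _ _)).trans (Finset.sum_congr rfl fun k _ => ?_)
    rw [map_mul, Pi.mul_apply, map_smul, Pi.smul_apply, toSection_ofFun, ← hqe, neg_one_smul,
      neg_mul, Algebra.smul_def]
  rw [univJet_jet s hl h1, map_sum, map_add, map_add, Pi.add_apply, Pi.add_apply, h2,
    toSection_inclShift, ← hpe, Finset.sum_neg_distrib, ← add_assoc, sub_eq_add_neg]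
  simp only [map_smul]

theorem univJet_smooth (i : ℤ) (τ : (V (i + 1)).dual.Sec) :
    V.T1.IsSmooth fun x => univJet s i x ((V (i + 1)).dual.jet x τ) :=
  isSmooth_of_local fun x₀ =>
    let ⟨_, _, h⟩ := exists_univJet_eq s i τ x₀
    ⟨_, V.T1.toSection_isSmooth _, h⟩

theorem univJet_mem (i : ℤ) (x : M) (j : (V (i + 1)).dual.J1 x) :
    univJet s i x j ∈ V.T1.SFibDeg x (-i) := by
  have h : ∀ j, frameJet (V := V) (i + 1) x j ∈ V.T1.SFibDeg x (-i) := fun j => by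
    obtain ⟨τ, rfl⟩ := Submodule.mkQ_surjective _ j
    have := frameDer_mem (i + 1) ((V (i + 1)).dual.localFrame x) x τ
    rw [show 1 + -(i + 1) = -i by ring] at this
    exact this
  exact sub_mem (add_mem (V.shiftGen_mem i x _) (h j)) (h _)

/-- The universal covariant derivative on sections of the jet bundle. -/
def univJetSec (i : ℤ) : (V (i + 1)).dual.JetSec →ₗ[ℝ] V.T1.Alg :=
  V.T1.ofSection (-i) ∘ₗ
    { toFun := fun θ => ⟨fun x => univJet s i x (θ.1 x), by
        refine ⟨isSmooth_of_local fun x₀ => ?_, fun x => univJet_mem s i x _⟩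
        obtain ⟨U, hU, n, g, σ, hσ⟩ := θ.2 x₀
        refine ⟨∑ k, V.T1.toSection (V.T1.ofFun (g k)) *
          fun x => univJet s i x ((V (i + 1)).dual.jet x (σ k)), ?_, ?_⟩
        · exact sum_mem (S := smoothSections V.T1) fun k _ =>
            (V.T1.toSection_isSmooth _).mul _ (univJet_smooth s i (σ k))
        · filter_upwards [hU] with x hx
          rw [hσ x hx, map_sum, Finset.sum_apply]
          refine Finset.sum_congr rfl fun k _ => ?_
          rw [map_smul, Pi.mul_apply, toSection_ofFun, Algebra.smul_def]⟩
      map_add' := fun θ θ' => Subtype.ext (funext fun x => map_add (univJet s i x) _ _)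
      map_smul' := fun r θ => Subtype.ext (funext fun x => map_smul (univJet s i x) _ _) }

theorem toSection_univJetSec (i : ℤ) (θ : (V (i + 1)).dual.JetSec) (x : M) :
    V.T1.toSection (univJetSec s i θ) x = univJet s i x (θ.1 x) :=
  congrFun (V.T1.toSection_lof (-i) _) x

/-- The section `j¹σ`, linearly in `σ`. -/
def jetSecₗ (V : VB M) : V.Sec →ₗ[ℝ] V.JetSec where
  toFun := V.jetSec
  map_add' σ τ := Subtype.ext (funext fun x => map_add (V.jet x) σ τ)
  map_smul' r σ := Subtype.ext (funext fun x => map_smul (V.jet x) r σ)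

/-- The universal covariant derivative on sections of `V[1]*`. -/
def univSec (i : ℤ) : (V (i + 1)).dual.Sec →ₗ[ℝ] V.T1.Alg :=
  univJetSec s i ∘ₗ jetSecₗ (V (i + 1)).dual

theorem toSection_univSec (i : ℤ) (τ : (V (i + 1)).dual.Sec) (x : M) :
    V.T1.toSection (univSec s i τ) x = univJet s i x ((V (i + 1)).dual.jet x τ) :=
  toSection_univJetSec s i _ x

theorem univSec_smulSec (i : ℤ) (f : M.Fun) (τ : (V (i + 1)).dual.Sec) :
    univSec s i ((V (i + 1)).dual.smulSec f τ) =
      V.T1.ofSec (-1) (V.inclForm (VB.d f)) * V.T1.ofSec (i + 1) (V.inclBase (i + 1) τ) +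
        V.T1.ofFun f * univSec s i τ := by
  refine toSection_injective fun x => ?_
  rw [map_add, map_mul, map_mul, Pi.add_apply, Pi.mul_apply, Pi.mul_apply, toSection_inclForm,
    toSection_inclBase, toSection_univSec, toSection_univSec, univJet_smulSec, toSection_ofFun,
    Algebra.smul_def, add_comm]

theorem univSec_mem (i : ℤ) (τ : (V (i + 1)).dual.Sec) :
    univSec s i τ ∈ sumGrading V.T1.SSec (-i) := ⟨_, rfl⟩

/-- The universal covariant derivative on sections of `V*`. -/
def univDer (i : ℤ) : (V i).dual.Sec →ₗ[ℝ] V.T1.Alg :=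
  cast (by rw [sub_add_cancel]) (univSec s (i - 1))

/-- `univSec` is indexed by the degree in V[1], one less than that in V, and `univDer` reindexes it
by a cast. Generalizing the index to a variable `k` with `k = i` makes the cast trivial. -/
theorem univDer_add_one (i : ℤ) : univDer s (i + 1) = univSec s i := by
  have h : ∀ (k : ℤ) (hk : k = i) (p : ((V (k + 1)).dual.Sec →ₗ[ℝ] V.T1.Alg) =
      ((V (i + 1)).dual.Sec →ₗ[ℝ] V.T1.Alg)), cast p (univSec s k) = univSec s i := by
    rintro k rfl p
    rfl
  exact h (i + 1 - 1) (by ring) _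

/-- The values of the universal point on generators. -/
def univData : FatData V V.T1 where
  onFun₀ := V.T1.funHom
  onFun₁ :=
    { toFun := fun f => V.T1.ofSec (-1) (V.inclForm (VB.d f))
      map_add' := fun f g => toSection_injective fun x => by
        rw [map_add, Pi.add_apply]
        simp only [toSection_inclForm]
        rw [VB.d_add, map_add]
      map_smul' := fun r f => toSection_injective fun x => by
        rw [map_smul, Pi.smul_apply]
        simp only [toSection_inclForm]
        rw [VB.d_smul, map_smul]
        rfl }
  onSec₀ i :=
    { toFun := fun σ => V.T1.ofSec i (V.inclBase i σ)
      map_add' := fun σ τ => toSection_injective fun x => by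
        rw [map_add, Pi.add_apply]
        simp only [toSection_inclBase]
        exact map_add (V.baseGen i x) _ _
      map_smul' := fun r σ => toSection_injective fun x => by
        rw [map_smul, Pi.smul_apply]
        simp only [toSection_inclBase]
        exact map_smul (V.baseGen i x) _ _ }
  onSec₁ := univDer s
  onFun₀_mem := V.T1.ofFun_mem
  onFun₁_mem f := by
    have h := V.T1.ofSec_mem (-1) (V.inclForm (VB.d f))
    rw [neg_neg] at h
    exact h
  onSec₀_mem i σ := V.T1.ofSec_mem i _
  onSec₁_mem i σ := by
    obtain ⟨j, rfl⟩ : ∃ j, j + 1 = i := ⟨i - 1, by ring⟩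
    rw [univDer_add_one, show -(j + 1) + 1 = -j by ring]
    exact univSec_mem s j σ
  onFun₁_mul f g := toSection_injective fun x => by
    change V.T1.toSection (V.T1.ofSec (-1) (V.inclForm (VB.d (f * g)))) x =
      V.T1.toSection (V.T1.ofSec (-1) (V.inclForm (VB.d f)) * V.T1.ofFun g +
        V.T1.ofFun f * V.T1.ofSec (-1) (V.inclForm (VB.d g))) x
    rw [map_add, map_mul, map_mul, Pi.add_apply, Pi.mul_apply, Pi.mul_apply]
    simp only [toSection_inclForm, toSection_ofFun]
    rw [VB.d_mul, map_add, map_smul, map_smul, Algebra.smul_def, Algebra.smul_def,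
      Algebra.commutes (g x), add_comm]
  onSec₀_smul i f σ := toSection_injective fun x => by
    change V.T1.toSection (V.T1.ofSec i (V.inclBase i ((V i).dual.smulSec f σ))) x =
      V.T1.toSection (V.T1.ofFun f * V.T1.ofSec i (V.inclBase i σ)) x
    rw [map_mul, Pi.mul_apply]
    simp only [toSection_inclBase, toSection_ofFun]
    rw [VB.smulSec_apply, map_smul, Algebra.smul_def]
  onSec₁_smul i f σ := by
    obtain ⟨j, rfl⟩ : ∃ j, j + 1 = i := ⟨i - 1, by ring⟩
    rw [univDer_add_one]
    exact univSec_smulSec s j f σ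

/-- The universal point of `T[1]𝔖(V)`. -/
def univPoint : FatPoint V.toGrMfd V.T1.toGrMfd := (univData s).point

theorem univPoint_part₁_ofSec (i : ℤ) (σ : (V (i + 1)).dual.Sec) :
    (univPoint s).part₁ (V.ofSec (i + 1) σ) = univSec s i σ :=
  ((univData s).point_part₁_ofSec (i + 1) σ).trans
    (LinearMap.congr_fun (univDer_add_one s i) σ)

/-- The universal point was defined so that its components are the generators themselves;
`univJetSec` is its jet extension. By naturality, all jet extensions needed elsewhere are obtained
from this one. -/
theorem encodes_univPoint : Encodes s (univPoint s) (𝟙 V.T1.toGrMfd) where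
  on_fun f := ((univData s).point_part₀_ofFun f).symm
  on_base i σ := ((univData s).point_part₀_ofSec i σ).symm
  on_form f := ((univData s).point_part₁_ofFun f).symm
  on_shift i := by
    refine ⟨⟨univJetSec s i, fun f θ => ?_, fun σ => ?_⟩, fun σ => ?_⟩
    · refine toSection_injective fun x => ?_
      have e : (univPoint s).part₀ (V.ofFun f) = V.T1.ofFun f :=
        (univData s).point_part₀_ofFun f
      refine Eq.trans ?_ (congrArg (fun a => V.T1.toSection (a * univJetSec s i θ) x) e).symm
      rw [map_mul, Pi.mul_apply, toSection_univJetSec, toSection_ofFun, ← Algebra.smul_def]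
      exact (toSection_univJetSec s i _ x).trans (map_smul (univJet s i x) _ _)
    · exact (univPoint_part₁_ofSec s i σ).symm
    · refine toSection_injective fun x => ?_
      refine (V.toSection_inclShift i σ x).trans ?_
      have e : V.T1.toSection (univJetSec s i ((s (i + 1)).lift σ)) x = V.shiftGen i x (σ x) :=
        (toSection_univJetSec s i _ x).trans (univJet_app s i x (σ x))
      exact e.symm

variable {s}

/-- The relation between `Ψ` and `χ` is natural in the test object. -/
theorem Encodes.restrict {T T' : GrMfd} {Ψ : FatPoint V.toGrMfd T} {χ : T ⟶ V.T1.toGrMfd}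
    (h : Encodes s Ψ χ) (g : T' ⟶ T) : Encodes s (Ψ.restrict g) (g ≫ χ) where
  on_fun f := (congrArg (GrMfd.pull g) (h.on_fun f)).trans (Ψ.part₀_restrict g _).symm
  on_base i σ := (congrArg (GrMfd.pull g) (h.on_base i σ)).trans (Ψ.part₀_restrict g _).symm
  on_form f := (congrArg (GrMfd.pull g) (h.on_form f)).trans (Ψ.part₁_restrict g _).symm
  on_shift i := by
    obtain ⟨J, hJ⟩ := h.on_shift i
    refine ⟨⟨(GrMfd.pull g).toAlgHom.toLinearMap ∘ₗ J.toLin, fun f θ => ?_, fun σ => ?_⟩,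
      fun σ => congrArg (GrMfd.pull g) (hJ σ)⟩
    · refine ((congrArg (GrMfd.pull g).toAlgHom (J.map_smul f θ)).trans
        (map_mul (GrMfd.pull g).toAlgHom _ _)).trans ?_
      exact congrArg (· * (GrMfd.pull g).toAlgHom (J.toLin θ)) (Ψ.part₀_restrict g _).symm
    · exact (congrArg (GrMfd.pull g) (J.map_jet σ)).trans (Ψ.part₁_restrict g _).symm

end GVB

/-! ### Derivations of the algebra of smooth functions and differential forms -/

namespace Mfd

open VB

theorem Coordinates.eventually_eq {M : Mfd} {x : M} (c : M.Coordinates x) :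
    ∀ᶠ y in 𝓝 x, ∀ α : (VB.tangent M).dual.Sec,
      α y = ∑ l, pairing α (c.vec l) y • d (c.fn l) y := by
  filter_upwards [c.expand] with y hy α
  refine ContinuousLinearMap.ext (f := functional (α y))
    (g := functional (∑ l, pairing α (c.vec l) y • d (c.fn l) y)) fun v => ?_
  have h1 : functional (α y) v = ∑ l, functional (d (c.fn l) y) v * pairing α (c.vec l) y := by
    conv_lhs => rw [hy v]
    rw [map_sum]
    refine Finset.sum_congr rfl fun l _ => ?_
    rw [map_smul]
    rfl
  have h2 : functional (∑ l, pairing α (c.vec l) y • d (c.fn l) y) v =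
      ∑ l, pairing α (c.vec l) y * functional (d (c.fn l) y) v :=
    sum_apply Finset.univ
      (fun l => pairing α (c.vec l) y • functional (d (c.fn l) y)) v
  rw [h1, h2]
  exact Finset.sum_congr rfl fun l _ => mul_comm _ _

end Mfd

namespace VB

variable {M : Mfd}

theorem pairing_add {V : VB M} (α β : V.dual.Sec) (X : V.Sec) :
    pairing (α + β) X = pairing α X + pairing β X := rfl

theorem pairing_smul {V : VB M} (r : ℝ) (α : V.dual.Sec) (X : V.Sec) :
    pairing (r • α) X = r • pairing α X := rfl

theorem pairing_smulSec {V : VB M} (f : M.Fun) (α : V.dual.Sec) (X : V.Sec) :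
    pairing (V.dual.smulSec f α) X = f * pairing α X := rfl

theorem pairing_d_mul (f g : M.Fun) (X : (VB.tangent M).Sec) :
    pairing (d (f * g)) X = f * pairing (d g) X + g * pairing (d f) X := by
  ext x
  change functional (d (f * g) x) (X x) = _
  rw [d_mul]
  rfl

theorem pairing_d_add (f g : M.Fun) (X : (VB.tangent M).Sec) :
    pairing (d (f + g)) X = pairing (d f) X + pairing (d g) X := by
  ext x
  change functional (d (f + g) x) (X x) = _
  rw [d_add]
  rfl

theorem pairing_d_smul (r : ℝ) (f : M.Fun) (X : (VB.tangent M).Sec) :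
    pairing (d (r • f)) X = r • pairing (d f) X := by
  ext x
  change functional (d (r • f) x) (X x) = _
  rw [d_smul]
  rfl

end VB

namespace GVB

open VB

variable {M N : Mfd} {W : GVB N}

instance : IsScalarTower ℝ W.Alg W.Alg := ⟨fun r x y => Algebra.smul_mul_assoc r x y⟩

/-- The value of an element of `Γ(S W*)` at a point. -/
def evalHom (W : GVB N) (y : N) : W.Alg →ₐ[ℝ] W.SFib y := (Pi.evalAlgHom ℝ W.SFib y).comp W.toSection

theorem evalHom_apply (y : N) (a : W.Alg) : W.evalHom y a = W.toSection a y := rfl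

theorem evalHom_injective {a b : W.Alg} (h : ∀ y, W.evalHom y a = W.evalHom y b) : a = b :=
  toSection_injective h

variable (u : M.Fun →ₐ[ℝ] W.Alg)

theorem evalHom_fun_congr {y : N} {f g : M.Fun} (h : ∀ᶠ x in 𝓝 (basePoint u y), f x = g x) :
    W.evalHom y (u f) = W.evalHom y (u g) := by
  obtain ⟨k, h1, h2⟩ := Mfd.exists_bump_mem h
  rw [← sub_eq_zero]
  refine toSection_regular u h1.self_of_nhds ?_
  have e : k * f = k * g := by
    ext x
    by_cases hk : k x = 0
    · simp [hk]
    · simp [h2 x hk]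
  rw [mul_sub, ← evalHom_apply, ← map_mul, ← map_mul, ← map_mul, ← map_mul, e, sub_self]

/-- Global equality follows from equality after multiplication, for each `y`, by the image of a
function with value 1 at the base point of `y`. -/
theorem eq_of_bump {a b : W.Alg}
    (h : ∀ y, ∃ k : M.Fun, k (basePoint u y) = 1 ∧ u k * a = u k * b) : a = b := by
  refine evalHom_injective fun y => ?_
  obtain ⟨k, h1, h2⟩ := h y
  rw [← sub_eq_zero]
  refine toSection_regular u h1 ?_
  have e := congrArg (W.evalHom y) h2
  rw [map_mul, map_mul, ← sub_eq_zero] at e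
  exact (mul_sub _ _ _).trans e

/-- Differentiating `k * (f - g) = 0` gives `u k` times the derivative of `f - g`; the other term
vanishes because `u (f - g)` is already zero at `y`. -/
theorem derivation_congr {y : N} {E : M.Fun →ₗ[ℝ] W.SFib y}
    (hE : ∀ f g, E (f * g) = E f * W.evalHom y (u g) + W.evalHom y (u f) * E g) {f g : M.Fun}
    (h : ∀ᶠ x in 𝓝 (basePoint u y), f x = g x) : E f = E g := by
  obtain ⟨k, h1, h2⟩ := Mfd.exists_bump_mem h
  rw [← sub_eq_zero, ← map_sub]
  refine toSection_regular u h1.self_of_nhds ?_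
  have e : k * (f - g) = 0 := by
    ext x
    by_cases hk : k x = 0
    · simp [hk]
    · simp [h2 x hk]
  have e1 : W.evalHom y (u (f - g)) = 0 := by
    rw [evalHom_fun_congr u (g := 0) (h.mono fun x hx => by simp [hx]), map_zero u, map_zero]
  have e2 := hE k (f - g)
  rw [e, map_zero, e1, mul_zero, zero_add] at e2
  exact e2.symm

theorem derivation_const {y : N} {E : M.Fun →ₗ[ℝ] W.SFib y}
    (hE : ∀ f g, E (f * g) = E f * W.evalHom y (u g) + W.evalHom y (u f) * E g) (r : ℝ) :
    E (algebraMap ℝ _ r) = 0 := by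
  have h1 := hE 1 1
  rw [map_one u, map_one (W.evalHom y), mul_one, mul_one, one_mul] at h1
  rw [Algebra.algebraMap_eq_smul_one, map_smul, left_eq_add.1 h1, smul_zero]

/-- A derivation which vanishes on coordinates is zero. -/
theorem derivation_eq_zero {y : N} {E : M.Fun →ₗ[ℝ] W.SFib y}
    (hE : ∀ f g, E (f * g) = E f * W.evalHom y (u g) + W.evalHom y (u f) * E g)
    (c : M.Coordinates (basePoint u y)) (hc : ∀ l, E (c.fn l) = 0) (f : M.Fun) : E f = 0 := by
  -- Hadamard's coefficients are again arbitrary functions, so the induction on the arity runs over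
  -- all `f`, and each application of the lemma gains one order.
  refine GSym.eq_zero_of_mem_fil _ _ fun k => ?_
  induction k generalizing f with
  | zero => intro j hj; omega
  | succ k ih =>
    obtain ⟨g, hg⟩ := c.hadamard f
    have e : E f = E (algebraMap ℝ _ (f (basePoint u y)) +
        ∑ l, (c.fn l - algebraMap ℝ _ (c.fn l (basePoint u y))) * g l) := by
      refine derivation_congr u hE ?_
      filter_upwards [hg] with x hx
      rw [hx, ContMDiffMap.coe_add, Pi.add_apply]
      congr 1
      exact (map_sum (Mfd.evalAt x) (fun l => (c.fn l - algebraMap ℝ _ (c.fn l (basePoint u y))) * g l) Finset.univ).symm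
    rw [e, map_add, derivation_const u hE, zero_add, map_sum]
    refine sum_mem fun l _ => ?_
    rw [hE, map_sub E, derivation_const u hE, hc, sub_zero, zero_mul, zero_add, add_comm k]
    -- The coordinate minus its value at the base point has augmentation zero under `u`, hence arity
    -- at least 1.
    refine GSym.mul_mem_fil _ _ (GSym.mem_fil_one _ _ ?_) (ih (g l))
    refine (aug_eq_basePoint u y _).trans ?_
    exact sub_self _

/-! ### Extension of derivations to differential forms -/

variable (δ : M.Fun →ₗ[ℝ] W.Alg)

/-- The extension of a derivation to differential forms, in given coordinates. -/
def coordForm {x : M} (c : M.Coordinates x) : (VB.tangent M).dual.Sec →ₗ[ℝ] W.Alg where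
  toFun α := ∑ l, u (pairing α (c.vec l)) * δ (c.fn l)
  map_add' α β := by
    rw [← Finset.sum_add_distrib]
    refine Finset.sum_congr rfl fun l _ => ?_
    rw [pairing_add, map_add, add_mul]
  map_smul' r α := by
    rw [RingHom.id_apply, Finset.smul_sum]
    refine Finset.sum_congr rfl fun l _ => ?_
    rw [pairing_smul, map_smul, smul_mul_assoc]

theorem coordForm_apply {x : M} (c : M.Coordinates x) (α : (VB.tangent M).dual.Sec) :
    coordForm u δ c α = ∑ l, u (pairing α (c.vec l)) * δ (c.fn l) := rfl

theorem coordForm_smulSec {x : M} (c : M.Coordinates x) (f : M.Fun)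
    (α : (VB.tangent M).dual.Sec) :
    coordForm u δ c ((VB.tangent M).dual.smulSec f α) = u f * coordForm u δ c α := by
  rw [coordForm_apply, coordForm_apply, Finset.mul_sum]
  refine Finset.sum_congr rfl fun l _ => ?_
  rw [pairing_smulSec, map_mul, mul_assoc]

variable {δ}

theorem fun_mul_comm {k : ℤ} {a : W.Alg} (hu : ∀ f, u f ∈ sumGrading W.SSec 0) (ha : a ∈ sumGrading W.SSec k) (f : M.Fun) :
    u f * a = a * u f := by
  have := W.alg_comm (hu f) ha
  rwa [zero_mul, zpow_zero, one_smul] at this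

/-- The difference of both sides is a derivation in `f` over `u`. It vanishes on the coordinates
because the vector fields `c.vec` are dual to them near the base point. -/
theorem evalHom_coordForm_d (hu : ∀ f, u f ∈ sumGrading W.SSec 0)
    (hδ : ∀ f g, δ (f * g) = δ f * u g + u f * δ g) (hδ₁ : ∀ f, δ f ∈ sumGrading W.SSec 1) {y : N}
    (c : M.Coordinates (basePoint u y)) (f : M.Fun) :
    W.evalHom y (coordForm u δ c (d f)) = W.evalHom y (δ f) := by
  let E : M.Fun →ₗ[ℝ] W.SFib y := (W.evalHom y).toLinearMap ∘ₗ
    { toFun := fun f => coordForm u δ c (d f)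
      map_add' := fun f g => by
        simp only [coordForm_apply, pairing_d_add, map_add, add_mul, Finset.sum_add_distrib]
      map_smul' := fun r f => by
        simp only [coordForm_apply, pairing_d_smul, map_smul, smul_mul_assoc, Finset.smul_sum,
          RingHom.id_apply] } - (W.evalHom y).toLinearMap ∘ₗ δ
  have hE : ∀ f, E f = W.evalHom y (coordForm u δ c (d f)) - W.evalHom y (δ f) := fun f => rfl
  have hc : ∀ f g, coordForm u δ c (d (f * g)) =
      coordForm u δ c (d f) * u g + u f * coordForm u δ c (d g) := fun f g => by
    simp only [coordForm_apply, pairing_d_mul, map_add, map_mul, Finset.mul_sum, Finset.sum_mul]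
    rw [← Finset.sum_add_distrib]
    refine Finset.sum_congr rfl fun l _ => ?_
    rw [add_mul, add_comm, mul_assoc (u (pairing (d f) (c.vec l))), ← fun_mul_comm u hu (hδ₁ _) g,
      ← mul_assoc, ← map_mul, ← map_mul, mul_comm g, map_mul u f, mul_assoc (u f),
      map_mul u (pairing (d f) (c.vec l))]
  rw [← sub_eq_zero, ← hE]
  refine derivation_eq_zero u (fun f g => ?_) c (fun m => ?_) f
  · rw [hE, hE, hE, hc, hδ, map_add, map_add, map_mul, map_mul, map_mul, map_mul, sub_mul, mul_sub]
    abel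
  · rw [hE, sub_eq_zero, coordForm_apply, map_sum, Finset.sum_eq_single m]
    · have : W.evalHom y (u (pairing (d (c.fn m)) (c.vec m))) = W.evalHom y (u 1) := by
        refine evalHom_fun_congr u ?_
        filter_upwards [c.dual] with x hx
        refine (hx m m).trans ?_
        rw [if_pos rfl]
        rfl
      rw [map_mul, this, map_one u, map_one, one_mul]
    · intro l _ hl
      have : W.evalHom y (u (pairing (d (c.fn m)) (c.vec l))) = W.evalHom y (u 0) := by
        refine evalHom_fun_congr u ?_
        filter_upwards [c.dual] with x hx
        refine (hx m l).trans ?_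
        rw [if_neg hl.symm]
        rfl
      rw [map_mul, this, map_zero u, map_zero, zero_mul]
    · simp

/-- Independence of coordinates: expand `α` in the differentials of `c₀` near the base point and
apply the extension in the coordinates `c`, which is linear over functions and correct on exact
forms. -/
theorem evalHom_coordForm_eq (hu : ∀ f, u f ∈ sumGrading W.SSec 0)
    (hδ : ∀ f g, δ (f * g) = δ f * u g + u f * δ g) (hδ₁ : ∀ f, δ f ∈ sumGrading W.SSec 1) {x₀ : M} {y : N}
    (c₀ : M.Coordinates x₀) (c : M.Coordinates (basePoint u y))
    (h : ∀ᶠ x in 𝓝 (basePoint u y), ∀ α : (VB.tangent M).dual.Sec,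
      α x = ∑ l, pairing α (c₀.vec l) x • d (c₀.fn l) x) (α : (VB.tangent M).dual.Sec) :
    W.evalHom y (coordForm u δ c α) = W.evalHom y (coordForm u δ c₀ α) := by
  have h1 : ∀ l, W.evalHom y (u (pairing α (c.vec l))) = W.evalHom y (u (∑ m,
      pairing α (c₀.vec m) * pairing (d (c₀.fn m)) (c.vec l))) := fun l => by
    refine evalHom_fun_congr u ?_
    filter_upwards [h] with x hx
    have e1 : functional (α x) (c.vec l x) =
        ∑ m, pairing α (c₀.vec m) x * functional (d (c₀.fn m) x) (c.vec l x) := by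
      conv_lhs => rw [hx α]
      exact sum_apply Finset.univ
        (fun m => pairing α (c₀.vec m) x • functional (d (c₀.fn m) x)) _
    refine e1.trans ?_
    exact (map_sum (Mfd.evalAt x) (fun m =>
      pairing α (c₀.vec m) * pairing (d (c₀.fn m)) (c.vec l)) Finset.univ).symm
  have h2 : W.evalHom y (coordForm u δ c₀ α) = ∑ m, W.evalHom y (u (pairing α (c₀.vec m))) *
      W.evalHom y (coordForm u δ c (d (c₀.fn m))) := by
    rw [coordForm_apply, map_sum]
    refine Finset.sum_congr rfl fun m _ => ?_
    rw [map_mul, evalHom_coordForm_d u hu hδ hδ₁]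
  rw [h2, coordForm_apply, map_sum]
  simp only [coordForm_apply, map_sum, map_mul, h1, Finset.sum_mul, Finset.mul_sum]
  rw [Finset.sum_comm]
  simp only [mul_assoc]

/-- The extension of a derivation on functions to differential forms. -/
theorem exists_formExtension (hu : ∀ f, u f ∈ sumGrading W.SSec 0)
    (hδ : ∀ f g, δ (f * g) = δ f * u g + u f * δ g) (hδ₁ : ∀ f, δ f ∈ sumGrading W.SSec 1) :
    ∃ Θ : (VB.tangent M).dual.Sec →ₗ[ℝ] W.Alg, (∀ f, Θ (d f) = δ f) ∧
      (∀ f α, Θ ((VB.tangent M).dual.smulSec f α) = u f * Θ α) ∧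
        ∀ α, Θ α ∈ sumGrading W.SSec 1 := by
  let F : (VB.tangent M).dual.Sec → ∀ y, W.SFib y := fun α y =>
    W.evalHom y (coordForm u δ (M.coordinates (basePoint u y)) α)
  have hm : ∀ {x : M} (c : M.Coordinates x) α, coordForm u δ c α ∈ sumGrading W.SSec 1 :=
    fun c α => by
      refine coordForm_apply u δ c α ▸ sum_mem fun l _ => ?_
      have := SetLike.GradedMul.mul_mem (hu (pairing α (c.vec l))) (hδ₁ (c.fn l))
      rwa [zero_add] at this
  have hF : ∀ α, F α ∈ W.SSec 1 := fun α => by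
    refine ⟨isSmooth_of_local fun y₀ => ?_, fun y => (mem_SSec_of_mem_sumGrading (hm _ α)).2 y⟩
    -- The coordinates in `F` change with `y`; near `y₀` those at the base point of `y₀` give the
    -- same values, and with them fixed the section is smooth.
    refine ⟨W.toSection (coordForm u δ (M.coordinates (basePoint u y₀)) α),
      W.toSection_isSmooth _, ?_⟩
    filter_upwards [(continuous_basePoint u).continuousAt.eventually
      (M.coordinates (basePoint u y₀)).eventually_eq.eventually_nhds] with y hy
    exact evalHom_coordForm_eq u hu hδ hδ₁ _ _ hy α
  have hv : ∀ α y, W.evalHom y (W.ofSection 1 ⟨F α, hF α⟩) = F α y := fun α y =>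
    congrFun (W.toSection_lof 1 _) y
  refine ⟨
    { toFun := fun α => W.ofSection 1 ⟨F α, hF α⟩
      map_add' := fun α β => evalHom_injective fun y => by
        rw [map_add (W.evalHom y), hv, hv, hv]
        exact (congrArg (W.evalHom y) (map_add _ _ _)).trans (map_add (W.evalHom y) _ _)
      map_smul' := fun r α => evalHom_injective fun y => by
        rw [RingHom.id_apply, map_smul (W.evalHom y), hv, hv]
        exact (congrArg (W.evalHom y) (map_smul _ _ _)).trans (map_smul (W.evalHom y) _ _) },
    fun f => ?_, fun f α => ?_, fun α => ⟨_, rfl⟩⟩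
  · exact evalHom_injective fun y => (hv _ y).trans (evalHom_coordForm_d u hu hδ hδ₁ _ f)
  · refine evalHom_injective fun y => (hv _ y).trans ?_
    change W.evalHom y (coordForm u δ _ _) = W.evalHom y (u f * W.ofSection 1 ⟨F α, hF α⟩)
    rw [map_mul, hv, coordForm_smulSec, map_mul]

end GVB

/-! ### Morphisms out of `Γ(S (V ⊕ T[1]M ⊕ V[1])*)` -/

namespace VB.Hom

variable {M : Mfd}

/-- Inclusion of the first summand of a direct sum. -/
def inl (V W : VB M) : Hom V (V.sum W) ContMDiffMap.id where
  app := fun x => ContinuousLinearMap.inl ℝ (V.fib x) (W.fib x)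
  smooth := by
    intro p
    have h := Bundle.contMDiffAt_totalSpace.1
      (contMDiffAt_id (I := (𝓡 M.dim).prod 𝓘(ℝ, V.F)) (n := ∞) (x := p))
    have hz : ContMDiff ((𝓡 M.dim).prod 𝓘(ℝ, V.F)) ((𝓡 M.dim).prod 𝓘(ℝ, W.F)) ∞
        (fun p : V.Tot => (⟨p.1, 0⟩ : W.Tot)) :=
      (Bundle.contMDiff_zeroSection ℝ W.fib).comp (Bundle.contMDiff_proj V.fib)
    have h' := Bundle.contMDiffAt_totalSpace.1 (hz p)
    exact Bundle.contMDiffAt_totalSpace.2 ⟨h.1, h.2.prodMk_space h'.2⟩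

/-- Inclusion of the second summand of a direct sum. -/
def inr (V W : VB M) : Hom W (V.sum W) ContMDiffMap.id where
  app := fun x => ContinuousLinearMap.inr ℝ (V.fib x) (W.fib x)
  smooth := by
    intro p
    have h := Bundle.contMDiffAt_totalSpace.1
      (contMDiffAt_id (I := (𝓡 M.dim).prod 𝓘(ℝ, W.F)) (n := ∞) (x := p))
    have hz : ContMDiff ((𝓡 M.dim).prod 𝓘(ℝ, W.F)) ((𝓡 M.dim).prod 𝓘(ℝ, V.F)) ∞
        (fun p : W.Tot => (⟨p.1, 0⟩ : V.Tot)) :=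
      (Bundle.contMDiff_zeroSection ℝ V.fib).comp (Bundle.contMDiff_proj W.fib)
    have h' := Bundle.contMDiffAt_totalSpace.1 (hz p)
    exact Bundle.contMDiffAt_totalSpace.2 ⟨h.1, h'.2.prodMk_space h.2⟩

variable {V W : VB M}

theorem inl_fst (σ : V.dual.Sec) : (inl V W).pullSec ((fst V W).pullSec σ) = σ := by
  ext x : 1
  exact ContinuousLinearMap.ext (f := functional (σ x)) fun v => rfl

theorem inl_snd (σ : W.dual.Sec) : (inl V W).pullSec ((snd V W).pullSec σ) = 0 := by
  ext x : 1
  exact ContinuousLinearMap.ext (g := 0) fun v => map_zero (functional (σ x))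

theorem inr_fst (σ : V.dual.Sec) : (inr V W).pullSec ((fst V W).pullSec σ) = 0 := by
  ext x : 1
  exact ContinuousLinearMap.ext (g := 0) fun v => map_zero (functional (σ x))

theorem inr_snd (σ : W.dual.Sec) : (inr V W).pullSec ((snd V W).pullSec σ) = σ := by
  ext x : 1
  exact ContinuousLinearMap.ext (f := functional (σ x)) fun v => rfl

theorem fst_inl_add_snd_inr (τ : (V.sum W).dual.Sec) :
    (fst V W).pullSec ((inl V W).pullSec τ) + (snd V W).pullSec ((inr V W).pullSec τ) = τ := by
  ext x : 1
  refine ContinuousLinearMap.ext (g := functional (τ x)) fun v => ?_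
  refine (map_add (functional (τ x)) _ _).symm.trans (congrArg (functional (τ x)) ?_)
  exact Prod.fst_add_snd v

end VB.Hom

namespace GVB

variable {M N : Mfd} {V : GVB M} {W : GVB N}

theorem shiftedTangent_dual_eq_zero : ∀ {i : ℤ}, i ≠ -1 → ∀ σ : (shiftedTangent M i).dual.Sec, σ = 0
  | Int.negSucc 0, h, _ => (h rfl).elim
  | Int.negSucc (n + 1), _, σ => by
    ext x : 1
    exact ContinuousLinearMap.ext (f := VB.functional (σ x)) (g := 0) fun v =>
      map_zero (VB.functional (σ x))
  | Int.ofNat n, _, σ => by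
    ext x : 1
    exact ContinuousLinearMap.ext (f := VB.functional (σ x)) (g := 0) fun v =>
      map_zero (VB.functional (σ x))

/-- A map on differential forms, extended by zero to the other degrees. -/
def formFamily {A : Type} [AddCommMonoid A] [Module ℝ A] (Θ : (VB.tangent M).dual.Sec →ₗ[ℝ] A) :
    ∀ i, (shiftedTangent M i).dual.Sec →ₗ[ℝ] A
  | Int.negSucc 0 => Θ
  | Int.negSucc (_ + 1) => 0
  | Int.ofNat _ => 0

variable (V) in
/-- The map on sections of the dual of `V ⊕ T[1]M ⊕ V[1]` with given restrictions. -/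
def sumFamily {A : Type} [AddCommMonoid A] [Module ℝ A] (gB : ∀ i, (V i).dual.Sec →ₗ[ℝ] A)
    (Θ : (VB.tangent M).dual.Sec →ₗ[ℝ] A) (gS : ∀ i, (V (i + 1)).dual.Sec →ₗ[ℝ] A) (i : ℤ) :
    (V.T1 i).dual.Sec →ₗ[ℝ] A :=
  gB i ∘ₗ (VB.Hom.inl (V i) ((shiftedTangent M i).sum (V (i + 1)))).pullSecₗ +
    (formFamily Θ i ∘ₗ (VB.Hom.inl (shiftedTangent M i) (V (i + 1))).pullSecₗ +
      gS i ∘ₗ (VB.Hom.inr (shiftedTangent M i) (V (i + 1))).pullSecₗ) ∘ₗ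
      (VB.Hom.inr (V i) ((shiftedTangent M i).sum (V (i + 1)))).pullSecₗ

section

variable {A : Type} [AddCommMonoid A] [Module ℝ A] (gB : ∀ i, (V i).dual.Sec →ₗ[ℝ] A)
    (Θ : (VB.tangent M).dual.Sec →ₗ[ℝ] A) (gS : ∀ i, (V (i + 1)).dual.Sec →ₗ[ℝ] A)

theorem sumFamily_apply (i : ℤ) (τ : (V.T1 i).dual.Sec) : sumFamily V gB Θ gS i τ =
    gB i ((VB.Hom.inl (V i) _).pullSec τ) +
      (formFamily Θ i ((VB.Hom.inl _ _).pullSec ((VB.Hom.inr (V i) _).pullSec τ)) +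
        gS i ((VB.Hom.inr (shiftedTangent M i) _).pullSec ((VB.Hom.inr (V i) _).pullSec τ))) := rfl

theorem pullSec_zero {X Y : VB M} (L : VB.Hom X Y ContMDiffMap.id) : L.pullSec 0 = 0 :=
  map_zero L.pullSecₗ

theorem sumFamily_base (i : ℤ) (σ : (V i).dual.Sec) :
    sumFamily V gB Θ gS i (V.inclBase i σ) = gB i σ := by
  rw [sumFamily_apply, inclBase, VB.Hom.inl_fst, VB.Hom.inr_fst, pullSec_zero, pullSec_zero,
    map_zero, map_zero, add_zero, add_zero]

theorem sumFamily_form (α : (VB.tangent M).dual.Sec) :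
    sumFamily V gB Θ gS (-1) (V.inclForm α) = Θ α := by
  rw [sumFamily_apply, inclForm, VB.Hom.inl_snd, VB.Hom.inr_snd, map_zero, zero_add]
  have h1 := VB.Hom.inl_fst (V := shiftedTangent M (-1)) (W := V (-1 + 1)) α
  have h2 := VB.Hom.inr_fst (V := shiftedTangent M (-1)) (W := V (-1 + 1)) α
  refine (congrArg₂ (fun a b => formFamily Θ (-1) a + gS (-1) b) h1 h2).trans ?_
  rw [map_zero, add_zero]
  rfl

theorem sumFamily_shift (i : ℤ) (σ : (V (i + 1)).dual.Sec) :
    sumFamily V gB Θ gS i (V.inclShift i σ) = gS i σ := by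
  rw [sumFamily_apply, inclShift, VB.Hom.inl_snd, VB.Hom.inr_snd, VB.Hom.inl_snd, VB.Hom.inr_snd,
    map_zero, map_zero, zero_add, zero_add]

end

/-- Morphisms out of `Γ(S (V ⊕ T[1]M ⊕ V[1])*)` are given by their values on functions and on sections
of the three summands. -/
theorem exists_algHom_T1 (u : M.Fun →ₐ[ℝ] W.Alg) (hu : ∀ f, u f ∈ sumGrading W.SSec 0)
    (gB : ∀ i, (V i).dual.Sec →ₗ[ℝ] W.Alg) (hB : ∀ i σ, gB i σ ∈ sumGrading W.SSec (-i))
    (hBu : ∀ i f σ, gB i ((V i).dual.smulSec f σ) = u f * gB i σ)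
    (Θ : (VB.tangent M).dual.Sec →ₗ[ℝ] W.Alg) (hΘ : ∀ α, Θ α ∈ sumGrading W.SSec 1)
    (hΘu : ∀ f α, Θ ((VB.tangent M).dual.smulSec f α) = u f * Θ α)
    (gS : ∀ i, (V (i + 1)).dual.Sec →ₗ[ℝ] W.Alg) (hS : ∀ i σ, gS i σ ∈ sumGrading W.SSec (-i))
    (hSu : ∀ i f σ, gS i ((V (i + 1)).dual.smulSec f σ) = u f * gS i σ) :
    ∃ χ : sumGrading V.T1.SSec →ₐᵍ[ℝ] sumGrading W.SSec,
      (∀ f, χ (V.T1.ofFun f) = u f) ∧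
      (∀ i σ, χ (V.T1.ofSec i (V.inclBase i σ)) = gB i σ) ∧
      (∀ α, χ (V.T1.ofSec (-1) (V.inclForm α)) = Θ α) ∧
      ∀ i σ, χ (V.T1.ofSec i (V.inclShift i σ)) = gS i σ := by
  have hF : ∀ i σ, formFamily Θ i σ ∈ sumGrading W.SSec (-i)
    | Int.negSucc 0, σ => hΘ σ
    | Int.negSucc (n + 1), σ => zero_mem _
    | Int.ofNat n, σ => zero_mem _
  have hFu : ∀ i f σ, formFamily Θ i ((shiftedTangent M i).dual.smulSec f σ) =
      u f * formFamily Θ i σ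
    | Int.negSucc 0, f, σ => hΘu f σ
    | Int.negSucc (n + 1), f, σ => (mul_zero _).symm
    | Int.ofNat n, f, σ => (mul_zero _).symm
  let g : ∀ i, (V.T1 i).dual.Sec →ₗ[ℝ] W.Alg := sumFamily V gB Θ gS
  have hg : ∀ i τ, g i τ = _ := sumFamily_apply gB Θ gS
  obtain ⟨χ, h1, h2⟩ := exists_algHom (V := V.T1) u hu g
    (fun i τ => add_mem (hB i _) (add_mem (hF i _) (hS i _)))
    (fun i f τ => by
      rw [hg, hg, mul_add, mul_add, ← hBu, ← hFu, ← hSu]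
      rfl)
  exact ⟨χ, h1, fun i σ => (h2 i _).trans (sumFamily_base gB Θ gS i σ),
    fun α => (h2 _ _).trans (sumFamily_form gB Θ gS α),
    fun i σ => (h2 i _).trans (sumFamily_shift gB Θ gS i σ)⟩

/-- A section of the dual of a direct sum is the sum of its restrictions to the summands. The middle
summand has nonzero sections only in degree −1, where they are differential forms. -/
theorem algHom_T1_ext {χ χ' : V.T1.Alg →ₐ[ℝ] W.Alg}
    (hf : ∀ f, χ (V.T1.ofFun f) = χ' (V.T1.ofFun f))
    (hB : ∀ i σ, χ (V.T1.ofSec i (V.inclBase i σ)) = χ' (V.T1.ofSec i (V.inclBase i σ)))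
    (hF : ∀ α, χ (V.T1.ofSec (-1) (V.inclForm α)) = χ' (V.T1.ofSec (-1) (V.inclForm α)))
    (hS : ∀ i σ, χ (V.T1.ofSec i (V.inclShift i σ)) = χ' (V.T1.ofSec i (V.inclShift i σ))) :
    χ = χ' := by
  have hT : ∀ i (σ : (shiftedTangent M i).dual.Sec),
      χ (V.T1.ofSec i ((VB.Hom.snd _ _).pullSec ((VB.Hom.fst _ (V (i + 1))).pullSec σ))) =
        χ' (V.T1.ofSec i ((VB.Hom.snd _ _).pullSec ((VB.Hom.fst _ (V (i + 1))).pullSec σ))) := by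
    intro i σ
    by_cases hi : i = -1
    · subst hi
      exact hF σ
    · rw [shiftedTangent_dual_eq_zero hi σ, pullSec_zero, pullSec_zero]
      have hz : V.T1.ofSec i 0 = 0 := map_zero (V.T1.secHom i)
      exact (congrArg χ hz).trans
        ((map_zero χ).trans ((congrArg χ' hz).trans (map_zero χ')).symm)
  refine algHom_ext hf fun i τ => ?_
  have e : V.T1.ofSec i τ = V.T1.ofSec i (V.inclBase i ((VB.Hom.inl (V i) _).pullSec τ)) +
      (V.T1.ofSec i ((VB.Hom.snd _ _).pullSec ((VB.Hom.fst _ (V (i + 1))).pullSec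
        ((VB.Hom.inl _ _).pullSec ((VB.Hom.inr (V i) _).pullSec τ)))) +
      V.T1.ofSec i (V.inclShift i ((VB.Hom.inr (shiftedTangent M i) _).pullSec
        ((VB.Hom.inr (V i) _).pullSec τ)))) := by
    have e1 := VB.Hom.fst_inl_add_snd_inr τ
    have e2 := VB.Hom.fst_inl_add_snd_inr (V := shiftedTangent M i) (W := V (i + 1))
      ((VB.Hom.inr (V i) _).pullSec τ)
    rw [← e2] at e1
    have e3 := congrArg (V.T1.secHom i) e1
    refine e3.symm.trans ((map_add (V.T1.secHom i) _ _).trans ?_)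
    exact congrArg (V.T1.secHom i (V.inclBase i ((VB.Hom.inl (V i) _).pullSec τ)) + ·)
      (map_add (V.T1.secHom i ∘ₗ (VB.Hom.snd (V i) _).pullSecₗ) _ _)
  rw [e, map_add, map_add, map_add, map_add, hB, hT, hS]

end GVB

/-! ### Points and the morphisms encoding them -/

namespace GVB

open VB

variable {M N : Mfd} {V : GVB M} {W : GVB N}

section Point

variable (Ψ : FatPoint V.toGrMfd W.toGrMfd)

/-- The part `Ψ₀`, as a morphism of algebras of sections. -/
def pointHom : V.Alg →ₐ[ℝ] W.Alg := Ψ.part₀Hom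

/-- The part `Ψ₁`, as a map of algebras of sections. -/
def pointDer : V.Alg →ₗ[ℝ] W.Alg := Ψ.part₁

/-- The part `Ψ₀` on functions. -/
def pointFun : M.Fun →ₐ[ℝ] W.Alg := (pointHom Ψ).comp V.funHom

theorem pointHom_mem {k : ℤ} {a : V.Alg} (ha : a ∈ sumGrading V.SSec k) :
    pointHom Ψ a ∈ sumGrading W.SSec k := Ψ.part₀_mem ha

theorem pointDer_mem {k : ℤ} {a : V.Alg} (ha : a ∈ sumGrading V.SSec k) :
    pointDer Ψ a ∈ sumGrading W.SSec (k + 1) := Ψ.part₁_mem ha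

theorem pointFun_mem (f : M.Fun) : pointFun Ψ f ∈ sumGrading W.SSec 0 :=
  pointHom_mem Ψ (V.ofFun_mem f)

theorem pointDer_mul (f : M.Fun) (a : V.Alg) :
    pointDer Ψ (V.ofFun f * a) =
      pointDer Ψ (V.ofFun f) * pointHom Ψ a + pointFun Ψ f * pointDer Ψ a := by
  have h := Ψ.part₁_mul (V.ofFun_mem f) a
  rw [zpow_zero, one_smul] at h
  exact h

end Point

/-- A point is determined by its values on functions and sections. -/
theorem point_ext {Ψ Ψ' : FatPoint V.toGrMfd W.toGrMfd}
    (hf₀ : ∀ f, Ψ.part₀ (V.ofFun f) = Ψ'.part₀ (V.ofFun f))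
    (hs₀ : ∀ i σ, Ψ.part₀ (V.ofSec i σ) = Ψ'.part₀ (V.ofSec i σ))
    (hf₁ : ∀ f, Ψ.part₁ (V.ofFun f) = Ψ'.part₁ (V.ofFun f))
    (hs₁ : ∀ i σ, Ψ.part₁ (V.ofSec i σ) = Ψ'.part₁ (V.ofSec i σ)) : Ψ = Ψ' := by
  have h₀ : pointHom Ψ = pointHom Ψ' := algHom_ext hf₀ hs₀
  have hq : ∀ q ∈ V.polys, pointDer Ψ q = pointDer Ψ' q := fun q hq =>
    congrArg W.toGrMfd.comp₁ (eqOn_polys (χ := Ψ.hom) (χ' := Ψ'.hom)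
      (fun f => GrMfd.fat_ext (hf₀ f) (hf₁ f)) (fun i σ => GrMfd.fat_ext (hs₀ i σ) (hs₁ i σ)) hq)
  refine FatPoint.ext_parts (fun a => AlgHom.congr_fun h₀ a) fun a => ?_
  refine eq_of_bump (pointFun Ψ) (a := pointDer Ψ a) (b := pointDer Ψ' a) fun y => ?_
  obtain ⟨k, q, h1, hqp, e⟩ := V.exists_bump_mul_eq a (basePoint (pointFun Ψ) y)
  refine ⟨k, h1, ?_⟩
  -- The second part is not multiplicative, so the relation between `a` and the polynomial `q` is
  -- differentiated. The terms with the derivative of `k` agree and cancel, leaving the derivatives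
  -- multiplied by `k`.
  have e1 := pointDer_mul Ψ k a
  have e2 := pointDer_mul Ψ' k a
  have e3 := pointDer_mul Ψ k q
  have e4 := pointDer_mul Ψ' k q
  have e5 : pointDer Ψ (V.ofFun k) = pointDer Ψ' (V.ofFun k) := hf₁ k
  have e6 : pointFun Ψ k = pointFun Ψ' k := hf₀ k
  rw [e, e3] at e1
  rw [e, e4, ← hq q hqp, ← h₀, ← e5, ← e6] at e2
  have e7 := e1.symm.trans e2
  refine evalHom_injective fun y => ?_
  have e8 := congrArg (W.evalHom y) e7
  rw [map_add, map_add] at e8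
  exact add_left_cancel e8

variable {u : M.Fun →ₐ[ℝ] W.Alg}

/-- A function-linear map on differential forms is determined by its values on exact forms. -/
theorem form_ext {Θ Θ' : (VB.tangent M).dual.Sec →ₗ[ℝ] W.Alg}
    (hΘ : ∀ f α, Θ ((VB.tangent M).dual.smulSec f α) = u f * Θ α)
    (hΘ' : ∀ f α, Θ' ((VB.tangent M).dual.smulSec f α) = u f * Θ' α)
    (h : ∀ f, Θ (d f) = Θ' (d f)) (α : (VB.tangent M).dual.Sec) : Θ α = Θ' α := by
  refine eq_of_bump u fun y => ?_
  let c := M.coordinates (basePoint u y)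
  obtain ⟨k, h1, h2⟩ := Mfd.exists_bump_mem c.eventually_eq
  have e : (VB.tangent M).dual.smulSec k α =
      ∑ l, (VB.tangent M).dual.smulSec (k * pairing α (c.vec l)) (d (c.fn l)) := by
    ext x : 1
    have hsum : (∑ l, (VB.tangent M).dual.smulSec (k * pairing α (c.vec l)) (d (c.fn l))) x =
        ∑ l, k x • (pairing α (c.vec l) x • d (c.fn l) x) :=
      (map_sum ((VB.tangent M).dual.evalSec x) _ _).trans
        (Finset.sum_congr rfl fun l _ => mul_smul (k x) (pairing α (c.vec l) x) (d (c.fn l) x))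
    rw [hsum, ← Finset.smul_sum]
    by_cases hk : k x = 0
    · rw [VB.smulSec_apply, hk, zero_smul, zero_smul]
    · rw [← h2 x hk α]
      rfl
  refine ⟨k, h1.self_of_nhds, ?_⟩
  rw [← hΘ, ← hΘ', e, map_sum, map_sum]
  exact Finset.sum_congr rfl fun l _ => by rw [hΘ, hΘ', h]

/-- The extension of a first order operator to sections of the jet bundle is unique. -/
theorem jetExtension_ext {X : VB M} {D : X.Sec → W.Alg} (J J' : X.JetExtension u D)
    (θ : X.JetSec) : J.toLin θ = J'.toLin θ := by
  refine eq_of_bump u fun y => ?_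
  obtain ⟨U, hU, n, g, τ, hτ⟩ := θ.2 (basePoint u y)
  obtain ⟨k, h1, h2⟩ := Mfd.exists_bump_mem hU
  have e : X.smulJet k θ = ∑ l, X.smulJet (k * g l) (X.jetSec (τ l)) := by
    refine Subtype.ext (funext fun x => ?_)
    have hsum : (∑ l, X.smulJet (k * g l) (X.jetSec (τ l))).1 x =
        ∑ l, k x • (g l x • X.jet x (τ l)) :=
      (map_sum (LinearMap.proj x ∘ₗ X.JetSec.subtype) _ _).trans
        (Finset.sum_congr rfl fun l _ => mul_smul (k x) (g l x) (X.jet x (τ l)))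
    rw [hsum, ← Finset.smul_sum]
    change k x • θ.1 x = _
    by_cases hk : k x = 0
    · rw [hk, zero_smul, zero_smul]
    · rw [hτ x (h2 x hk)]
  refine ⟨k, h1.self_of_nhds, ?_⟩
  rw [← J.map_smul, ← J'.map_smul, e, map_sum, map_sum]
  exact Finset.sum_congr rfl fun l _ => by rw [J.map_smul, J'.map_smul, J.map_jet, J'.map_jet]

/-- Differential forms in `Γ(S (V ⊕ T[1]M ⊕ V[1])*)`, linearly. -/
def formHom (V : GVB M) : (VB.tangent M).dual.Sec →ₗ[ℝ] V.T1.Alg where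
  toFun α := V.T1.ofSec (-1) (V.inclForm α)
  map_add' α β := map_add (V.T1.secHom (-1)) (V.inclForm α) (V.inclForm β)
  map_smul' r α := map_smul (V.T1.secHom (-1)) r (V.inclForm α)

theorem formHom_smulSec (f : M.Fun) (α : (VB.tangent M).dual.Sec) :
    formHom V ((VB.tangent M).dual.smulSec f α) = V.T1.ofFun f * formHom V α :=
  V.T1.ofSec_smulSec (-1) f (V.inclForm α)

variable {s : V.DualConnection}

/-- The morphism encoding a point is unique. -/
theorem Encodes.unique {Ψ : FatPoint V.toGrMfd W.toGrMfd} {χ χ' : W.toGrMfd ⟶ V.T1.toGrMfd}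
    (h : Encodes s Ψ χ) (h' : Encodes s Ψ χ') : χ = χ' := by
  let η : V.T1.Alg →ₐ[ℝ] W.Alg := (GrMfd.pull χ).toAlgHom
  let η' : V.T1.Alg →ₐ[ℝ] W.Alg := (GrMfd.pull χ').toAlgHom
  have hf : ∀ f, η (V.T1.ofFun f) = pointFun Ψ f := h.on_fun
  have hf' : ∀ f, η' (V.T1.ofFun f) = pointFun Ψ f := h'.on_fun
  have key : η = η' := by
    refine algHom_T1_ext (fun f => (hf f).trans (hf' f).symm)
      (fun i σ => (h.on_base i σ).trans (h'.on_base i σ).symm) (fun α => ?_) fun i σ => ?_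
    · refine form_ext (u := pointFun Ψ) (Θ := η.toLinearMap ∘ₗ formHom V)
        (Θ' := η'.toLinearMap ∘ₗ formHom V) (fun f α => ?_) (fun f α => ?_)
        (fun f => (h.on_form f).trans (h'.on_form f).symm) α
      · rw [← hf]
        exact (congrArg η (formHom_smulSec f α)).trans (map_mul η _ _)
      · rw [← hf']
        exact (congrArg η' (formHom_smulSec f α)).trans (map_mul η' _ _)
    · obtain ⟨J, hJ⟩ := h.on_shift i
      obtain ⟨J', hJ'⟩ := h'.on_shift i
      refine (hJ σ).trans (Eq.trans ?_ (hJ' σ).symm)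
      exact jetExtension_ext (u := pointFun Ψ) J J' _
  have : (GrMfd.pull χ) = GrMfd.pull χ' := by
    ext a
    exact AlgHom.congr_fun key a
  exact this

theorem noShift_congr {χ χ' : V.T1.Alg →ₐ[ℝ] W.Alg}
    (hf : ∀ f, χ (V.T1.ofFun f) = χ' (V.T1.ofFun f))
    (hB : ∀ i σ, χ (V.T1.ofSec i (V.inclBase i σ)) = χ' (V.T1.ofSec i (V.inclBase i σ)))
    (hF : ∀ f, χ (V.T1.ofSec (-1) (V.inclForm (d f))) = χ' (V.T1.ofSec (-1) (V.inclForm (d f))))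
    {q : V.T1.Alg} (hq : q ∈ V.noShift) : χ q = χ' q := by
  have h : V.noShift ≤ AlgHom.equalizer χ χ' := by
    refine Algebra.adjoin_le ?_
    rintro _ ((⟨f, rfl⟩ | ⟨f, rfl⟩) | h)
    · exact hf f
    · exact hF f
    · obtain ⟨i, σ, rfl⟩ := Set.mem_iUnion.1 h
      exact hB i σ
  exact h hq

theorem exists_bump_univSec (i : ℤ) (τ : (V (i + 1)).dual.Sec) (x : M) :
    ∃ (k : M.Fun) (q : V.T1.Alg), k x = 1 ∧ q ∈ V.noShift ∧ V.T1.ofFun k * univSec s i τ =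
      V.T1.ofFun k * (V.T1.ofSec i (V.inclShift i τ) + q) := by
  obtain ⟨q, hq, he⟩ := exists_univJet_eq s i τ x
  obtain ⟨k, h1, h2⟩ := Mfd.exists_bump_mem he
  refine ⟨k, q, h1.self_of_nhds, hq, toSection_injective fun y => ?_⟩
  rw [map_mul, map_mul, Pi.mul_apply, Pi.mul_apply, toSection_univSec, toSection_ofFun]
  by_cases hk : k y = 0
  · rw [hk, map_zero, zero_mul, zero_mul]
  · rw [h2 y hk]

theorem restrict_univPoint_eq (s : V.DualConnection) {Ψ : FatPoint V.toGrMfd W.toGrMfd}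
    {χ : sumGrading V.T1.SSec →ₐᵍ[ℝ] sumGrading W.SSec}
    (hf : ∀ f, χ (V.T1.ofFun f) = pointFun Ψ f)
    (hB : ∀ i σ, χ (V.T1.ofSec i (V.inclBase i σ)) = pointHom Ψ (V.ofSec i σ))
    (hF : ∀ f, χ (V.T1.ofSec (-1) (V.inclForm (d f))) = pointDer Ψ (V.ofFun f))
    (hU : ∀ i σ, χ (univSec s i σ) = pointDer Ψ (V.ofSec (i + 1) σ)) :
    (univPoint s).restrict (T' := W.toGrMfd) (T := V.T1.toGrMfd) χ = Ψ := by
  have r₀ : ∀ {a : V.Alg} {b : V.T1.Alg} {c : W.Alg}, pointHom (univPoint s) a = b → χ b = c →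
      pointHom ((univPoint s).restrict (T' := W.toGrMfd) (T := V.T1.toGrMfd) χ) a = c := by
    rintro a b c rfl rfl
    exact (univPoint s).part₀_restrict (T' := W.toGrMfd) (T := V.T1.toGrMfd) χ a
  have r₁ : ∀ {a : V.Alg} {b : V.T1.Alg} {c : W.Alg}, pointDer (univPoint s) a = b → χ b = c →
      pointDer ((univPoint s).restrict (T' := W.toGrMfd) (T := V.T1.toGrMfd) χ) a = c := by
    rintro a b c rfl rfl
    exact (univPoint s).part₁_restrict (T' := W.toGrMfd) (T := V.T1.toGrMfd) χ a
  refine point_ext (fun f => ?_) (fun i σ => ?_) (fun f => ?_) fun i σ => ?_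
  · exact r₀ ((univData s).point_part₀_ofFun f) (hf f)
  · exact r₀ ((univData s).point_part₀_ofSec i σ) (hB i σ)
  · exact r₁ ((univData s).point_part₁_ofFun f) (hF f)
  · obtain ⟨j, rfl⟩ : ∃ j, j + 1 = i := ⟨i - 1, by ring⟩
    exact r₁ (univPoint_part₁_ofSec s j σ) (hU j σ)

/-- Every point is a restriction of the universal one. -/
theorem exists_eq_restrict (s : V.DualConnection) (Ψ : FatPoint V.toGrMfd W.toGrMfd) :
    ∃ χ : W.toGrMfd ⟶ V.T1.toGrMfd, (univPoint s).restrict χ = Ψ := by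
  have hδ : ∀ f g, (pointDer Ψ ∘ₗ V.funHom.toLinearMap) (f * g) =
      (pointDer Ψ ∘ₗ V.funHom.toLinearMap) f * pointFun Ψ g +
        pointFun Ψ f * (pointDer Ψ ∘ₗ V.funHom.toLinearMap) g := fun f g =>
    (congrArg (pointDer Ψ) (map_mul V.funHom f g)).trans (pointDer_mul Ψ f (V.ofFun g))
  have hδ₁ : ∀ f, (pointDer Ψ ∘ₗ V.funHom.toLinearMap) f ∈ sumGrading W.SSec 1 := fun f => by
    have := pointDer_mem Ψ (V.ofFun_mem f)
    rwa [zero_add] at this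
  obtain ⟨Θ, hΘd, hΘu, hΘ⟩ := exists_formExtension (pointFun Ψ) (pointFun_mem Ψ) hδ hδ₁
  have hBu : ∀ i f σ, (pointHom Ψ).toLinearMap.comp (V.secHom i) ((V i).dual.smulSec f σ) =
      pointFun Ψ f * (pointHom Ψ).toLinearMap.comp (V.secHom i) σ := fun i f σ =>
    (congrArg (pointHom Ψ) (V.ofSec_smulSec i f σ)).trans (map_mul (pointHom Ψ) _ _)
  -- An auxiliary morphism, zero on the shifted generators: it maps the universal derivative [τ] +
  -- ∇τ to the image of ∇τ, which the functions, forms and sections of V* already determine.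
  obtain ⟨χ', h'f, h'B, h'F, h'S⟩ := exists_algHom_T1 (pointFun Ψ) (pointFun_mem Ψ)
    (fun i => (pointHom Ψ).toLinearMap.comp (V.secHom i))
    (fun i σ => pointHom_mem Ψ (V.ofSec_mem i σ)) hBu Θ hΘ hΘu (fun i => 0) (fun i σ => zero_mem _)
    (fun i f σ => (mul_zero _).symm)
  -- The value on [τ] is forced: Ψ₁τ minus the image of ∇τ. The two terms have the same Leibniz
  -- defect, so the difference is linear over functions.
  let gS : ∀ i, (V (i + 1)).dual.Sec →ₗ[ℝ] W.Alg := fun i =>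
    (pointDer Ψ).comp (V.secHom (i + 1)) + (-1 : ℝ) • χ'.toAlgHom.toLinearMap.comp (univSec s i)
  have hgS : ∀ i σ, gS i σ = pointDer Ψ (V.ofSec (i + 1) σ) + (-1 : ℝ) • χ' (univSec s i σ) :=
    fun i σ => rfl
  have hSu : ∀ i f σ, gS i ((V (i + 1)).dual.smulSec f σ) = pointFun Ψ f * gS i σ := by
    intro i f σ
    have e1 : χ' (univSec s i ((V (i + 1)).dual.smulSec f σ)) =
        pointDer Ψ (V.ofFun f) * pointHom Ψ (V.ofSec (i + 1) σ) +
          pointFun Ψ f * χ' (univSec s i σ) := by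
      refine (congrArg χ'.toAlgHom (univSec_smulSec s i f σ)).trans ?_
      refine (map_add χ'.toAlgHom _ _).trans
        (congrArg₂ (· + ·) ((map_mul χ'.toAlgHom _ _).trans ?_) ((map_mul χ'.toAlgHom _ _).trans ?_))
      · exact congrArg₂ (· * ·) ((h'F _).trans (hΘd f)) (h'B _ _)
      · exact congrArg (· * _) (h'f f)
    have e2 : pointDer Ψ (V.ofSec (i + 1) ((V (i + 1)).dual.smulSec f σ)) =
        pointDer Ψ (V.ofFun f) * pointHom Ψ (V.ofSec (i + 1) σ) +
          pointFun Ψ f * pointDer Ψ (V.ofSec (i + 1) σ) :=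
      (congrArg (pointDer Ψ) (V.ofSec_smulSec (i + 1) f σ)).trans (pointDer_mul Ψ f _)
    refine evalHom_injective fun y => ?_
    rw [hgS, hgS, e1, e2]
    simp only [map_add, map_mul, map_smul]
    simp only [neg_one_smul, mul_add, mul_neg]
    abel
  obtain ⟨χ, hf, hB, hF, hS⟩ := exists_algHom_T1 (pointFun Ψ) (pointFun_mem Ψ)
    (fun i => (pointHom Ψ).toLinearMap.comp (V.secHom i))
    (fun i σ => pointHom_mem Ψ (V.ofSec_mem i σ)) hBu Θ hΘ hΘu gS
    (fun i σ => by
      refine add_mem ?_ (Submodule.smul_mem _ _ (χ'.map_mem (univSec_mem s i σ)))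
      have := pointDer_mem Ψ (V.ofSec_mem (i + 1) σ)
      rwa [show -(i + 1) + 1 = -i by ring] at this) hSu
  have hU : ∀ i σ, χ (univSec s i σ) = pointDer Ψ (V.ofSec (i + 1) σ) := by
    intro i σ
    refine eq_of_bump (pointFun Ψ) fun y => ?_
    obtain ⟨k, q, hk, hq, e⟩ := exists_bump_univSec (s := s) i σ (basePoint (pointFun Ψ) y)
    refine ⟨k, hk, ?_⟩
    have hqq : χ.toAlgHom q = χ'.toAlgHom q := noShift_congr (fun f => (hf f).trans (h'f f).symm)
      (fun i σ => (hB i σ).trans (h'B i σ).symm) (fun f => (hF _).trans (h'F _).symm) hq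
    -- Up to a bump function the universal derivative is the shifted generator plus `q`, and `χ`,
    -- `χ'` agree on `q`. Comparing with `c2`, the image of `q` cancels the subtracted term in `gS`.
    have c1 : pointFun Ψ k * χ (univSec s i σ) = pointFun Ψ k * (gS i σ + χ.toAlgHom q) := by
      rw [← hf k, ← hS i σ]
      refine (map_mul χ.toAlgHom _ _).symm.trans ((congrArg χ.toAlgHom e).trans
        ((map_mul χ.toAlgHom _ _).trans ?_))
      exact congrArg (χ.toAlgHom _ * ·) (map_add χ.toAlgHom _ _)
    have c2 : pointFun Ψ k * χ' (univSec s i σ) = pointFun Ψ k * χ'.toAlgHom q := by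
      rw [← h'f k]
      refine (map_mul χ'.toAlgHom _ _).symm.trans ((congrArg χ'.toAlgHom e).trans
        ((map_mul χ'.toAlgHom _ _).trans ?_))
      refine congrArg (χ'.toAlgHom _ * ·) ((map_add χ'.toAlgHom _ _).trans ?_)
      exact (congrArg (· + χ'.toAlgHom q) (h'S i σ)).trans (zero_add _)
    refine c1.trans ?_
    rw [hqq, mul_add, ← c2, hgS]
    refine evalHom_injective fun y => ?_
    simp only [map_add, map_mul, map_smul]
    simp only [neg_one_smul, mul_add, mul_neg, neg_add_cancel_right]
  exact ⟨χ, restrict_univPoint_eq s hf hB (fun f => (hF _).trans (hΘd f)) hU⟩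

end GVB

/-! ### The splitting induced by a connection -/

namespace GrMfd

/-- Every graded manifold is a retract of some `𝔖(W)`. -/
theorem exists_retract (T : GrMfd) : ∃ (N : Mfd) (W : GVB N) (g : W.toGrMfd ⟶ T)
    (g' : T ⟶ W.toGrMfd), g' ≫ g = 𝟙 T := by
  obtain ⟨N, W, e, he⟩ := T.split
  let g : T.gr →ₐᵍ[ℝ] sumGrading W.SSec := ⟨e.toAlgHom, fun {k a} ha => (he k a).1 ha⟩
  let g' : sumGrading W.SSec →ₐᵍ[ℝ] T.gr := ⟨e.symm.toAlgHom, fun {k a} ha => (he k _).2 (by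
    change e (e.symm a) ∈ _
    rw [e.apply_symm_apply]
    exact ha)⟩
  refine ⟨N, W, g, g', ?_⟩
  have : g'.comp g = GradedAlgHom.id ℝ T.gr := by
    ext a
    exact e.symm_apply_apply a
  exact this

end GrMfd

namespace FatPoint

variable {X T T' T'' : GrMfd}

theorem restrict_restrict (Ψ : FatPoint X T) (g : T' ⟶ T) (g' : T'' ⟶ T') :
    (Ψ.restrict g).restrict g' = Ψ.restrict (g' ≫ g) :=
  FatPoint.ext fun a => (AlgHom.congr_fun (GrMfd.fatMap_comp g g') (Ψ.hom a)).symm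

theorem restrict_id (Ψ : FatPoint X T) : Ψ.restrict (𝟙 T) = Ψ :=
  FatPoint.ext fun a => AlgHom.congr_fun (GrMfd.fatMap_id T) (Ψ.hom a)

end FatPoint

namespace GVB

variable {M N : Mfd} {V : GVB M} {s : V.DualConnection}

/-- Encodings restrict along the retraction from some 𝔖(W), where uniqueness is known; the section
of the retraction brings the equality back to `T`. -/
theorem Encodes.eq {T : GrMfd} {Ψ : FatPoint V.toGrMfd T} {χ χ' : T ⟶ V.T1.toGrMfd}
    (h : Encodes s Ψ χ) (h' : Encodes s Ψ χ') : χ = χ' := by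
  obtain ⟨N, W, g, g', hg⟩ := T.exists_retract
  have := congrArg (g' ≫ ·) ((h.restrict g).unique (h'.restrict g))
  simpa only [← Category.assoc, hg, Category.id_comp] using this

theorem encodes_restrict_univPoint (s : V.DualConnection) {T : GrMfd} (χ : T ⟶ V.T1.toGrMfd) :
    Encodes s ((univPoint s).restrict χ) χ := by
  have := (encodes_univPoint s).restrict χ
  rwa [Category.comp_id] at this

/-- Representability of T[1]𝔖(V). Equal restrictions are encoded by both morphisms, which therefore
coincide; surjectivity is transported from 𝔖(W) along a retraction. -/
theorem bijective_restrict_univPoint (s : V.DualConnection) (T : GrMfd) :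
    Function.Bijective fun χ : T ⟶ V.T1.toGrMfd => (univPoint s).restrict χ := by
  refine ⟨fun χ χ' h => ?_, fun Ψ => ?_⟩
  · have h1 := encodes_restrict_univPoint s χ
    have h2 := encodes_restrict_univPoint s χ'
    have h3 : (univPoint s).restrict χ = (univPoint s).restrict χ' := h
    rw [← h3] at h2
    exact h1.eq h2
  · obtain ⟨N, W, g, g', hg⟩ := T.exists_retract
    obtain ⟨χ, hχ⟩ := exists_eq_restrict s (Ψ.restrict g)
    refine ⟨g' ≫ χ, ?_⟩
    change (univPoint s).restrict (g' ≫ χ) = Ψ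
    rw [← FatPoint.restrict_restrict, hχ, FatPoint.restrict_restrict, hg, FatPoint.restrict_id]

/-- The splitting induced by a connection. -/
def splitting (s : V.DualConnection) :
    tangentPresheaf.obj V.toGrMfd ≅ yoneda.obj V.T1.toGrMfd :=
  (NatIso.ofComponents (F := yoneda.obj V.T1.toGrMfd) (G := tangentPresheaf.obj V.toGrMfd)
    (fun T => (Equiv.ofBijective _ (bijective_restrict_univPoint s T.unop)).toIso)
    (fun {T T'} g => by
      ext χ : 3
      exact (FatPoint.restrict_restrict (univPoint s) χ g.unop).symm)).symm

/-- The splitting inverts restriction of the universal point, so `Ψ` is the restriction along its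
own image and is encoded by it. -/
theorem splitting_isInduced (s : V.DualConnection) : IsInducedSplitting s (splitting s) := by
  intro T Ψ
  have h := encodes_restrict_univPoint s ((splitting s).hom.app (Opposite.op T) Ψ)
  have e : (univPoint s).restrict ((splitting s).hom.app (Opposite.op T) Ψ) = Ψ :=
    (Equiv.ofBijective _ (bijective_restrict_univPoint s T)).apply_symm_apply Ψ
  rwa [e] at h

theorem existsUnique_splitting (s : V.DualConnection) :
    ∃! sp : tangentPresheaf.obj V.toGrMfd ≅ yoneda.obj V.T1.toGrMfd, IsInducedSplitting s sp := by
  refine ⟨splitting s, splitting_isInduced s, fun sp h => ?_⟩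
  refine Iso.ext (NatTrans.ext (funext fun T => ?_))
  ext Ψ : 3
  exact (h T.unop Ψ).eq (splitting_isInduced s T.unop Ψ)

/-! ### Naturality in the graded vector bundle -/

variable {W : GVB N} {φ : M.Map N} (L : Hom V W φ)

theorem toSection_algMap (a : W.Alg) : V.toSection (L.algMap a) = L.pull (W.toSection a) := by
  induction a using DirectSum.induction_on with
  | zero =>
    rw [map_zero W.toSection, map_zero L.pull]
    exact (congrArg V.toSection (map_zero L.algMap.toAlgHom)).trans (map_zero _)
  | add a b ha hb =>
    rw [map_add W.toSection, map_add L.pull, ← ha, ← hb]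
    exact (congrArg V.toSection (map_add L.algMap.toAlgHom a b)).trans (map_add _ _ _)
  | of k a =>
    have h : L.algMap (DirectSum.lof ℝ ℤ (fun k => W.SSec k) k a) = V.ofSection k (L.pullDeg k a) :=
      DirectSum.toModule_lof ℝ (φ := fun k =>
        DirectSum.lof ℝ ℤ (fun k => V.SSec k) k ∘ₗ L.pullDeg k) k a
    refine (congrArg V.toSection h).trans ((V.toSection_lof k _).trans ?_)
    exact congrArg L.pull (W.toSection_lof k a).symm

theorem algMap_ofFun (f : N.Fun) : L.algMap (W.ofFun f) = V.ofFun (f.comp φ) := by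
  refine toSection_injective fun x => ?_
  rw [toSection_algMap, toSection_ofFun]
  refine (congrArg (L.fibMap x) (W.toSection_ofFun f (φ x))).trans ?_
  exact (L.fibMap x).commutes _

theorem algMap_ofSec (i : ℤ) (σ : (W i).dual.Sec) :
    L.algMap (W.ofSec i σ) = V.ofSec i ((L i).pullSec σ) := by
  refine toSection_injective fun x => ?_
  rw [toSection_algMap, toSection_ofSec]
  refine (congrArg (L.fibMap x) (W.toSection_ofSec i σ (φ x))).trans ?_
  exact GSym.map_gen (fun i : ℤ => -i) (P := fun i => (W i).dual.fib (φ x))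
    (Q := fun i => (V i).dual.fib x) (L.dualMap x) i (σ (φ x))

/-- Pull-back of sections of jet bundles. -/
def _root_.GradedGeometry.VB.Hom.pullJet {X : VB M} {Y : VB N} (K : VB.Hom X Y φ) :
    Y.dual.JetSec →ₗ[ℝ] X.dual.JetSec where
  toFun θ := ⟨fun x => K.jetMap x (θ.1 (φ x)), fun x₀ => by
    obtain ⟨U, hU, n, g, τ, h⟩ := θ.2 (φ x₀)
    refine ⟨φ ⁻¹' U, φ.contMDiff.continuous.continuousAt hU, n, fun i => (g i).comp φ,
      fun i => K.pullSec (τ i), fun x hx => ?_⟩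
    refine (congrArg (K.jetMap x) (h (φ x) hx)).trans ((map_sum (K.jetMap x) _ _).trans ?_)
    refine Finset.sum_congr rfl fun i _ => ?_
    rw [map_smul]
    rfl⟩
  map_add' θ θ' := Subtype.ext (funext fun x => map_add (K.jetMap x) _ _)
  map_smul' r θ := Subtype.ext (funext fun x => map_smul (K.jetMap x) _ _)

/-! ### Push-forward of encodings along a compatible morphism -/

variable {L} {s' : W.DualConnection}

/-- Every generator of the target is pulled back to the corresponding generator of the source; for
exact forms this is the chain rule d(f∘φ) = (Tφ)*df. The jet extension of the pushed point is the
old one precomposed with J¹L*. -/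
theorem Encodes.push (hs : L.Compatible s s') {T : GrMfd} {Ψ : FatPoint V.toGrMfd T}
    {χ : T ⟶ V.T1.toGrMfd} (h : Encodes s Ψ χ) :
    Encodes s' (Ψ.push L.toGrMfd) (χ ≫ L.T1.toGrMfd) where
  on_fun f := by
    refine (congrArg (GrMfd.pull χ) (algMap_ofFun L.T1 f)).trans ((h.on_fun _).trans ?_)
    exact congrArg Ψ.part₀ (algMap_ofFun L f).symm
  on_base i σ := by
    refine (congrArg (GrMfd.pull χ) (algMap_ofSec L.T1 i _)).trans
      ((h.on_base i ((L i).pullSec σ)).trans ?_)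
    exact congrArg Ψ.part₀ (algMap_ofSec L i σ).symm
  on_form f := by
    have e : (L.T1 (-1)).pullSec (W.inclForm (VB.d f)) = V.inclForm (VB.d (f.comp φ)) := by
      rw [VB.d_comp]
      rfl
    refine (congrArg (GrMfd.pull χ) (algMap_ofSec L.T1 (-1) _)).trans ?_
    refine (congrArg (fun τ => GrMfd.pull χ (V.T1.ofSec (-1) τ)) e).trans ((h.on_form _).trans ?_)
    exact congrArg Ψ.part₁ (algMap_ofFun L f).symm
  on_shift i := by
    obtain ⟨J, hJ⟩ := h.on_shift i
    refine ⟨⟨J.toLin ∘ₗ (L (i + 1)).pullJet, fun f θ => ?_, fun σ => ?_⟩, fun σ => ?_⟩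
    · have e : (L (i + 1)).pullJet ((W (i + 1)).dual.smulJet f θ) =
          (V (i + 1)).dual.smulJet (f.comp φ) ((L (i + 1)).pullJet θ) :=
        Subtype.ext (funext fun x => map_smul ((L (i + 1)).jetMap x) _ _)
      refine (congrArg J.toLin e).trans ((J.map_smul _ _).trans ?_)
      exact congrArg (fun a => Ψ.part₀ a * J.toLin ((L (i + 1)).pullJet θ)) (algMap_ofFun L f).symm
    · refine (J.map_jet ((L (i + 1)).pullSec σ)).trans ?_
      exact congrArg Ψ.part₁ (algMap_ofSec L (i + 1) σ).symm
    · refine (congrArg (GrMfd.pull χ) (algMap_ofSec L.T1 i _)).trans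
        ((hJ ((L (i + 1)).pullSec σ)).trans (congrArg J.toLin ?_))
      -- The only place where compatibility of the connections enters.
      exact Subtype.ext (funext fun x => (hs (i + 1) x (σ (φ x))).symm)

/-- Both sides send `Ψ` to a morphism encoding the pushed point with respect to `s'`, and there is
only one. -/
theorem splitting_naturality (hs : L.Compatible s s')
    {sp : tangentPresheaf.obj V.toGrMfd ≅ yoneda.obj V.T1.toGrMfd}
    {sp' : tangentPresheaf.obj W.toGrMfd ≅ yoneda.obj W.T1.toGrMfd}
    (h : IsInducedSplitting s sp) (h' : IsInducedSplitting s' sp') :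
    tangentPresheaf.map L.toGrMfd ≫ sp'.hom = sp.hom ≫ yoneda.map L.T1.toGrMfd := by
  refine NatTrans.ext (funext fun T => ?_)
  ext Ψ : 3
  exact (h' T.unop (Ψ.push L.toGrMfd)).eq ((h T.unop Ψ).push hs)

end GVB

end GradedGeometry

end

theorem mainTheorem7 {M N : GradedGeometry.Mfd} {φ : M.Map N}
    {E : GradedGeometry.GVB M} {F : GradedGeometry.GVB N} (L : GradedGeometry.GVB.Hom E F φ)
    (s : E.DualConnection) (s' : F.DualConnection)
    (hs : GradedGeometry.GVB.Hom.Compatible L s s') :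
    (∃! sp : GradedGeometry.tangentPresheaf.obj E.toGrMfd ≅ CategoryTheory.yoneda.obj E.T1.toGrMfd,
        GradedGeometry.GVB.IsInducedSplitting s sp) ∧
      (∃! sp' : GradedGeometry.tangentPresheaf.obj F.toGrMfd ≅ CategoryTheory.yoneda.obj F.T1.toGrMfd,
        GradedGeometry.GVB.IsInducedSplitting s' sp') ∧
      ∀ (sp : GradedGeometry.tangentPresheaf.obj E.toGrMfd ≅ CategoryTheory.yoneda.obj E.T1.toGrMfd)
        (sp' : GradedGeometry.tangentPresheaf.obj F.toGrMfd ≅ CategoryTheory.yoneda.obj F.T1.toGrMfd),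
        GradedGeometry.GVB.IsInducedSplitting s sp →
        GradedGeometry.GVB.IsInducedSplitting s' sp' →
          GradedGeometry.tangentPresheaf.map (GradedGeometry.GVB.Hom.toGrMfd L) ≫ sp'.hom =
            sp.hom ≫ CategoryTheory.yoneda.map
              (GradedGeometry.GVB.Hom.toGrMfd (GradedGeometry.GVB.Hom.T1 L)) := by
  exact ⟨GradedGeometry.GVB.existsUnique_splitting s, GradedGeometry.GVB.existsUnique_splitting s',
    fun _ _ h h' => GradedGeometry.GVB.splitting_naturality hs h h'⟩
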